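/- **Setting.** Let $n,k\ge 0$ be integers and let $\phi(x,y)$ be holomorphic near $(x_0,y_0)\in\mathbf C^n\times\mathbf R^n$ with $\Im\phi''_{yy}(x_0,y_0)>0$, $\det\phi''_{xy}(x_0,y_0)\ne0$ and $-\phi'_y(x_0,y_0)=\eta_0\in\mathbf R^n$. Put $\rho_0=(y_0,\eta_0)$, $\xi_0=\phi'_x(x_0,y_0)$, let $\kappa_T:(y,-\phi'_y(x,y))\mapsto(x,\phi'_x(x,y))$ be the associated complex canonical transformation, let $\Phi_0(x)=\sup_{y}(-\Im\phi(x,y))$ for $x$ near $x_0$, the supremum being over real $y$ in a small neighbourhood of $y_0$, and let $\Lambda_{\Phi_0}=\{(x,\frac2i\partial_x\Phi_0(x))\}$, where $\partial_x$ is the holomorphic derivative. Let $\widetilde p$ be a smooth complex-valued function near $(x_0,\xi_0)$ in $\mathbf C^{2n}$ with $\overline\partial\widetilde p=\mathcal O(\mathrm{dist}(\cdot,\Lambda_{\Phi_0})^\infty)$, and let $p=\widetilde p\circ\kappa_T$ on $\mathbf R^{2n}$ near $\rho_0$. Assume $\Re p\ge0$ near $\rho_0$ and, with $H_f=\partial_\eta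 f\cdot\partial_y-\partial_yf\cdot\partial_\eta$, $$H_{\Im p}^j\Re p(\rho_0)=0\ \ (j<k),\qquad H_{\Im p}^k\Re p(\rho_0)>0 .$$ Let $\Phi_t(x)$ be real-valued, smooth near $(0,x_0)$ in $[0,\infty)\times\mathbf C^n$, equal to $\Phi_0$ at $t=0$, and a solution there of the real Hamilton–Jacobi equation $$\partial_t\Phi_t+\Re\widetilde p\Big(x,\frac2i\frac{\partial\Phi_t}{\partial x}\Big)=0 .$$ **Conclusions.** (1) For $(t,y,\eta)$ near $(0,\rho_0)$, $t\ge0$, the critical value $$G_t(y,\eta)=\mathrm{v.c.}_{x,\theta}\big(\Im\phi(x,y+i\theta)+\eta\cdot\theta+\Phi_t(x)\big),\qquad (x,\theta)\in\mathbf C^n\times\mathbf R^n,$$ taken at a critical point that tends to $(x_0,0)$ as $(t,y,\eta)\to(0,\rho_0)$, exists; and for every function $G$ given by such critical values there is $C>0$ with $G_t(\rho)\le-t^{k+1}/C$ for all $(t,\rho)$ in a neighbourhood of $(0,\rho_0)$ in $[0,\infty)\times\mathbf R^{2n}$. (2) There is $C>0$ with $\Phi_t(x)\le\Phi_0(x)-t^{k+1}/C$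 for all $(t,x)$ in a neighbourhood of $(0,x_0)$ in $[0,\infty)\times\mathbf C^n$. (3) Let $\Psi_t(x,\theta)$ be complex-valued and smooth near $(0,x_0,\overline{x_0})$ in $[0,\infty)\times\mathbf C^n\times\mathbf C^n$, with $\Psi_0(x,\overline x)=\Phi_0(x)$, and such that $\overline\partial_{x,\theta}\Psi_t$ and $2\partial_t\Psi_t+\widetilde p(x,\frac2i\partial_x\Psi_t)$ are $\mathcal O((t+|\theta-\overline x|)^\infty)$. Let $a_t(x,\theta;h)$ be complex-valued, continuous in $(t,x,\theta)$ and bounded, uniformly for small $h>0$, in an $h$-independent neighbourhood of $(0,x_0,\overline{x_0})$, $t\ge0$. For open $V$ and with Lebesgue measure $L(dy)$ put $$\widetilde U(t)u(x)=h^{-n}\int_V e^{\frac2h\Psi_t(x,\overline y)}a_t(x,\overline y;h)u(y)e^{-\frac2h\Phi_0(y)}L(dy),$$ (the microlocal semigroup $e^{-t\widetilde P/h}$ of a pseudodifferential operator $\widetilde P$ with leading symbol $\widetilde p$ is constructed in this form, for suitable $a$). Then for every $\delta>0$ there are $r,C,h_0>0$ such that for all open $W\subseteq V\subseteq B(x_0,r)$,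 all $0<h\le h_0$, all $0\le t\le h^\delta$ and all $u$ holomorphic in $V$ with $u\in L^2(V,e^{-2\Phi_0/h}L(dx))$, $$\|\widetilde U(t)u\|_{L^2(W,e^{-2\Phi_0/h}L(dx))}\le C\,e^{-t^{k+1}/(Ch)}\,\|u\|_{L^2(V,e^{-2\Phi_0/h}L(dx))}.$$ -/

import Mathlib

open Set Filter Topology MeasureTheory
open scoped ContDiff

namespace FBI

/-- Real position (or momentum) space. All norms on it are equivalent, and only neighbourhoods and
orders of magnitude are used below, so the sup norm of the function space is harmless. -/
abbrev Rn (n : ℕ) : Type := Fin n → ℝ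

/-- The complex space `ℂⁿ`; its `volume` is Lebesgue measure. -/
abbrev Cn (n : ℕ) : Type := Fin n → ℂ

/-- The inclusion of `ℝⁿ` in `ℂⁿ`. -/
def toC {n : ℕ} (y : Rn n) : Cn n := fun j => (y j : ℂ)

/-- Componentwise complex conjugation. -/
def conjC {n : ℕ} (x : Cn n) : Cn n := fun j => (starRingEnd ℂ) (x j)

section Derivatives

variable {E : Type*} [NormedAddCommGroup E] [NormedSpace ℝ E] [Module ℂ E]

/-- The complex linear part `∂f(z)(v) = (df(z)(v) - i df(z)(i v)) / 2` of the real differential. -/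
noncomputable def del (f : E → ℂ) (z v : E) : ℂ :=
  (fderiv ℝ f z v - Complex.I * fderiv ℝ f z (Complex.I • v)) / 2

/-- The antilinear part `∂̄f(z)(v) = (df(z)(v) + i df(z)(i v)) / 2` of the real differential. -/
noncomputable def dbar (f : E → ℂ) (z v : E) : ℂ :=
  (fderiv ℝ f z v + Complex.I * fderiv ℝ f z (Complex.I • v)) / 2

end Derivatives

/-- The vector of holomorphic derivatives `∂f/∂x_j = (∂f/∂Re x_j + (1/i) ∂f/∂Im x_j) / 2`. -/
noncomputable def pd {n : ℕ} (f : Cn n → ℂ) (x : Cn n) : Cn n :=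
  fun j => del f x (Pi.single j 1)

/-- `f` is smooth in a neighbourhood of `a` in `S`. -/
def SmoothNear {E F : Type*} [NormedAddCommGroup E] [NormedSpace ℝ E]
    [NormedAddCommGroup F] [NormedSpace ℝ F] (f : E → F) (S : Set E) (a : E) : Prop :=
  ∃ U ∈ 𝓝[S] a, ContDiffOn ℝ ∞ f U

/-- The neighbourhoods of `(0, a)` in `[0, ∞) × E`. -/
def halfNhds {E : Type*} [TopologicalSpace E] (a : E) : Filter (ℝ × E) :=
  𝓝[Ici (0 : ℝ) ×ˢ (univ : Set E)] ((0 : ℝ), a)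

/-- The derivation `H_f g = ∂f/∂η · ∂g/∂y - ∂f/∂y · ∂g/∂η` on real phase space. -/
noncomputable def hamD {n : ℕ} (f g : Rn n × Rn n → ℝ) : Rn n × Rn n → ℝ := fun ρ =>
  ∑ j, (fderiv ℝ f ρ (0, Pi.single j 1) * fderiv ℝ g ρ (Pi.single j 1, 0) -
    fderiv ℝ f ρ (Pi.single j 1, 0) * fderiv ℝ g ρ (0, Pi.single j 1))

/-- `φ` is the phase of a generalized Bargmann (FBI) transform near `(x₀, y₀) ∈ ℂⁿ × ℝⁿ`:
holomorphic, `Im φ''_{yy} > 0`, `det φ''_{xy} ≠ 0` and `-φ'_y = η₀ ∈ ℝⁿ` at `(x₀, y₀)`. -/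
structure IsFBIPhase {n : ℕ} (φ : Cn n → Cn n → ℂ) (x₀ : Cn n) (y₀ η₀ : Rn n) : Prop where
  holo : AnalyticAt ℂ (fun z : Cn n × Cn n => φ z.1 z.2) (x₀, toC y₀)
  pos : (Matrix.of fun i j : Fin n =>
    (pd (fun y => pd (φ x₀) y j) (toC y₀) i).im).PosDef
  nondeg : (Matrix.of fun i j : Fin n =>
    pd (fun x => pd (φ x) (toC y₀) j) x₀ i).det ≠ 0
  real : -pd (φ x₀) (toC y₀) = toC η₀

/-- The graph of the complex canonical transformation
`κ_T : (y, -φ'_y(x, y)) ↦ (x, φ'_x(x, y))`. -/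
def kappaGraph {n : ℕ} (φ : Cn n → Cn n → ℂ) : Set ((Cn n × Cn n) × (Cn n × Cn n)) :=
  {w | w.1.2 = -pd (φ w.2.1) w.1.1 ∧ w.2.2 = pd (fun x => φ x w.1.1) w.2.1}

/-- `Φ₀(x) = sup_y (-Im φ(x, y))` for `x` near `x₀`, the supremum being over the real `y` in a
small fixed neighbourhood of `y₀`. -/
def IsFBIWeight {n : ℕ} (φ : Cn n → Cn n → ℂ) (x₀ : Cn n) (y₀ : Rn n) (Φ₀ : Cn n → ℝ) : Prop :=
  ∀ᶠ r in 𝓝[>] (0 : ℝ), ∀ᶠ x in 𝓝 x₀,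
    IsLUB ((fun y : Rn n => -(φ x (toC y)).im) '' Metric.ball y₀ r) (Φ₀ x)

/-- The covector `(2/i) ∂F/∂x` for a complex-valued (in particular a real-valued) `F`. -/
noncomputable def cov {n : ℕ} (F : Cn n → ℂ) (x : Cn n) : Cn n :=
  (2 / Complex.I) • pd F x

/-- The covector `(2/i) ∂Φ/∂x` of a real weight `Φ`. -/
noncomputable def wcov {n : ℕ} (Φ : Cn n → ℝ) (x : Cn n) : Cn n :=
  cov (fun x' => (Φ x' : ℂ)) x

/-- The I-Lagrangian manifold `Λ_Φ = {(x, (2/i) ∂Φ/∂x)}`. -/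
def LambdaSet {n : ℕ} (Φ : Cn n → ℝ) : Set (Cn n × Cn n) :=
  {z | z.2 = wcov Φ z.1}

/-- `p̃` is smooth near `z₀` and almost holomorphic on `Λ`: `∂̄p̃ = O(dist(·, Λ)^∞)` near `z₀`. -/
def IsAlmostHolo {n : ℕ} (pt : Cn n × Cn n → ℂ) (Λ : Set (Cn n × Cn n)) (z₀ : Cn n × Cn n) :
    Prop :=
  SmoothNear pt univ z₀ ∧
    ∀ (N : ℕ) (v : Cn n × Cn n),
      (fun z => dbar pt z v) =O[𝓝 z₀] fun z => Metric.infDist z Λ ^ N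

/-- `p = p̃ ∘ κ_T` on the real phase space, near `(y₀, η₀)`. -/
def IsPullback {n : ℕ} (φ : Cn n → Cn n → ℂ) (x₀ ξ₀ : Cn n) (y₀ η₀ : Rn n)
    (pt : Cn n × Cn n → ℂ) (p : Rn n × Rn n → ℂ) : Prop :=
  ∀ᶠ w in 𝓝 (((y₀, η₀) : Rn n × Rn n), ((x₀, ξ₀) : Cn n × Cn n)),
    ((toC w.1.1, toC w.1.2), w.2) ∈ kappaGraph φ → p w.1 = pt w.2

/-- `Φ_t` is smooth near `(0, x₀)` in `[0, ∞) × ℂⁿ` and solves there the real Hamilton-Jacobi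
equation `∂_t Φ_t + Re p̃(x, (2/i) ∂Φ_t/∂x) = 0`. -/
def SolvesHJ {n : ℕ} (pt : Cn n × Cn n → ℂ) (x₀ : Cn n) (Φ : ℝ → Cn n → ℝ) : Prop :=
  SmoothNear (fun q : ℝ × Cn n => Φ q.1 q.2) (Ici (0 : ℝ) ×ˢ univ) (0, x₀) ∧
    ∀ᶠ q in halfNhds x₀,
      HasDerivWithinAt (fun s => Φ s q.2) (-(pt (q.2, wcov (Φ q.1) q.2)).re) (Ici 0) q.1

/-- The function `(x, θ) ↦ Im φ(x, y + iθ) + η · θ + Φ(x)` on `ℂⁿ × ℝⁿ`. -/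
noncomputable def critFun {n : ℕ} (φ : Cn n → Cn n → ℂ) (Φ : Cn n → ℝ) (y η : Rn n) :
    Cn n × Rn n → ℝ :=
  fun z => (φ z.1 (toC y + Complex.I • toC z.2)).im + ∑ j, η j * z.2 j + Φ z.1

/-- `G_t(y, η)` is, for `(t, y, η)` near `(0, y₀, η₀)`, `t ≥ 0`, the critical value with respect to
`(x, θ)` of `Im φ(x, y + iθ) + η · θ + Φ_t(x)`, the critical point being the one that tends to
`(x₀, 0)` as `(t, y, η) → (0, y₀, η₀)`. -/
def IsRealWeight {n : ℕ} (φ : Cn n → Cn n → ℂ) (x₀ : Cn n) (y₀ η₀ : Rn n)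
    (Φ : ℝ → Cn n → ℝ) (G : ℝ → Rn n × Rn n → ℝ) : Prop :=
  ∀ ε > 0, ∀ᶠ q in halfNhds ((y₀, η₀) : Rn n × Rn n),
    ∃ z ∈ Metric.ball ((x₀, 0) : Cn n × Rn n) ε,
      HasFDerivAt (critFun φ (Φ q.1) q.2.1 q.2.2) (0 : Cn n × Rn n →L[ℝ] ℝ) z ∧
        G q.1 q.2 = critFun φ (Φ q.1) q.2.1 q.2.2 z

/-- `f(t, x, θ)` vanishes to infinite order at `t = 0`, `θ = x̄`, near `(0, x₀, x̄₀)`. -/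
def VanishesToInfiniteOrder {n : ℕ} (x₀ : Cn n) (f : ℝ × (Cn n × Cn n) → ℂ) : Prop :=
  ∀ N : ℕ, f =O[halfNhds ((x₀, conjC x₀) : Cn n × Cn n)]
    fun q => (q.1 + ‖q.2.2 - conjC q.2.1‖) ^ N

/-- `Ψ_t(x, θ)` is a phase of the microlocal semigroup of `p̃`: smooth near `(0, x₀, x̄₀)` for
`t ≥ 0`, equal to `Φ₀(x)` at `t = 0`, `θ = x̄`, and, to infinite order at `t = 0`, `θ = x̄`,
holomorphic in `(x, θ)` and a solution of the eikonal equation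
`2 ∂_t Ψ + p̃(x, (2/i) ∂_x Ψ) = 0`. -/
structure IsSemigroupPhase {n : ℕ} (pt : Cn n × Cn n → ℂ) (x₀ : Cn n) (Φ₀ : Cn n → ℝ)
    (Ψ : ℝ → Cn n → Cn n → ℂ) : Prop where
  smooth : SmoothNear (fun q : ℝ × (Cn n × Cn n) => Ψ q.1 q.2.1 q.2.2)
    (Ici (0 : ℝ) ×ˢ univ) (0, (x₀, conjC x₀))
  initial : ∀ᶠ x in 𝓝 x₀, Ψ 0 x (conjC x) = (Φ₀ x : ℂ)
  almostHolo : ∀ v : Cn n × Cn n, VanishesToInfiniteOrder x₀ fun q =>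
    dbar (fun z : Cn n × Cn n => Ψ q.1 z.1 z.2) q.2 v
  eikonal : VanishesToInfiniteOrder x₀ fun q =>
    2 * derivWithin (fun s => Ψ s q.2.1 q.2.2) (Ici 0) q.1 +
      pt (q.2.1, cov (fun x => Ψ q.1 x q.2.2) q.2.1)

/-- The amplitudes `a_t(x, θ; h)`: continuous in `(t, x, θ)` in a neighbourhood of `(0, x₀, x̄₀)`,
`t ≥ 0`, that does not depend on `h`, and bounded there uniformly in `h ∈ (0, h₁]`. -/
def IsBoundedAmplitude {n : ℕ} (x₀ : Cn n) (a : ℝ → ℝ → Cn n → Cn n → ℂ) : Prop :=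
  ∃ U ∈ halfNhds ((x₀, conjC x₀) : Cn n × Cn n), ∃ h₁ > (0 : ℝ), ∃ M : ℝ,
    ∀ h ∈ Ioc 0 h₁, ContinuousOn (fun q : ℝ × (Cn n × Cn n) => a h q.1 q.2.1 q.2.2) U ∧
      ∀ q ∈ U, ‖a h q.1 q.2.1 q.2.2‖ ≤ M

/-- `Ũ(t)u(x) = h⁻ⁿ ∫_V e^{2 Ψ_t(x, ȳ)/h} a_t(x, ȳ; h) u(y) e^{-2 Φ₀(y)/h} L(dy)`. -/
noncomputable def semigroupOp {n : ℕ} (Φ₀ : Cn n → ℝ) (Ψ : ℝ → Cn n → Cn n → ℂ)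
    (a : ℝ → ℝ → Cn n → Cn n → ℂ) (V : Set (Cn n)) (h t : ℝ) (u : Cn n → ℂ) : Cn n → ℂ :=
  fun x => ((h ^ n)⁻¹ : ℝ) * ∫ y in V,
    Complex.exp (2 * Ψ t x (conjC y) / h) * a h t x (conjC y) * u y *
      (Real.exp (-2 * Φ₀ y / h) : ℂ)

/-- The norm of `L²(V, e^{-2Φ/h} L(dx))`. -/
noncomputable def wNorm {n : ℕ} (Φ : Cn n → ℝ) (h : ℝ) (V : Set (Cn n)) (u : Cn n → ℂ) : ENNReal :=
  (∫⁻ x in V, ‖u x‖ₑ ^ 2 * ENNReal.ofReal (Real.exp (-2 * Φ x / h))) ^ (1 / 2 : ℝ)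

/-- `H_Φ(V)`: the holomorphic functions in `L²(V, e^{-2Φ/h} L(dx))`. -/
def HSpace {n : ℕ} (Φ : Cn n → ℝ) (h : ℝ) (V : Set (Cn n)) : Set (Cn n → ℂ) :=
  {u | DifferentiableOn ℂ u V ∧ wNorm Φ h V u < ⊤}

end FBI

/-!
All three conclusions come from one comparison argument for the *defect* `d = Φ₀ - Φ_t`, and for the
two-point version `d = Φ₀(x) + Φ₀(y) - 2 Re Ψ_t(x, ȳ)` (`phaseDefect`): after conjugation by the
weights, the kernel of the semigroup is of size `h⁻ⁿ exp (-d / h)`. Both satisfy the equation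
`∂ₜ d = Re p̃(x, (2/i) ∂ₓ(Φ₀ - d))`, the second one up to an error that vanishes to infinite order in
`√t + |x - y|` (`IsDefect`).

**Growth of the defect.** The real part of `p̃` is nonnegative on `Λ_{Φ₀}`, which the canonical
transformation identifies with the real phase space (`Setting.exists_chart`). So `∂ₜ d` is at least
`-L |∇d|` up to the error, and the minimum principle on backward cones (`le_of_cone_inequality`) shows
that `d` is almost nonnegative (`IsDefect.exists_lower_bound`). A function that is almost nonnegative
and has Hessian bounded above controls the square of its gradient (`IsDefect.exists_sq_norm_grad_le`).
The quadratic terms in the Taylor expansion of `p̃` at `Λ_{Φ₀}` are therefore harmless, and the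
equation becomes, up to a Grönwall factor, a transport inequality for `d` along the field
`-i ∂p̃/∂ξ`. Up to `O((Re p̃)^{1/2})` this field is the image of the Hamilton field of `Im p`
(`ChartAt.fderiv_hamVec_im`), and Young's inequality absorbs the difference in `Re p̃`. Hence `d` grows
along the flow of `H_{Im p}` at least like a multiple of the action `∫ Re p`
(`IsDefect.exists_action_lower_bound`).

**The action.** The action up to time `t` is nondecreasing in `t`, and its derivative of order `k + 1`
is `H_{Im p}^k Re p > 0`. An `m`-th difference of a nondecreasing function that vanishes at `0` is at
most `2 ^ m` times its last value, so the action is at least `c t ^ (k + 1)`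
(`le_of_iterated_deriv_lower_bound`, `Setting.exists_characteristics`).

**The conclusions.** The decay of the weight is the case `d = Φ₀ - Φ_t` (`SolvesHJ.exists_decay`). The
critical point in the definition of `G` is a saddle (`Setting.exists_isSaddle`), so it exists near the
base point (`exists_isRealWeight`), and its value is a minimax. The competitor `(X(y, η), 0)`, where
`X` is the first component of the canonical transformation, gives `G_t(y, η) ≤ (Φ_t - Φ₀)(X(y, η))`
(`IsSaddle.eventually_le`, `ChartAt.critFun`). For the semigroup, strict plurisubharmonicity of `Φ₀`
yields `phaseDefect ≥ c |x - y|²` at `t = 0`; the comparison argument transports this along the flow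
to `phaseDefect ≥ c (t ^ (k + 1) + |Z_t(x) - y|²)`, where `Z_t(x)` is the starting point of the
characteristic that ends at `x` (`IsSemigroupPhase.exists_phaseDefect_ge`). Since `Z_t` has a Lipschitz
inverse, Schur's test with Gaussian integrals gives the norm bound (`IsSemigroupPhase.exists_wNorm_le`).

The data are smooth only for `t ≥ 0`. The substitution `t = τ²` makes them smooth in a full
neighbourhood of `τ = 0` (`SmoothNear.eventually_contDiffAt_sq`), so that the implicit function theorem
and Taylor estimates apply across the boundary; this is the origin of the square roots.
-/

namespace FBI

/-! ### Taylor estimates, a minimum principle and finite differences -/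

section Calculus

variable {E : Type*} [NormedAddCommGroup E] [NormedSpace ℝ E]

/-- Second-order Taylor lower bound along a segment on which the Hessian is bounded below. -/
lemma le_of_hessian_lower_bound {f : E → ℝ} {x y : E} {c : ℝ}
    (hf : ∀ z ∈ segment ℝ x y, ContDiffAt ℝ 2 f z)
    (hc : ∀ z ∈ segment ℝ x y, c ≤ fderiv ℝ (fderiv ℝ f) z (y - x) (y - x)) :
    f x + fderiv ℝ f x (y - x) + c / 2 ≤ f y := by
  set v := y - x with hv
  have hseg : ∀ s ∈ Icc (0 : ℝ) 1, x + s • v ∈ segment ℝ x y := fun s hs => by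
    rw [segment_eq_image']; exact ⟨s, hs, rfl⟩
  have hline : ∀ s : ℝ, HasDerivAt (fun s : ℝ => x + s • v) v s := fun s => by
    simpa using ((hasDerivAt_id s).smul_const v).const_add x
  have h1 : ∀ s ∈ Icc (0 : ℝ) 1,
      HasDerivAt (fun s => f (x + s • v)) (fderiv ℝ f (x + s • v) v) s := fun s hs =>
    ((hf _ (hseg s hs)).differentiableAt (by norm_num)).hasFDerivAt.comp_hasDerivAt s (hline s)
  have h2 : ∀ s ∈ Icc (0 : ℝ) 1, HasDerivAt (fun s => fderiv ℝ f (x + s • v) v)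
      (fderiv ℝ (fderiv ℝ f) (x + s • v) v v) s := fun s hs => by
    have hd : ContDiffAt ℝ 1 (fderiv ℝ f) (x + s • v) :=
      (hf _ (hseg s hs)).fderiv_right (by norm_num)
    have := (hd.differentiableAt (by norm_num)).hasFDerivAt.comp_hasDerivAt s (hline s)
    simpa using this.clm_apply (hasDerivAt_const s v)
  have h3 : ∀ s ∈ Icc (0 : ℝ) 1, fderiv ℝ f x v + c * s ≤ fderiv ℝ f (x + s • v) v := by
    have hd : ∀ s ∈ Icc (0 : ℝ) 1, HasDerivAt (fun s => fderiv ℝ f (x + s • v) v - c * s)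
        (fderiv ℝ (fderiv ℝ f) (x + s • v) v v - c) s := fun s hs => by
      simpa using (h2 s hs).fun_sub ((hasDerivAt_id' s).const_mul c)
    have hm : MonotoneOn (fun s => fderiv ℝ f (x + s • v) v - c * s) (Icc 0 1) := by
      apply monotoneOn_of_hasDerivWithinAt_nonneg (convex_Icc 0 1)
        (fun s hs => (hd s hs).continuousAt.continuousWithinAt)
        (fun s hs => (hd s (interior_subset hs)).hasDerivWithinAt)
      intro s hs
      linarith [hc _ (hseg s (interior_subset hs))]
    intro s hs
    have := hm (left_mem_Icc.2 zero_le_one) hs hs.1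
    simp only [zero_smul, add_zero, mul_zero, sub_zero] at this
    linarith
  have hd : ∀ s ∈ Icc (0 : ℝ) 1,
      HasDerivAt (fun s => f (x + s • v) - s * fderiv ℝ f x v - c / 2 * s ^ 2)
        (fderiv ℝ f (x + s • v) v - fderiv ℝ f x v - c * s) s := fun s hs => by
    have := ((h1 s hs).sub ((hasDerivAt_id s).mul_const (fderiv ℝ f x v))).sub
      ((hasDerivAt_pow 2 s).const_mul (c / 2))
    refine this.congr_deriv ?_
    norm_num
    ring
  have hm : MonotoneOn (fun s => f (x + s • v) - s * fderiv ℝ f x v - c / 2 * s ^ 2) (Icc 0 1) := by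
    apply monotoneOn_of_hasDerivWithinAt_nonneg (convex_Icc 0 1)
      (fun s hs => (hd s hs).continuousAt.continuousWithinAt)
      (fun s hs => (hd s (interior_subset hs)).hasDerivWithinAt)
    intro s hs
    linarith [h3 s (interior_subset hs)]
  have := hm (left_mem_Icc.2 zero_le_one) (right_mem_Icc.2 zero_le_one) zero_le_one
  have hy : x + v = y := by simp [hv]
  simp only [zero_smul, add_zero, zero_mul, sub_zero, one_smul, one_mul, hy] at this
  norm_num at this
  linarith

/-- Second-order Taylor upper bound along a segment on which the Hessian is bounded above. -/
lemma le_of_hessian_upper_bound {f : E → ℝ} {x y : E} {c : ℝ}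
    (hf : ∀ z ∈ segment ℝ x y, ContDiffAt ℝ 2 f z)
    (hc : ∀ z ∈ segment ℝ x y, fderiv ℝ (fderiv ℝ f) z (y - x) (y - x) ≤ c) :
    f y ≤ f x + fderiv ℝ f x (y - x) + c / 2 := by
  have hneg : fderiv ℝ (fun z => -f z) = fun z => -fderiv ℝ f z := by
    ext z; simp [fderiv_fun_neg]
  have := le_of_hessian_lower_bound (f := fun z => -f z) (c := -c) (fun z hz => (hf z hz).neg)
    (fun z hz => by
      rw [hneg, fderiv_fun_neg]
      simp only [neg_apply]
      exact neg_le_neg (hc z hz))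
  rw [hneg] at this
  simp only [neg_apply] at this
  linarith

/-- A linear form which is bounded below on a ball, up to a quadratic term, by `-A` has squared norm
at most `4 M A`. This is the estimate `|∇f|² ≤ 4 M f` for nonnegative functions. -/
lemma sq_norm_le_of_quadratic_nonneg (l : E →L[ℝ] ℝ) {A M σ : ℝ} (hM : 0 < M)
    (hl : ‖l‖ ≤ 2 * M * σ) (h : ∀ v, ‖v‖ ≤ σ → 0 ≤ A + l v + M * ‖v‖ ^ 2) :
    ‖l‖ ^ 2 ≤ 4 * M * A := by
  set s := ‖l‖ / (2 * M) with hs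
  have hs0 : 0 ≤ s := by positivity
  have hsσ : s ≤ σ := by rw [hs, div_le_iff₀ (by positivity)]; linarith
  have hls : ‖l‖ = 2 * M * s := by rw [hs]; field_simp
  have hA0 : 0 ≤ A := by simpa using h 0 (by simpa using hs0.trans hsσ)
  rcases hs0.eq_or_lt with h0 | hspos
  · rw [hls, ← h0]; simp; positivity
  have key : ∀ v, ‖v‖ ≤ s → l v ≤ A + M * s ^ 2 := fun v hv => by
    have h1 := h (-v) (by rw [norm_neg]; exact hv.trans hsσ)
    rw [map_neg, norm_neg] at h1
    have h2 : M * ‖v‖ ^ 2 ≤ M * s ^ 2 := by gcongr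
    linarith
  have hb : ‖l‖ ≤ (A + M * s ^ 2) / s := by
    refine l.opNorm_le_bound (by positivity) fun v => ?_
    rcases eq_or_ne v 0 with rfl | hv
    · simp
    have hv' : 0 < ‖v‖ := norm_pos_iff.2 hv
    have hk : ∀ ε : ℝ, |ε| = 1 → ε * l v ≤ (A + M * s ^ 2) / s * ‖v‖ := fun ε hε => by
      have := key ((ε * (s / ‖v‖)) • v) (by
        rw [norm_smul, Real.norm_eq_abs, abs_mul, hε, abs_of_pos (by positivity)]
        field_simp; rfl)
      rw [map_smul, smul_eq_mul] at this
      have h2 : ε * l v = ε * (s / ‖v‖) * l v * (‖v‖ / s) := by field_simp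
      rw [h2, div_mul_eq_mul_div, mul_div_assoc]
      gcongr
    rw [Real.norm_eq_abs]
    refine abs_le.2 ⟨?_, ?_⟩
    · have := hk (-1) (by simp); linarith
    · have := hk 1 (by simp); linarith
  rw [le_div_iff₀ hspos, hls] at hb
  rw [hls]
  nlinarith

/-- Minimum principle on a backward cone for the differential inequality
`∂ₜ d ≥ -L |∇d| - e`: information travels with speed at most `L`. -/
lemma le_of_cone_inequality [ProperSpace E] {d : ℝ → E → ℝ} {t L m e : ℝ} {x : E} (ht : 0 ≤ t)
    (hL : 0 ≤ L)
    (hcont : ContinuousOn (fun q : ℝ × E => d q.1 q.2)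
      {q | 0 ≤ q.1 ∧ q.1 ≤ t ∧ ‖q.2 - x‖ ≤ L * (t - q.1)})
    (hdiff : ∀ s ∈ Ioc 0 t, ∀ z, ‖z - x‖ ≤ L * (t - s) → ∃ D : ℝ × E →L[ℝ] ℝ,
      HasFDerivAt (fun q : ℝ × E => d q.1 q.2) D (s, z) ∧
        -(L * ‖D.comp (ContinuousLinearMap.inr ℝ ℝ E)‖) - e ≤ D (1, 0))
    (hinit : ∀ z, ‖z - x‖ ≤ L * t → m ≤ d 0 z) : m - e * t ≤ d t x := by
  set K : Set (ℝ × E) := {q | 0 ≤ q.1 ∧ q.1 ≤ t ∧ ‖q.2 - x‖ ≤ L * (t - q.1)} with hK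
  -- `K` is the backward cone with vertex `(t, x)`; it is convex and compact
  have hKclosed : IsClosed K := by
    refine (isClosed_le continuous_const continuous_fst).inter
      ((isClosed_le continuous_fst continuous_const).inter
        (isClosed_le (continuous_snd.sub continuous_const).norm
          (continuous_const.mul (continuous_const.sub continuous_fst))))
  have hKcomp : IsCompact K := by
    refine ((isCompact_Icc (a := (0 : ℝ)) (b := t)).prod
      (isCompact_closedBall x (L * t))).of_isClosed_subset hKclosed ?_
    rintro ⟨s, z⟩ ⟨h0, h1, h2⟩
    refine ⟨⟨h0, h1⟩, ?_⟩
    rw [mem_closedBall_iff_norm]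
    refine h2.trans ?_
    dsimp only at h0 ⊢
    gcongr
    linarith
  have hKconv : Convex ℝ K := by
    rintro ⟨s, z⟩ ⟨h0, h1, h2⟩ ⟨s', z'⟩ ⟨h0', h1', h2'⟩ a b ha hb hab
    simp only [] at h0 h1 h2 h0' h1' h2'
    refine ⟨?_, ?_, ?_⟩
    · simp only [Prod.fst_add, Prod.smul_fst, smul_eq_mul]; positivity
    · simp only [Prod.fst_add, Prod.smul_fst, smul_eq_mul]
      nlinarith
    · simp only [Prod.fst_add, Prod.snd_add, Prod.smul_fst, Prod.smul_snd, smul_eq_mul]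
      have : a • z + b • z' - x = a • (z - x) + b • (z' - x) := by
        have : x = (a + b) • x := by rw [hab, one_smul]
        nth_rewrite 1 [this]
        module
      rw [this]
      refine (norm_add_le _ _).trans ?_
      rw [norm_smul, norm_smul, Real.norm_of_nonneg ha, Real.norm_of_nonneg hb]
      have e1 : L * (t - (a * s + b * s')) = a * (L * (t - s)) + b * (L * (t - s')) := by
        linear_combination -(L * t) * hab
      rw [e1]
      gcongr
  -- the tilted function `d + (e + ε) s` has no minimum on `K` at a positive time
  have main : ∀ ε > 0, m ≤ d t x + (e + ε) * t := by
    intro ε hε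
    have htx : (t, x) ∈ K := ⟨ht, le_rfl, by simp⟩
    obtain ⟨⟨s, z⟩, hq, hmin⟩ := hKcomp.exists_isMinOn ⟨_, htx⟩
      (f := fun q : ℝ × E => d q.1 q.2 + (e + ε) * q.1)
      (hcont.add (by fun_prop))
    have hle := hmin htx
    simp only [mem_ofPred_eq] at hle
    obtain ⟨hs0, hst, hzx⟩ := hq
    simp only [] at hs0 hst hzx
    rcases hs0.eq_or_lt with h0 | hspos
    · subst h0
      have := hinit z (by simpa using hzx)
      simp at hle
      linarith
    exfalso
    obtain ⟨D, hD, hineq⟩ := hdiff s ⟨hspos, hst⟩ z hzx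
    set l := D.comp (ContinuousLinearMap.inr ℝ ℝ E) with hl
    have hg : HasFDerivAt (fun q : ℝ × E => d q.1 q.2 + (e + ε) * q.1)
        (D + (e + ε) • ContinuousLinearMap.fst ℝ ℝ E) (s, z) :=
      hD.add (hasFDerivAt_fst.const_mul (e + ε))
    -- from `(s, z)` every direction `(-s, s w)` with `‖w‖ ≤ L` points into the cone
    have key : ∀ w, ‖w‖ ≤ L → D (1, 0) + e + ε ≤ l w := by
      intro w hw
      have hmem : ((-s, s • w) : ℝ × E) ∈ posTangentConeAt K (s, z) := by
        refine mem_posTangentConeAt_of_segment_subset ?_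
        refine hKconv.segment_subset ⟨hs0, hst, hzx⟩ ⟨?_, ?_, ?_⟩
        · simp
        · simpa using ht
        · simp only [Prod.mk_add_mk, add_neg_cancel, sub_zero]
          have : z + s • w - x = (z - x) + s • w := by abel
          rw [this]
          refine (norm_add_le _ _).trans ?_
          rw [norm_smul, Real.norm_of_nonneg hs0]
          nlinarith
      have h0 := (hmin.localize).hasFDerivWithinAt_nonneg hg.hasFDerivWithinAt hmem
      have e1 : D (-s, s • w) = s * (l w - D (1, 0)) := by
        have : ((-s, s • w) : ℝ × E) = s • ((0, w) - (1, 0)) := by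
          ext <;> simp
        rw [this, map_smul, map_sub, smul_eq_mul]
        simp [hl]
      simp only [add_apply, smul_apply,
        ContinuousLinearMap.coe_fst', smul_eq_mul, e1] at h0
      have : 0 ≤ s * (l w - D (1, 0) - (e + ε)) := by linarith
      have := nonneg_of_mul_nonneg_right this hspos
      linarith
    -- the infimum of `l w` over `‖w‖ ≤ L` is `-L ‖l‖`, which contradicts the inequality for `D (1, 0)`
    have hLl : L * ‖l‖ ≤ -(D (1, 0) + e + ε) := by
      have hk0 := key 0 (by simpa using hL)
      rw [map_zero] at hk0
      rcases hL.eq_or_lt with h0 | hLpos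
      · rw [← h0, zero_mul]; linarith
      have : ‖l‖ ≤ -(D (1, 0) + e + ε) / L := by
        refine l.opNorm_le_bound (div_nonneg (by linarith) hL) fun w => ?_
        rcases eq_or_ne w 0 with rfl | hw
        · simp
        have hw' : 0 < ‖w‖ := norm_pos_iff.2 hw
        have hnorm : ‖(L / ‖w‖) • w‖ ≤ L := by
          rw [norm_smul, Real.norm_of_nonneg (by positivity)]; field_simp; rfl
        have h1 := key ((L / ‖w‖) • w) hnorm
        have h2 := key (-((L / ‖w‖) • w)) (by rwa [norm_neg])
        rw [map_neg] at h2
        rw [map_smul, smul_eq_mul] at h1 h2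
        have e2 : l w = (L / ‖w‖ * l w) * (‖w‖ / L) := by field_simp
        have e3 : -(D (1, 0) + e + ε) / L * ‖w‖ = -(D (1, 0) + e + ε) * (‖w‖ / L) := by ring
        have hpos : 0 < ‖w‖ / L := by positivity
        rw [Real.norm_eq_abs, e2, e3, abs_mul, abs_of_pos hpos]
        gcongr
        exact abs_le.2 ⟨by linarith, by linarith⟩
      rwa [le_div_iff₀ hLpos, mul_comm] at this
    linarith
  rcases ht.eq_or_lt with h0 | htpos
  · have := main 1 one_pos
    subst h0
    simpa using this
  refine le_of_forall_pos_le_add fun ε hε => ?_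
  have := main (ε / t) (by positivity)
  have e1 : (e + ε / t) * t = e * t + ε := by field_simp
  linarith

end Calculus

section FiniteDifferences

open fwdDiff

/-- If the `m`-th derivative of `f 0` is at least `c` then so is its `m`-th difference quotient. -/
lemma le_fwdDiff_iter {h : ℝ} (hh : 0 ≤ h) (m : ℕ) : ∀ (c T : ℝ) (f : ℕ → ℝ → ℝ),
    (∀ j < m, ∀ s ∈ Icc 0 T, HasDerivWithinAt (f j) (f (j + 1) s) (Icc 0 T) s) →
    (∀ s ∈ Icc 0 T, c ≤ f m s) → m * h ≤ T → c * h ^ m ≤ (fwdDiff h)^[m] (f 0) 0 := by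
  induction m with
  | zero =>
    intro c T f _ hc hT
    simpa using hc 0 ⟨le_rfl, by simpa using hT⟩
  | succ m ih =>
    intro c T f hf hc hT
    push_cast at hT
    have hmh : 0 ≤ m * h := by positivity
    have hsub : Icc 0 (T - h) ⊆ Icc 0 T := Icc_subset_Icc_right (by linarith)
    have hshift : ∀ s ∈ Icc 0 (T - h), s + h ∈ Icc 0 T := fun s hs =>
      ⟨by linarith [hs.1], by linarith [hs.2]⟩
    have := ih (c * h) (T - h) (fun j s => f j (s + h) - f j s) ?_ ?_ (by linarith)
    · rw [Function.iterate_succ_apply]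
      calc c * h ^ (m + 1) = c * h * h ^ m := by ring
        _ ≤ _ := this
    · intro j hj s hs
      have h1 := hf j (by omega) s (hsub hs)
      have h2 := hf j (by omega) (s + h) (hshift s hs)
      have h3 : HasDerivWithinAt (fun s => f j (s + h)) (f (j + 1) (s + h)) (Icc 0 (T - h)) s := by
        have := h2.scomp s (h := fun s => s + h) (s := Icc 0 (T - h))
          (((hasDerivAt_id s).add_const h).hasDerivWithinAt) (fun s hs => hshift s hs)
        simpa [Function.comp_def] using this
      exact h3.fun_sub (h1.mono hsub)
    · intro s hs
      have hI : Icc s (s + h) ⊆ Icc 0 T := fun u hu =>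
        ⟨hs.1.trans hu.1, hu.2.trans (hshift s hs).2⟩
      have hm : MonotoneOn (fun u => f m u - c * u) (Icc s (s + h)) := by
        have hd : ∀ u ∈ Icc s (s + h), HasDerivWithinAt (fun u => f m u - c * u)
            (f (m + 1) u - c) (Icc s (s + h)) u := fun u hu => by
          simpa using ((hf m (by omega) u (hI hu)).mono hI).fun_sub
            (((hasDerivAt_id' u).const_mul c).hasDerivWithinAt)
        refine monotoneOn_of_hasDerivWithinAt_nonneg (convex_Icc _ _)
          (fun u hu => (hd u hu).continuousWithinAt)
          (fun u hu => (hd u (interior_subset hu)).mono interior_subset) ?_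
        intro u hu
        linarith [hc u (hI (interior_subset hu))]
      have := hm (left_mem_Icc.2 (by linarith)) (right_mem_Icc.2 (by linarith)) (by linarith)
      simp only [] at this ⊢
      nlinarith

/-- A nondecreasing function vanishing at `0` with `m`-th derivative at least `c` on `[0, t]` is at
least a multiple of `t ^ m` at `t`; no information on the lower derivatives is needed. -/
lemma le_of_iterated_deriv_lower_bound {c t : ℝ} {m : ℕ} (hm : 0 < m) (ht : 0 ≤ t) (f : ℕ → ℝ → ℝ)
    (hf : ∀ j < m, ∀ s ∈ Icc 0 t, HasDerivWithinAt (f j) (f (j + 1) s) (Icc 0 t) s)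
    (hc : ∀ s ∈ Icc 0 t, c ≤ f m s) (h0 : f 0 0 = 0) (hmono : MonotoneOn (f 0) (Icc 0 t)) :
    c / (m ^ m * 2 ^ m) * t ^ m ≤ f 0 t := by
  have hm' : (0 : ℝ) < m := by exact_mod_cast hm
  have h1 := le_fwdDiff_iter (h := t / m) (by positivity) m c t f hf hc
    (by field_simp; rfl)
  have hpos : 0 ≤ f 0 t := by
    rw [← h0]; exact hmono (left_mem_Icc.2 ht) (right_mem_Icc.2 ht) ht
  -- the `m`-th difference is an alternating binomial sum of values in `[0, f 0 t]`
  have h2 : (fwdDiff (t / m))^[m] (f 0) 0 ≤ 2 ^ m * f 0 t := by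
    rw [fwdDiff_iter_eq_sum_shift]
    have : (2 : ℝ) ^ m * f 0 t = ∑ k ∈ Finset.range (m + 1), (m.choose k : ℝ) * f 0 t := by
      rw [← Finset.sum_mul]
      congr 1
      exact_mod_cast (Nat.sum_range_choose m).symm
    rw [this]
    refine Finset.sum_le_sum fun k hk => ?_
    have hk' : k ≤ m := Nat.lt_succ_iff.1 (Finset.mem_range.1 hk)
    have hmem : (0 : ℝ) + k • (t / m) ∈ Icc 0 t := by
      rw [zero_add, nsmul_eq_mul]
      refine ⟨by positivity, ?_⟩
      rw [mul_div_assoc', div_le_iff₀ hm', mul_comm]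
      gcongr
    have hb : f 0 (0 + k • (t / m)) ≤ f 0 t := hmono hmem (right_mem_Icc.2 ht) hmem.2
    have hb0 : 0 ≤ f 0 (0 + k • (t / m)) := h0.symm.le.trans (hmono (left_mem_Icc.2 ht) hmem hmem.1)
    rw [zsmul_eq_mul]
    push_cast
    rcases neg_one_pow_eq_or ℝ (m - k) with h | h <;> rw [h]
    · rw [one_mul]; gcongr
    · have : 0 ≤ (m.choose k : ℝ) * f 0 (0 + k • (t / m)) := by positivity
      have : 0 ≤ (m.choose k : ℝ) * f 0 t := by positivity
      linarith
  have h3 := h1.trans h2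
  rw [div_pow] at h3
  have : c / (m ^ m * 2 ^ m) * t ^ m = (c * (t ^ m / m ^ m)) / 2 ^ m := by field_simp
  rw [this, div_le_iff₀ (by positivity), mul_comm (f 0 t)]
  exact h3

end FiniteDifferences

end FBI

namespace FBI

/-! ### Hessians and coercivity -/

section Linear

variable {E : Type*} [NormedAddCommGroup E] [NormedSpace ℝ E]

/-- A positive definite bilinear form on a finite-dimensional space is coercive. -/
lemma exists_coercive [FiniteDimensional ℝ E] (B : E →L[ℝ] E →L[ℝ] ℝ)
    (hB : ∀ v, v ≠ 0 → 0 < B v v) : ∃ c > 0, ∀ v, c * ‖v‖ ^ 2 ≤ B v v := by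
  have hproper : ProperSpace E := FiniteDimensional.proper_real E
  have hcont : Continuous fun v => B v v := by fun_prop
  rcases (Metric.sphere (0 : E) 1).eq_empty_or_nonempty with h | h
  · refine ⟨1, one_pos, fun v => ?_⟩
    have : v = 0 := by
      by_contra hv
      have : (‖v‖⁻¹ • v) ∈ Metric.sphere (0 : E) 1 := by
        simp [norm_smul, hv]
      rw [h] at this
      exact this
    simp [this]
  obtain ⟨w, hw, hmin⟩ := (isCompact_sphere (0 : E) 1).exists_isMinOn h hcont.continuousOn
  have hw0 : w ≠ 0 := by
    rintro rfl
    simp at hw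
  refine ⟨B w w, hB w hw0, fun v => ?_⟩
  rcases eq_or_ne v 0 with rfl | hv
  · simp
  have hv' : 0 < ‖v‖ := norm_pos_iff.2 hv
  have hmem : (‖v‖⁻¹ • v) ∈ Metric.sphere (0 : E) 1 := by
    simp [norm_smul, hv]
  have := hmin hmem
  simp only [mem_ofPred_eq, map_smul, smul_apply, smul_eq_mul] at this
  have h2 : B v v = (‖v‖⁻¹ * (‖v‖⁻¹ * B v v)) * ‖v‖ ^ 2 := by field_simp
  rw [h2]
  gcongr

/-- Coercivity of a continuous family of bilinear forms, on the range of a bounded map `j`, is an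
open condition. -/
lemma eventually_coercive {Z V : Type*} [TopologicalSpace Z] [SeminormedAddCommGroup V]
    {B : Z → E →L[ℝ] E →L[ℝ] ℝ} {z₀ : Z}
    (hB : Tendsto (fun z => ‖B z - B z₀‖) (𝓝 z₀) (𝓝 0)) (j : V → E) {κ c : ℝ} (hc : 0 < c)
    (hκ : 0 < κ) (hj : ∀ v, ‖j v‖ ≤ κ * ‖v‖) (h : ∀ v, c * ‖v‖ ^ 2 ≤ B z₀ (j v) (j v)) :
    ∀ᶠ z in 𝓝 z₀, ∀ v, c / 2 * ‖v‖ ^ 2 ≤ B z (j v) (j v) := by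
  filter_upwards [hB.eventually_lt_const (show 0 < c / (2 * κ ^ 2) by positivity)] with z hz v
  have h1 : ‖(B z - B z₀) (j v) (j v)‖ ≤ c / (2 * κ ^ 2) * (κ * ‖v‖) * (κ * ‖v‖) :=
    ((B z - B z₀).le_opNorm₂ _ _).trans (by gcongr <;> exact hj v)
  have h2 := (abs_le.1 h1).1
  simp only [sub_apply] at h2
  have h3 : c / (2 * κ ^ 2) * (κ * ‖v‖) * (κ * ‖v‖) = c / 2 * ‖v‖ ^ 2 := by field_simp
  linarith [h v]

lemma tendsto_hessian {f : E → ℝ} {z₀ : E}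
    (h : ContDiffAt ℝ 2 f z₀) :
    Tendsto (fun z => ‖fderiv ℝ (fderiv ℝ f) z - fderiv ℝ (fderiv ℝ f) z₀‖) (𝓝 z₀) (𝓝 0) := by
  have h1 : ContDiffAt ℝ 1 (fderiv ℝ f) z₀ := h.fderiv_right (by norm_num)
  have h2 : ContDiffAt ℝ 0 (fderiv ℝ (fderiv ℝ f)) z₀ := h1.fderiv_right (by norm_num)
  exact tendsto_iff_norm_sub_tendsto_zero.1 h2.continuousAt

/-- The Hessian of a `C²` function is bounded near a point. -/
lemma eventually_hessian_le {f : E → ℝ} {z₀ : E} (h : ContDiffAt ℝ 2 f z₀) :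
    ∃ C > 0, ∀ᶠ z in 𝓝 z₀, ∀ v w, |fderiv ℝ (fderiv ℝ f) z v w| ≤ C * ‖v‖ * ‖w‖ := by
  refine ⟨‖fderiv ℝ (fderiv ℝ f) z₀‖ + 1, by positivity, ?_⟩
  filter_upwards [(tendsto_hessian h).eventually_lt_const one_pos] with z hz v w
  have h1 : ‖fderiv ℝ (fderiv ℝ f) z‖ ≤ ‖fderiv ℝ (fderiv ℝ f) z₀‖ + 1 := by
    have := norm_add_le (fderiv ℝ (fderiv ℝ f) z - fderiv ℝ (fderiv ℝ f) z₀)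
      (fderiv ℝ (fderiv ℝ f) z₀)
    rw [sub_add_cancel] at this
    linarith
  exact ((fderiv ℝ (fderiv ℝ f) z).le_opNorm₂ v w).trans (by gcongr)

lemma fderiv_fderiv_apply {F : Type*} [NormedAddCommGroup F] [NormedSpace ℝ F] {h : E → F} {u : E}
    (hh : ContDiffAt ℝ 2 h u) (v w : E) :
    fderiv ℝ (fderiv ℝ h) u v w = fderiv ℝ (fun u => fderiv ℝ h u w) u v := by
  have hd : DifferentiableAt ℝ (fderiv ℝ h) u :=
    (hh.fderiv_right (m := 1) (by norm_num)).differentiableAt (by norm_num)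
  have := (hd.hasFDerivAt.clm_apply (hasFDerivAt_const w u)).fderiv
  rw [this]
  simp

/-- The Hessian is nonnegative at a local minimum. -/
lemma hessian_nonneg_of_isLocalMin {h : E → ℝ} {u : E} (hh : ContDiffAt ℝ 2 h u)
    (hmin : IsLocalMin h u) (v : E) : 0 ≤ fderiv ℝ (fderiv ℝ h) u v v := by
  by_contra! hneg
  set q := fderiv ℝ (fderiv ℝ h) u v v with hq
  have hline : ∀ s : ℝ, HasDerivAt (fun s : ℝ => u + s • v) v s := fun s => by
    simpa using ((hasDerivAt_id s).smul_const v).const_add u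
  have hcont : ContinuousAt (fun s : ℝ => u + s • v) 0 := (hline 0).continuousAt
  have hu : Tendsto (fun s : ℝ => u + s • v) (𝓝 0) (𝓝 u) := by
    have := hcont.tendsto
    simpa using this
  have hd : ∀ᶠ z in 𝓝 u, ContDiffAt ℝ 2 h z := hh.eventually (by simp)
  have h1 : ∀ᶠ s in 𝓝 (0 : ℝ),
      HasDerivAt (fun s : ℝ => h (u + s • v)) (fderiv ℝ h (u + s • v) v) s := by
    filter_upwards [hu.eventually hd] with s hs
    exact (hs.differentiableAt (by norm_num)).hasFDerivAt.comp_hasDerivAt s (hline s)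
  have h1' : deriv (fun s : ℝ => h (u + s • v)) =ᶠ[𝓝 0] fun s => fderiv ℝ h (u + s • v) v :=
    h1.mono fun s hs => hs.deriv
  have h2 : HasDerivAt (fun s : ℝ => fderiv ℝ h (u + s • v) v) q 0 := by
    have hd : ContDiffAt ℝ 1 (fderiv ℝ h) (u + (0 : ℝ) • v) := by
      rw [zero_smul, add_zero]
      exact hh.fderiv_right (by norm_num)
    have := (hd.differentiableAt (by norm_num)).hasFDerivAt.comp_hasDerivAt (0 : ℝ) (hline 0)
    simpa [hq] using this.clm_apply (hasDerivAt_const (0 : ℝ) v)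
  have hder0 : deriv (fun s : ℝ => h (u + s • v)) 0 = 0 := by
    rw [h1'.eq_of_nhds, zero_smul, add_zero, hmin.fderiv_eq_zero]
    rfl
  have hloc := isLocalMax_of_deriv_deriv_neg (f := fun s : ℝ => h (u + s • v)) (x₀ := 0)
    (by rw [h1'.deriv_eq, h2.deriv]; exact hneg) hder0 (h1.self_of_nhds.continuousAt)
  have hconst : (fun s : ℝ => h (u + s • v)) =ᶠ[𝓝 0] fun _ => h u := by
    filter_upwards [hloc, hu.eventually hmin] with s hs hs'
    simp only [zero_smul, add_zero] at hs
    exact le_antisymm hs hs'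
  have : deriv (deriv (fun s : ℝ => h (u + s • v))) 0 = 0 := by
    rw [hconst.deriv.deriv_eq]
    simp
  rw [h1'.deriv_eq, h2.deriv] at this
  exact hneg.ne this

end Linear

section Holomorphic

variable {E : Type*} [NormedAddCommGroup E] [NormedSpace ℝ E]
  {Z : Type*} [NormedAddCommGroup Z] [NormedSpace ℂ Z]

/-- The imaginary part of a holomorphic function along a real affine map. -/
lemma hasFDerivAt_im_comp {f : Z → ℂ} {a : Z} (L : E →L[ℝ] Z) {u : E}
    (hf : DifferentiableAt ℂ f (a + L u)) :
    HasFDerivAt (fun u => (f (a + L u)).im)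
      (Complex.imCLM.comp (((fderiv ℂ f (a + L u)).restrictScalars ℝ).comp L)) u := by
  have h1 : HasFDerivAt (fun u => a + L u) L u := L.hasFDerivAt.const_add a
  exact Complex.imCLM.hasFDerivAt.comp u ((hf.hasFDerivAt.restrictScalars ℝ).comp u h1)

lemma contDiffAt_im_comp {f : Z → ℂ} {a : Z} (L : E →L[ℝ] Z) {u : E} {m : ℕ∞}
    (hf : ContDiffAt ℂ m f (a + L u)) : ContDiffAt ℝ m (fun u => (f (a + L u)).im) u := by
  have h1 : ContDiffAt ℝ m (fun u => a + L u) u := by fun_prop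
  exact Complex.imCLM.contDiff.contDiffAt.comp u ((hf.restrict_scalars ℝ).comp u h1)

lemma hessian_im_comp {f : Z → ℂ} {a : Z} (L : E →L[ℝ] Z) {u : E}
    (hf : ContDiffAt ℂ 2 f (a + L u)) (v w : E) :
    fderiv ℝ (fderiv ℝ fun u => (f (a + L u)).im) u v w =
      (fderiv ℂ (fderiv ℂ f) (a + L u) (L v) (L w)).im := by
  rw [fderiv_fderiv_apply (contDiffAt_im_comp (m := 2) L hf)]
  have hline : HasFDerivAt (fun u => a + L u) L u := L.hasFDerivAt.const_add a
  have hev : (fun u => fderiv ℝ (fun u => (f (a + L u)).im) u w) =ᶠ[𝓝 u]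
      fun u => (fderiv ℂ f (a + L u) (L w)).im := by
    have := hline.continuousAt.eventually (hf.eventually (by simp))
    filter_upwards [this] with u hu
    rw [(hasFDerivAt_im_comp L (hu.differentiableAt (by norm_num))).fderiv]
    simp
  rw [hev.fderiv_eq]
  have hd : DifferentiableAt ℂ (fderiv ℂ f) (a + L u) :=
    (hf.fderiv_right (m := 1) (by norm_num)).differentiableAt (by norm_num)
  have h1 : HasFDerivAt (fun z => fderiv ℂ f z (L w))
      ((fderiv ℂ (fderiv ℂ f) (a + L u)).flip (L w)) (a + L u) := by
    have := hd.hasFDerivAt.clm_apply (hasFDerivAt_const (L w) (a + L u))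
    refine this.congr_fderiv ?_
    ext; simp
  have := Complex.imCLM.hasFDerivAt.comp u ((h1.restrictScalars ℝ).comp u hline)
  have h2 := this.fderiv
  simp only [Function.comp_def, Complex.imCLM_apply] at h2
  rw [h2]
  simp

end Holomorphic

end FBI

namespace FBI

/-! ### Coordinates and holomorphic gradients -/

section Coordinates

variable {n : ℕ}

/-- The inclusion of `ℝⁿ` in `ℂⁿ` as a continuous linear map. -/
noncomputable def toCL (n : ℕ) : Rn n →L[ℝ] Cn n :=
  ContinuousLinearMap.pi fun j => Complex.ofRealCLM.comp (ContinuousLinearMap.proj j)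

@[simp] lemma norm_toC (y : Rn n) : ‖toC y‖ = ‖y‖ := by
  simp [Pi.norm_def, toC]

lemma toC_zero : toC (0 : Rn n) = 0 := (toCL n).map_zero

lemma continuous_toC : Continuous (toC : Rn n → Cn n) := (toCL n).continuous

/-- The componentwise imaginary part. -/
def imC (x : Cn n) : Rn n := fun j => (x j).im

/-- The componentwise real part. -/
def reC (x : Cn n) : Rn n := fun j => (x j).re

lemma norm_le_reC_add_imC (x : Cn n) : ‖x‖ ≤ ‖reC x‖ + ‖imC x‖ :=
  (pi_norm_le_iff_of_nonneg (by positivity)).2 fun j =>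
    (Complex.norm_le_abs_re_add_abs_im (x j)).trans
      (add_le_add (norm_le_pi_norm (reC x) j) (norm_le_pi_norm (imC x) j))

lemma continuous_imC : Continuous (imC : Cn n → Rn n) := by
  unfold imC; fun_prop

lemma continuous_reC : Continuous (reC : Cn n → Rn n) := by
  unfold reC; fun_prop

lemma sq_norm_le_sum_sq (v : Rn n) : ‖v‖ ^ 2 ≤ ∑ j, v j ^ 2 := by
  have h0 : 0 ≤ ∑ j, v j ^ 2 := Finset.sum_nonneg fun j _ => sq_nonneg _
  have : ‖v‖ ≤ Real.sqrt (∑ j, v j ^ 2) :=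
    (pi_norm_le_iff_of_nonneg (Real.sqrt_nonneg _)).2 fun j => by
      rw [Real.norm_eq_abs, ← Real.sqrt_sq_eq_abs]
      exact Real.sqrt_le_sqrt
        (Finset.single_le_sum (f := fun j => v j ^ 2) (fun j _ => sq_nonneg _) (Finset.mem_univ j))
  calc ‖v‖ ^ 2 ≤ Real.sqrt (∑ j, v j ^ 2) ^ 2 := by gcongr
    _ = _ := Real.sq_sqrt h0

lemma sum_smul_single {𝕜 : Type*} [NormedField 𝕜] (v : Fin n → 𝕜) :
    v = ∑ j, v j • (Pi.single j 1 : Fin n → 𝕜) := by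
  ext i; simp [Finset.sum_apply, Pi.single_apply]

lemma clm_apply_eq_sum {𝕜 F : Type*} [NontriviallyNormedField 𝕜] [NormedAddCommGroup F]
    [NormedSpace 𝕜 F] (l : (Fin n → 𝕜) →L[𝕜] F) (v : Fin n → 𝕜) :
    l v = ∑ j, v j • l (Pi.single j 1) := by
  conv_lhs => rw [sum_smul_single v]
  simp

/-- The holomorphic gradient in the first group of variables. -/
noncomputable def gradX (f : Cn n × Cn n → ℂ) (z : Cn n × Cn n) : Cn n :=
  fun j => fderiv ℂ f z (Pi.single j 1, 0)

/-- The holomorphic gradient in the second group of variables. -/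
noncomputable def gradY (f : Cn n × Cn n → ℂ) (z : Cn n × Cn n) : Cn n :=
  fun j => fderiv ℂ f z (0, Pi.single j 1)

lemma fderiv_apply_inl (f : Cn n × Cn n → ℂ) (z : Cn n × Cn n) (v : Cn n) :
    fderiv ℂ f z (v, 0) = ∑ j, v j * gradX f z j := by
  simpa [gradX] using clm_apply_eq_sum ((fderiv ℂ f z).comp (ContinuousLinearMap.inl ℂ (Cn n) (Cn n))) v

lemma fderiv_apply_inr (f : Cn n × Cn n → ℂ) (z : Cn n × Cn n) (v : Cn n) :
    fderiv ℂ f z (0, v) = ∑ j, v j * gradY f z j := by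
  simpa [gradY] using clm_apply_eq_sum ((fderiv ℂ f z).comp (ContinuousLinearMap.inr ℂ (Cn n) (Cn n))) v

lemma hasFDerivAt_gradX {f : Cn n × Cn n → ℂ} {z : Cn n × Cn n} (hf : ContDiffAt ℂ 2 f z) :
    HasFDerivAt (gradX f) (ContinuousLinearMap.pi fun j =>
      (fderiv ℂ (fderiv ℂ f) z).flip (Pi.single j 1, 0)) z := by
  have hd : DifferentiableAt ℂ (fderiv ℂ f) z :=
    (hf.fderiv_right (m := 1) (by norm_num)).differentiableAt (by norm_num)
  refine hasFDerivAt_pi.2 fun j => ?_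
  have := hd.hasFDerivAt.clm_apply (hasFDerivAt_const ((Pi.single j 1, 0) : Cn n × Cn n) z)
  refine this.congr_fderiv ?_
  ext <;> simp

lemma hasFDerivAt_gradY {f : Cn n × Cn n → ℂ} {z : Cn n × Cn n} (hf : ContDiffAt ℂ 2 f z) :
    HasFDerivAt (gradY f) (ContinuousLinearMap.pi fun j =>
      (fderiv ℂ (fderiv ℂ f) z).flip (0, Pi.single j 1)) z := by
  have hd : DifferentiableAt ℂ (fderiv ℂ f) z :=
    (hf.fderiv_right (m := 1) (by norm_num)).differentiableAt (by norm_num)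
  refine hasFDerivAt_pi.2 fun j => ?_
  have := hd.hasFDerivAt.clm_apply (hasFDerivAt_const ((0, Pi.single j 1) : Cn n × Cn n) z)
  refine this.congr_fderiv ?_
  ext <;> simp

lemma contDiffAt_gradX {f : Cn n × Cn n → ℂ} {z : Cn n × Cn n} (hf : ContDiffAt ℂ ∞ f z) :
    ContDiffAt ℂ ∞ (gradX f) z := by
  refine contDiffAt_pi.2 fun j => ?_
  exact (hf.fderiv_right (m := ∞) (by simp)).clm_apply contDiffAt_const

lemma contDiffAt_gradY {f : Cn n × Cn n → ℂ} {z : Cn n × Cn n} (hf : ContDiffAt ℂ ∞ f z) :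
    ContDiffAt ℂ ∞ (gradY f) z := by
  refine contDiffAt_pi.2 fun j => ?_
  exact (hf.fderiv_right (m := ∞) (by simp)).clm_apply contDiffAt_const

lemma analyticAt_gradY {f : Cn n × Cn n → ℂ} {z : Cn n × Cn n} (hf : AnalyticAt ℂ f z) :
    AnalyticAt ℂ (gradY f) z := by
  refine ContDiffAt.analyticAt (contDiffAt_pi.2 fun j => ?_)
  exact (hf.fderiv.contDiffAt (n := ω)).clm_apply contDiffAt_const

lemma symm_hessian {f : Cn n × Cn n → ℂ} {z : Cn n × Cn n} (hf : ContDiffAt ℂ 2 f z)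
    (v w : Cn n × Cn n) :
    fderiv ℂ (fderiv ℂ f) z v w = fderiv ℂ (fderiv ℂ f) z w v :=
  hf.isSymmSndFDerivAt (by simp) v w

/-- For holomorphic functions the vector `pd` consists of the complex partial derivatives. -/
lemma pd_eq {g : Cn n → ℂ} {x : Cn n} (hg : DifferentiableAt ℂ g x) (j : Fin n) :
    pd g x j = fderiv ℂ g x (Pi.single j 1) := by
  have h := (hg.hasFDerivAt.restrictScalars ℝ).fderiv
  simp only [pd, del, h, ContinuousLinearMap.coe_restrictScalars', map_smul, smul_eq_mul]
  rw [← mul_assoc, Complex.I_mul_I]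
  ring

lemma hasFDerivAt_left {f : Cn n × Cn n → ℂ} {x y : Cn n} (hf : DifferentiableAt ℂ f (x, y)) :
    HasFDerivAt (fun x => f (x, y))
      ((fderiv ℂ f (x, y)).comp (ContinuousLinearMap.inl ℂ (Cn n) (Cn n))) x :=
  hf.hasFDerivAt.comp x (hasFDerivAt_prodMk_left x y)

lemma hasFDerivAt_right {f : Cn n × Cn n → ℂ} {x y : Cn n} (hf : DifferentiableAt ℂ f (x, y)) :
    HasFDerivAt (fun y => f (x, y))
      ((fderiv ℂ f (x, y)).comp (ContinuousLinearMap.inr ℂ (Cn n) (Cn n))) y :=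
  hf.hasFDerivAt.comp y (hasFDerivAt_prodMk_right x y)

lemma pd_left {f : Cn n × Cn n → ℂ} {x y : Cn n} (hf : DifferentiableAt ℂ f (x, y)) :
    pd (fun x => f (x, y)) x = gradX f (x, y) := by
  ext j
  rw [pd_eq (hasFDerivAt_left hf).differentiableAt, (hasFDerivAt_left hf).fderiv]
  simp [gradX]

lemma pd_right {f : Cn n × Cn n → ℂ} {x y : Cn n} (hf : DifferentiableAt ℂ f (x, y)) :
    pd (fun y => f (x, y)) y = gradY f (x, y) := by
  ext j
  rw [pd_eq (hasFDerivAt_right hf).differentiableAt, (hasFDerivAt_right hf).fderiv]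
  simp [gradY]

/-- The real differential of a real-valued function is `2 Re` of its holomorphic gradient. -/
lemma fderiv_eq_re_pd {g : Cn n → ℝ} {x : Cn n} (hg : DifferentiableAt ℝ g x) (v : Cn n) :
    fderiv ℝ g x v = 2 * (∑ j, v j * pd (fun x => (g x : ℂ)) x j).re := by
  have h : HasFDerivAt (fun x => (g x : ℂ)) (Complex.ofRealCLM.comp (fderiv ℝ g x)) x :=
    Complex.ofRealCLM.hasFDerivAt.comp x hg.hasFDerivAt
  set l := fderiv ℝ g x
  have hv : v = ∑ j, ((v j).re • (Pi.single j 1 : Cn n) +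
      (v j).im • (Complex.I • (Pi.single j 1 : Cn n))) := by
    ext i
    simp only [Finset.sum_apply, Pi.add_apply, Pi.smul_apply, Pi.single_apply, Complex.real_smul,
      smul_eq_mul]
    simp [Finset.sum_add_distrib, Complex.re_add_im]
  conv_lhs => rw [hv]
  rw [map_sum, Complex.re_sum, Finset.mul_sum]
  refine Finset.sum_congr rfl fun j _ => ?_
  simp only [pd, del, h.fderiv, map_add, map_smul, smul_eq_mul, ContinuousLinearMap.comp_apply,
    Complex.ofRealCLM_apply]
  simp [Complex.mul_re]
  ring

lemma norm_pd_le {g : Cn n → ℝ} {x : Cn n} (hg : DifferentiableAt ℝ g x) :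
    ‖pd (fun x => (g x : ℂ)) x‖ ≤ ‖fderiv ℝ g x‖ := by
  have h : HasFDerivAt (fun x => (g x : ℂ)) (Complex.ofRealCLM.comp (fderiv ℝ g x)) x :=
    Complex.ofRealCLM.hasFDerivAt.comp x hg.hasFDerivAt
  refine (pi_norm_le_iff_of_nonneg (norm_nonneg _)).2 fun j => ?_
  simp only [pd, del, h.fderiv, ContinuousLinearMap.comp_apply, Complex.ofRealCLM_apply]
  have e1 : ‖(Pi.single j 1 : Cn n)‖ = 1 := by
    rw [Pi.norm_single, norm_one]
  have h1 := (fderiv ℝ g x).le_opNorm (Pi.single j 1)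
  have h2 := (fderiv ℝ g x).le_opNorm (Complex.I • Pi.single j 1)
  rw [norm_smul, Complex.norm_I, one_mul, e1, mul_one] at h2
  rw [e1, mul_one] at h1
  rw [norm_div, Complex.norm_ofNat, div_le_iff₀ two_pos]
  refine (norm_sub_le _ _).trans ?_
  rw [norm_mul, Complex.norm_I, one_mul, Complex.norm_real, Complex.norm_real]
  linarith

end Coordinates

end FBI

namespace FBI

/-! ### The weight and the phase -/

variable {n : ℕ}

/-- The local data of a Bargmann transform, stated with complex Fréchet derivatives: a phase `f`
holomorphic near `(x₀, y₀)` with `Im f''_{yy} > 0`, `f''_{xy}` nondegenerate and `-f'_y = η₀` at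
`(x₀, y₀)`, and a smooth weight `Φ₀(x) = sup_y (-Im f(x, y))`. -/
structure Setting (f : Cn n × Cn n → ℂ) (x₀ : Cn n) (y₀ η₀ : Rn n) (Φ₀ : Cn n → ℝ) : Prop where
  holo : AnalyticAt ℂ f (x₀, toC y₀)
  pos : ∀ v : Rn n, v ≠ 0 →
    0 < (fderiv ℂ (fderiv ℂ f) (x₀, toC y₀) (0, toC v) (0, toC v)).im
  inj : ∀ v : Cn n, (∀ w : Cn n, fderiv ℂ (fderiv ℂ f) (x₀, toC y₀) (v, 0) (0, w) = 0) → v = 0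
  real : gradY f (x₀, toC y₀) = -toC η₀
  smooth : ContDiffAt ℝ ∞ Φ₀ x₀
  weight : ∀ᶠ r in 𝓝[>] (0 : ℝ), ∀ᶠ x in 𝓝 x₀,
    IsLUB ((fun y : Rn n => -(f (x, toC y)).im) '' Metric.ball y₀ r) (Φ₀ x)

namespace Setting

variable {f : Cn n × Cn n → ℂ} {x₀ : Cn n} {y₀ η₀ : Rn n} {Φ₀ : Cn n → ℝ}

/-- The inclusion `ℂⁿ × ℝⁿ → ℂⁿ × ℂⁿ`. -/
noncomputable def incl (n : ℕ) : Cn n × Rn n →L[ℝ] Cn n × Cn n :=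
  (ContinuousLinearMap.id ℝ (Cn n)).prodMap (toCL n)

@[simp] lemma incl_apply (u : Cn n × Rn n) : incl n u = (u.1, toC u.2) := rfl

/-- The imaginary part of the phase, as a function on `ℂⁿ × ℝⁿ`. -/
def imPhase (f : Cn n × Cn n → ℂ) (u : Cn n × Rn n) : ℝ := (f (u.1, toC u.2)).im

lemma fderiv_imPhase {u : Cn n × Rn n} (hf : DifferentiableAt ℂ f (u.1, toC u.2))
    (v : Cn n × Rn n) :
    fderiv ℝ (imPhase f) u v = (fderiv ℂ f (u.1, toC u.2) (v.1, toC v.2)).im := by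
  have := hasFDerivAt_im_comp (a := 0) (incl n) (u := u) (by simpa using hf)
  simp only [zero_add] at this
  have h2 : fderiv ℝ (imPhase f) u = _ := this.fderiv
  rw [h2]
  rfl

lemma contDiffAt_imPhase {u : Cn n × Rn n} {m : ℕ∞} (hf : ContDiffAt ℂ m f (u.1, toC u.2)) :
    ContDiffAt ℝ m (imPhase f) u := by
  have := contDiffAt_im_comp (a := 0) (incl n) (u := u) (m := m) (by simpa using hf)
  simp only [zero_add, incl_apply] at this
  exact this

lemma hessian_imPhase {u : Cn n × Rn n} (hf : ContDiffAt ℂ 2 f (u.1, toC u.2))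
    (v w : Cn n × Rn n) :
    fderiv ℝ (fderiv ℝ (imPhase f)) u v w =
      (fderiv ℂ (fderiv ℂ f) (u.1, toC u.2) (v.1, toC v.2) (w.1, toC w.2)).im := by
  have := hessian_im_comp (a := 0) (incl n) (u := u) (by simpa using hf) v w
  simp only [zero_add, incl_apply] at this
  exact this

lemma eventually_analyticAt (S : Setting f x₀ y₀ η₀ Φ₀) :
    ∀ᶠ u in 𝓝 ((x₀, y₀) : Cn n × Rn n), AnalyticAt ℂ f (u.1, toC u.2) :=
  (incl n).continuous.continuousAt.eventually S.holo.eventually_analyticAt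

lemma exists_yy_coercive (S : Setting f x₀ y₀ η₀ Φ₀) : ∃ c > 0, ∀ᶠ u in 𝓝 ((x₀, y₀) : Cn n × Rn n),
    ∀ v : Rn n, c * ‖v‖ ^ 2 ≤ fderiv ℝ (fderiv ℝ (imPhase f)) u (0, v) (0, v) := by
  have hC : ContDiffAt ℂ 2 f (x₀, toC y₀) := S.holo.contDiffAt
  obtain ⟨c, hc, h⟩ := exists_coercive
    ((fderiv ℝ (fderiv ℝ (imPhase f)) (x₀, y₀)).bilinearComp
      (ContinuousLinearMap.inr ℝ (Cn n) (Rn n)) (ContinuousLinearMap.inr ℝ (Cn n) (Rn n)))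
    (fun v hv => by
      rw [ContinuousLinearMap.bilinearComp_apply, hessian_imPhase hC]
      exact S.pos v hv)
  refine ⟨c / 2, by positivity, ?_⟩
  refine eventually_coercive (tendsto_hessian (contDiffAt_imPhase (m := 2) hC))
    (fun v : Rn n => ((0, v) : Cn n × Rn n)) (κ := 1) hc one_pos (fun v => by simp) ?_
  intro v
  simpa [ContinuousLinearMap.bilinearComp_apply] using h v

/-- Near `(x₀, y₀)` the function `y ↦ Im f(x, y)` is strictly convex on real points, with bounded
Hessian. -/
lemma exists_taylor (S : Setting f x₀ y₀ η₀ Φ₀) : ∃ c > 0, ∃ C > 0, ∃ r > 0,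
    ∀ x ∈ Metric.ball x₀ r, ∀ y ∈ Metric.ball y₀ r, AnalyticAt ℂ f (x, toC y) ∧
      ∀ y' ∈ Metric.ball y₀ r,
        imPhase f (x, y) + (fderiv ℂ f (x, toC y) (0, toC (y' - y))).im + c * ‖y' - y‖ ^ 2 ≤
          imPhase f (x, y') ∧
        imPhase f (x, y') ≤
          imPhase f (x, y) + (fderiv ℂ f (x, toC y) (0, toC (y' - y))).im + C * ‖y' - y‖ ^ 2 := by
  obtain ⟨c, hc, h1⟩ := S.exists_yy_coercive
  have hC : ContDiffAt ℂ 2 f (x₀, toC y₀) := S.holo.contDiffAt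
  obtain ⟨C, hCpos, h2⟩ := eventually_hessian_le (contDiffAt_imPhase (m := 2) (u := (x₀, y₀)) hC)
  obtain ⟨r, hr, hball⟩ := Metric.eventually_nhds_iff_ball.1
    ((h1.and h2).and S.eventually_analyticAt)
  refine ⟨c / 2, by positivity, C / 2, by positivity, r, hr, fun x hx y hy => ?_⟩
  have hmem : ∀ {y}, y ∈ Metric.ball y₀ r → (x, y) ∈ Metric.ball (x₀, y₀) r := fun hy => by
    rw [← ball_prod_same]; exact ⟨hx, hy⟩
  refine ⟨(hball _ (hmem hy)).2, fun y' hy' => ?_⟩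
  have hseg : segment ℝ (x, y) (x, y') ⊆ Metric.ball (x₀, y₀) r :=
    (convex_ball _ _).segment_subset (hmem hy) (hmem hy')
  have hsub : ((x, y') : Cn n × Rn n) - (x, y) = (0, y' - y) := by simp
  have hcd : ∀ z ∈ segment ℝ (x, y) (x, y'), ContDiffAt ℝ 2 (imPhase f) z := fun z hz =>
    contDiffAt_imPhase (m := 2) (hball z (hseg hz)).2.contDiffAt
  have hder := fderiv_imPhase (u := (x, y)) (hball _ (hmem hy)).2.differentiableAt (0, y' - y)
  constructor
  · have := le_of_hessian_lower_bound (c := c * ‖y' - y‖ ^ 2) hcd (fun z hz => by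
      rw [hsub]
      exact (hball z (hseg hz)).1.1 _)
    rw [hsub, hder] at this
    linarith
  · have := le_of_hessian_upper_bound (c := C * ‖y' - y‖ ^ 2) hcd (fun z hz => by
      rw [hsub]
      have := (le_abs_self _).trans ((hball z (hseg hz)).1.2 (0, y' - y) (0, y' - y))
      rw [Prod.norm_mk, norm_zero, max_eq_right (norm_nonneg _)] at this
      linarith)
    rw [hsub, hder] at this
    linarith

lemma im_fderiv_toC {z : Cn n × Cn n} (v : Rn n) :
    (fderiv ℂ f z (0, toC v)).im = ∑ j, v j * imC (gradY f z) j := by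
  rw [fderiv_apply_inr, Complex.im_sum]
  refine Finset.sum_congr rfl fun j _ => ?_
  simp [toC, imC]

/-- The weight dominates `-Im f(x, y)`, with a gain measured by the `y`-gradient. -/
lemma exists_weight_ge (S : Setting f x₀ y₀ η₀ Φ₀) : ∃ c > 0, ∃ r > 0,
    ∀ x ∈ Metric.ball x₀ r, ∀ y ∈ Metric.ball y₀ r,
      c * ‖imC (gradY f (x, toC y))‖ ^ 2 ≤ Φ₀ x + imPhase f (x, y) := by
  obtain ⟨c, hc, C, hC, r, hr, hT⟩ := S.exists_taylor
  obtain ⟨R, hw, hR0, hRr⟩ := (S.weight.and (Ioo_mem_nhdsGT hr)).exists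
  -- the gradient vanishes at the base point, so it is small nearby
  have hcont : ContinuousAt (fun u : Cn n × Rn n => imC (gradY f (u.1, toC u.2))) (x₀, y₀) := by
    have h1 : ContinuousAt (gradY f) (incl n (x₀, y₀)) :=
      (contDiffAt_gradY S.holo.contDiffAt).continuousAt
    have h2 := h1.comp (f := incl n) (incl n).continuous.continuousAt
    exact continuous_imC.continuousAt.comp h2
  have h0 : imC (gradY f (x₀, toC y₀)) = 0 := by
    rw [S.real]; ext j; simp [imC, toC]
  have hsmall : ∀ᶠ u in 𝓝 ((x₀, y₀) : Cn n × Rn n), ‖imC (gradY f (u.1, toC u.2))‖ < R / 2 * C :=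
    hcont.norm.tendsto.eventually_lt_const (by simp only [h0, norm_zero]; positivity)
  obtain ⟨r₁, hr₁, hb₁⟩ := Metric.eventually_nhds_iff_ball.1 hsmall
  obtain ⟨r₂, hr₂, hb₂⟩ := Metric.eventually_nhds_iff_ball.1 hw
  refine ⟨1 / (2 * C) / 2, by positivity, min (min r₁ r₂) (min (R / 2) r), by positivity,
    fun x hx y hy => ?_⟩
  simp only [Metric.mem_ball, lt_min_iff] at hx hy
  set w := imC (gradY f (x, toC y)) with hwdef
  have hwsmall : ‖w‖ < R / 2 * C := hb₁ (x, y) (by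
    rw [← ball_prod_same]; exact ⟨hx.1.1, hy.1.1⟩)
  set τ := 1 / (2 * C) with hτ
  have hτ0 : 0 < τ := by positivity
  -- one gradient step from `y` competes in the supremum that defines the weight
  set y' := y - τ • w with hy'
  have hyy : y' - y = -(τ • w) := by simp [hy']
  have hy'R : y' ∈ Metric.ball y₀ R := by
    rw [mem_ball_iff_norm]
    have : y' - y₀ = (y - y₀) - τ • w := by rw [hy']; abel
    rw [this]
    refine (norm_sub_le _ _).trans_lt ?_
    rw [norm_smul, Real.norm_of_nonneg hτ0.le]
    have h1 : ‖y - y₀‖ < R / 2 := by rw [← dist_eq_norm]; exact hy.2.1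
    have h2 : τ * ‖w‖ < R / 2 := by
      have : τ * ‖w‖ < τ * (R / 2 * C) := by gcongr
      refine this.trans_le ?_
      rw [hτ]
      field_simp
      norm_num
    linarith
  have h1 : -imPhase f (x, y') ≤ Φ₀ x := (hb₂ x hx.1.2).1 ⟨y', hy'R, rfl⟩
  have h2 := ((hT x hx.2.2 y hy.2.2).2 y' (Metric.ball_subset_ball hRr.le hy'R)).2
  rw [hyy, im_fderiv_toC, norm_neg, norm_smul, Real.norm_of_nonneg hτ0.le] at h2
  have h3 : ∑ j, (-(τ • w)) j * imC (gradY f (x, toC y)) j = -(τ * ∑ j, w j ^ 2) := by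
    rw [Finset.mul_sum, ← Finset.sum_neg_distrib]
    refine Finset.sum_congr rfl fun j _ => ?_
    rw [← hwdef]
    simp only [Pi.neg_apply, Pi.smul_apply, smul_eq_mul]
    ring
  rw [h3] at h2
  have h4 : τ * ‖w‖ ^ 2 ≤ τ * ∑ j, w j ^ 2 := by gcongr; exact sq_norm_le_sum_sq w
  have h5 : C * (τ * ‖w‖) ^ 2 = τ / 2 * ‖w‖ ^ 2 := by
    rw [hτ]; field_simp
  linarith

/-- A real critical point of `y ↦ -Im f(x, y)` is its maximum. -/
lemma exists_weight_eq (S : Setting f x₀ y₀ η₀ Φ₀) : ∃ r > 0,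
    ∀ x ∈ Metric.ball x₀ r, ∀ y ∈ Metric.ball y₀ r, imC (gradY f (x, toC y)) = 0 →
      Φ₀ x = -imPhase f (x, y) := by
  obtain ⟨c, hc, C, hC, r, hr, hT⟩ := S.exists_taylor
  obtain ⟨R, hw, hR0, hRr⟩ := (S.weight.and (Ioo_mem_nhdsGT hr)).exists
  obtain ⟨r₂, hr₂, hb₂⟩ := Metric.eventually_nhds_iff_ball.1 hw
  refine ⟨min r₂ R, by positivity, fun x hx y hy h0 => ?_⟩
  simp only [Metric.mem_ball, lt_min_iff] at hx hy
  have hlub := hb₂ x hx.1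
  refine hlub.unique ⟨?_, fun b hb => hb ⟨y, hy.2, rfl⟩⟩
  rintro _ ⟨y', hy', rfl⟩
  have h2 := ((hT x (hx.2.trans hRr) y (hy.2.trans hRr)).2 y'
    (Metric.ball_subset_ball hRr.le hy')).1
  rw [im_fderiv_toC, h0] at h2
  simp only [Pi.zero_apply, mul_zero, Finset.sum_const_zero, add_zero] at h2
  have : 0 ≤ c * ‖y' - y‖ ^ 2 := by positivity
  simp only [imPhase] at h2 ⊢
  linarith

/-- The supremum defining the weight is attained at a critical point close to `y₀`. -/
lemma eventually_exists_critical (S : Setting f x₀ y₀ η₀ Φ₀) {ε : ℝ} (hε : 0 < ε) :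
    ∀ᶠ x in 𝓝 x₀, ∃ y ∈ Metric.ball y₀ ε, imC (gradY f (x, toC y)) = 0 := by
  obtain ⟨c, hc, C, hC, r, hr, hT⟩ := S.exists_taylor
  obtain ⟨R, hw, hR0, hRr⟩ := (S.weight.and (Ioo_mem_nhdsGT (lt_min hr hε))).exists
  obtain ⟨R', hw', hR'0, hR'R⟩ := (S.weight.and (Ioo_mem_nhdsGT hR0)).exists
  filter_upwards [hw, hw', Metric.ball_mem_nhds x₀ hr] with x hx hx' hxr
  have hRr' : R < r := hRr.trans_le (min_le_left _ _)
  have hcont : ContinuousOn (fun y : Rn n => -imPhase f (x, y)) (Metric.closedBall y₀ R') := by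
    intro y hy
    have hyr : y ∈ Metric.ball y₀ r :=
      Metric.closedBall_subset_ball (hR'R.trans hRr') hy
    have h1 : ContinuousAt (imPhase f) (x, y) :=
      (contDiffAt_imPhase (m := 0) (hT x hxr y hyr).1.contDiffAt).continuousAt
    have h2 : ContinuousAt (fun y : Rn n => imPhase f (x, y)) y :=
      ContinuousAt.comp (f := fun y : Rn n => (x, y)) h1 (by fun_prop)
    exact h2.neg.continuousWithinAt
  obtain ⟨y, hy, hmax⟩ := (isCompact_closedBall y₀ R').exists_isMaxOn
    ⟨y₀, Metric.mem_closedBall_self hR'0.le⟩ hcont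
  have hyR : y ∈ Metric.ball y₀ R := Metric.closedBall_subset_ball hR'R hy
  have hyr : y ∈ Metric.ball y₀ r := Metric.ball_subset_ball hRr'.le hyR
  refine ⟨y, Metric.ball_subset_ball (hRr.trans_le (min_le_right _ _)).le hyR, ?_⟩
  -- the supremum over the larger ball is already reached on the smaller closed ball
  have hle : ∀ y' ∈ Metric.ball y₀ R, -imPhase f (x, y') ≤ -imPhase f (x, y) := by
    intro y' hy'
    have h1 : -imPhase f (x, y') ≤ Φ₀ x := hx.1 ⟨y', hy', rfl⟩
    refine h1.trans (hx'.2 ?_)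
    rintro _ ⟨y'', hy'', rfl⟩
    exact hmax (Metric.ball_subset_closedBall hy'')
  have hloc : IsLocalMin (fun y : Rn n => imPhase f (x, y)) y := by
    filter_upwards [Metric.isOpen_ball.mem_nhds hyR] with y' hy'
    have := hle y' hy'
    linarith
  have hd : HasFDerivAt (fun y : Rn n => imPhase f (x, y))
      ((fderiv ℝ (imPhase f) (x, y)).comp (ContinuousLinearMap.inr ℝ (Cn n) (Rn n))) y := by
    have h1 : DifferentiableAt ℝ (imPhase f) (x, y) :=
      (contDiffAt_imPhase (m := 1) (hT x hxr y hyr).1.contDiffAt).differentiableAt (by norm_num)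
    exact h1.hasFDerivAt.comp y (hasFDerivAt_prodMk_right x y)
  have h0 := hloc.hasFDerivAt_eq_zero hd
  ext j
  have h1 := congrArg (fun l => l (Pi.single j 1)) h0
  simp only [ContinuousLinearMap.comp_apply, ContinuousLinearMap.inr_apply, zero_apply] at h1
  rw [fderiv_imPhase (hT x hxr y hyr).1.differentiableAt, im_fderiv_toC] at h1
  simpa [Pi.single_apply] using h1

end Setting

end FBI

namespace FBI

/-! ### Second-order geometry of the weight -/

lemma two_le_infty : (2 : WithTop ℕ∞) ≤ ∞ := by
  have : ((2 : ℕ∞) : WithTop ℕ∞) ≤ ((⊤ : ℕ∞) : WithTop ℕ∞) := WithTop.coe_le_coe.2 le_top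
  exact this

section Hessians

variable {E : Type*} [NormedAddCommGroup E] [NormedSpace ℝ E]

lemma hessian_add {a b : E → ℝ} {u : E} (ha : ContDiffAt ℝ 2 a u) (hb : ContDiffAt ℝ 2 b u)
    (v w : E) : fderiv ℝ (fderiv ℝ fun u => a u + b u) u v w =
      fderiv ℝ (fderiv ℝ a) u v w + fderiv ℝ (fderiv ℝ b) u v w := by
  have hev : fderiv ℝ (fun u => a u + b u) =ᶠ[𝓝 u] fun u => fderiv ℝ a u + fderiv ℝ b u := by
    filter_upwards [ha.eventually (by simp), hb.eventually (by simp)] with z hz hz'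
    exact fderiv_fun_add (hz.differentiableAt (by norm_num)) (hz'.differentiableAt (by norm_num))
  rw [hev.fderiv_eq, fderiv_fun_add
    ((ha.fderiv_right (m := 1) (by norm_num)).differentiableAt (by norm_num))
    ((hb.fderiv_right (m := 1) (by norm_num)).differentiableAt (by norm_num))]
  rfl

/-- The Hessian of a square at a zero. -/
lemma hessian_mul_sq {a : E → ℝ} {u : E} (ha : ContDiffAt ℝ 2 a u) (h0 : a u = 0) (c : ℝ) (v : E) :
    fderiv ℝ (fderiv ℝ fun u => c * a u ^ 2) u v v = 2 * c * fderiv ℝ a u v ^ 2 := by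
  have hsq : ContDiffAt ℝ 2 (fun u => c * a u ^ 2) u := contDiffAt_const.mul (ha.pow 2)
  rw [fderiv_fderiv_apply hsq]
  have hev : (fun u => fderiv ℝ (fun u => c * a u ^ 2) u v) =ᶠ[𝓝 u]
      fun u => c * (2 * (a u * fderiv ℝ a u v)) := by
    filter_upwards [ha.eventually (by simp)] with z hz
    have hd := (hz.differentiableAt (by norm_num)).hasFDerivAt
    have h2 : HasFDerivAt (fun u => c * a u ^ 2) _ z := (hd.pow 2).const_mul c
    rw [h2.fderiv]
    simp only [smul_apply, nsmul_eq_mul, smul_eq_mul]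
    simp only [Nat.cast_ofNat, Nat.add_one_sub_one, pow_one]
    ring
  rw [hev.fderiv_eq]
  have hd : HasFDerivAt a (fderiv ℝ a u) u := (ha.differentiableAt (by norm_num)).hasFDerivAt
  have hd2 : DifferentiableAt ℝ (fun u => fderiv ℝ a u v) u :=
    (((ha.fderiv_right (m := 1) (by norm_num)).differentiableAt (by norm_num))).clm_apply
      (differentiableAt_const v)
  have h3 : HasFDerivAt (fun u => c * (2 * (a u * fderiv ℝ a u v))) _ u :=
    ((hd.mul hd2.hasFDerivAt).const_mul 2).const_mul c
  rw [h3.fderiv]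
  simp [h0]
  ring

end Hessians

variable {n : ℕ}

/-- The mixed second derivative `f''_{yx}` as an endomorphism of `ℂⁿ`. -/
noncomputable def mixed (f : Cn n × Cn n → ℂ) (z : Cn n × Cn n) : Cn n →L[ℂ] Cn n :=
  ContinuousLinearMap.pi fun j =>
    ((fderiv ℂ (fderiv ℂ f) z).flip (0, Pi.single j 1)).comp
      (ContinuousLinearMap.inl ℂ (Cn n) (Cn n))

lemma mixed_apply (f : Cn n × Cn n → ℂ) (z : Cn n × Cn n) (v : Cn n) (j : Fin n) :
    mixed f z v j = fderiv ℂ (fderiv ℂ f) z (v, 0) (0, Pi.single j 1) := rfl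

namespace Setting

variable {f : Cn n × Cn n → ℂ} {x₀ : Cn n} {y₀ η₀ : Rn n} {Φ₀ : Cn n → ℝ}

lemma mixed_injective (S : Setting f x₀ y₀ η₀ Φ₀) :
    Function.Injective (mixed f (x₀, toC y₀)) := by
  rw [injective_iff_map_eq_zero]
  intro v hv
  refine S.inj v fun w => ?_
  have := clm_apply_eq_sum ((fderiv ℂ (fderiv ℂ f) (x₀, toC y₀) (v, 0)).comp
    (ContinuousLinearMap.inr ℂ (Cn n) (Cn n))) w
  simp only [ContinuousLinearMap.comp_apply, ContinuousLinearMap.inr_apply] at this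
  rw [this]
  refine Finset.sum_eq_zero fun j _ => ?_
  rw [← mixed_apply, hv]
  simp

lemma mixed_isInvertible (S : Setting f x₀ y₀ η₀ Φ₀) :
    (mixed f (x₀, toC y₀)).IsInvertible := by
  refine ⟨(LinearEquiv.ofInjectiveEndo (mixed f (x₀, toC y₀) : Cn n →ₗ[ℂ] Cn n)
    S.mixed_injective).toContinuousLinearEquiv, ?_⟩
  ext v
  rfl

lemma exists_mixed_ge (S : Setting f x₀ y₀ η₀ Φ₀) :
    ∃ c > 0, ∀ v, c * ‖v‖ ≤ ‖mixed f (x₀, toC y₀) v‖ := by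
  obtain ⟨K, hK, h⟩ := LinearMap.exists_antilipschitzWith
    (mixed f (x₀, toC y₀) : Cn n →ₗ[ℂ] Cn n) (LinearMap.ker_eq_bot.2 S.mixed_injective)
  refine ⟨(K : ℝ)⁻¹, by positivity, fun v => ?_⟩
  have := h.le_mul_dist v 0
  simp only [dist_zero_right, map_zero, ContinuousLinearMap.coe_coe] at this
  rw [inv_mul_le_iff₀ (by positivity)]
  exact this

lemma fderiv_imC_gradY {x : Cn n} (y : Rn n) (hf : ContDiffAt ℂ 2 f (x, toC y)) (j : Fin n)
    (v : Cn n) :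
    fderiv ℝ (fun x => imC (gradY f (x, toC y)) j) x v = (mixed f (x, toC y) v j).im := by
  have h1 := (hasFDerivAt_pi.1 (hasFDerivAt_gradY hf) j).comp (f := fun x => (x, toC y)) x
    (hasFDerivAt_prodMk_left x (toC y))
  have h2 := Complex.imCLM.hasFDerivAt.comp x (h1.restrictScalars ℝ)
  have h3 : fderiv ℝ (fun x => imC (gradY f (x, toC y)) j) x = _ := h2.fderiv
  rw [h3]
  rfl

/-- Lower bound for the Hessian of `x ↦ Φ₀(x) + Im f(x, y₀)`. -/
lemma exists_hessian_weight_ge (S : Setting f x₀ y₀ η₀ Φ₀) : ∃ c > 0, ∀ v : Cn n,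
    c * ‖imC (mixed f (x₀, toC y₀) v)‖ ^ 2 ≤ fderiv ℝ (fderiv ℝ Φ₀) x₀ v v +
      (fderiv ℂ (fderiv ℂ f) (x₀, toC y₀) (v, 0) (v, 0)).im := by
  obtain ⟨c, hc, r, hr, hM⟩ := S.exists_weight_ge
  obtain ⟨r', hr', hE⟩ := S.exists_weight_eq
  have hC : ContDiffAt ℂ ∞ f (x₀, toC y₀) := S.holo.contDiffAt
  have hC2 : ContDiffAt ℂ 2 f (x₀, toC y₀) := S.holo.contDiffAt
  have h0 : imC (gradY f (x₀, toC y₀)) = 0 := by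
    rw [S.real]; ext j; simp [imC, toC]
  have hval : Φ₀ x₀ + imPhase f (x₀, y₀) = 0 := by
    rw [hE x₀ (Metric.mem_ball_self hr') y₀ (Metric.mem_ball_self hr') h0]; ring
  set L : Cn n →L[ℝ] Cn n × Cn n := ContinuousLinearMap.inl ℝ (Cn n) (Cn n) with hL
  have hfun : (fun x => imPhase f (x, y₀)) = fun x => (f ((0, toC y₀) + L x)).im := by
    ext x; simp [imPhase, hL]
  have hpt : (0, toC y₀) + L x₀ = (x₀, toC y₀) := by simp [hL]
  have hg2 : ContDiffAt ℝ 2 (fun x => imPhase f (x, y₀)) x₀ := by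
    rw [hfun]
    exact contDiffAt_im_comp (m := 2) L (by rw [hpt]; exact hC2)
  have hΦ2 : ContDiffAt ℝ 2 Φ₀ x₀ := S.smooth.of_le two_le_infty
  refine ⟨2 * c, by positivity, fun v => ?_⟩
  have hbase : fderiv ℝ (fderiv ℝ fun x => Φ₀ x + imPhase f (x, y₀)) x₀ v v =
      fderiv ℝ (fderiv ℝ Φ₀) x₀ v v +
        (fderiv ℂ (fderiv ℂ f) (x₀, toC y₀) (v, 0) (v, 0)).im := by
    rw [hessian_add hΦ2 hg2, hfun, hessian_im_comp L (by rw [hpt]; exact hC2), hpt]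
    simp [hL]
  have key : ∀ j, 2 * c * (imC (mixed f (x₀, toC y₀) v) j) ^ 2 ≤
      fderiv ℝ (fderiv ℝ Φ₀) x₀ v v +
        (fderiv ℂ (fderiv ℂ f) (x₀, toC y₀) (v, 0) (v, 0)).im := by
    intro j
    set w : Cn n → ℝ := fun x => imC (gradY f (x, toC y₀)) j with hw
    have hw2 : ContDiffAt ℝ 2 w x₀ := by
      have h1 : ContDiffAt ℂ ∞ (fun x => gradY f (x, toC y₀) j) x₀ :=
        ContDiffAt.comp (g := fun z => gradY f z j) x₀ (contDiffAt_pi.1 (contDiffAt_gradY hC) j)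
          (by fun_prop)
      exact (Complex.imCLM.contDiff.contDiffAt.comp x₀ (h1.restrict_scalars ℝ)).of_le
        two_le_infty
    -- the gain in `exists_weight_ge` can be subtracted, and the local minimum at `x₀` is kept
    have hmin : IsLocalMin (fun x => (Φ₀ x + imPhase f (x, y₀)) + -c * w x ^ 2) x₀ := by
      filter_upwards [Metric.ball_mem_nhds x₀ hr] with x hx
      have h1 := hM x hx y₀ (Metric.mem_ball_self hr)
      have h2 : w x ^ 2 ≤ ‖imC (gradY f (x, toC y₀))‖ ^ 2 := by
        have := norm_le_pi_norm (imC (gradY f (x, toC y₀))) j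
        rw [Real.norm_eq_abs] at this
        rw [← sq_abs (w x)]
        gcongr
      have h3 : w x₀ = 0 := by rw [hw]; simp only [h0]; rfl
      rw [h3, hval]
      nlinarith
    have := hessian_nonneg_of_isLocalMin ((hΦ2.add hg2).add (contDiffAt_const.mul (hw2.pow 2)))
      hmin v
    rw [hessian_add (hΦ2.add hg2) (contDiffAt_const.mul (hw2.pow 2)), hbase,
      hessian_mul_sq hw2 (by rw [hw]; simp only [h0]; rfl), hw,
      fderiv_imC_gradY y₀ hC2] at this
    simp only [imC]
    linarith
  set w := imC (mixed f (x₀, toC y₀) v) with hw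
  rcases isEmpty_or_nonempty (Fin n) with he | he
  · have hv0 : v = 0 := Subsingleton.elim _ _
    have hw0 : w = 0 := Subsingleton.elim _ _
    rw [hw0, hv0]
    have h00 : ((0, 0) : Cn n × Cn n) = 0 := rfl
    simp [h00]
  · obtain ⟨j, hj⟩ := Finite.exists_max fun j => ‖w j‖
    have h1 : ‖w‖ ≤ ‖w j‖ := (pi_norm_le_iff_of_nonneg (norm_nonneg _)).2 hj
    refine le_trans ?_ (key j)
    rw [← sq_abs (w j), ← Real.norm_eq_abs]
    gcongr

/-- The weight is strictly plurisubharmonic: in the sum of the Hessians in the directions `v` and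
`i v` the pluriharmonic contribution of `f''_{xx}` cancels. -/
lemma exists_levi_ge (S : Setting f x₀ y₀ η₀ Φ₀) : ∃ c > 0, ∀ v : Cn n,
    c * ‖v‖ ^ 2 ≤ fderiv ℝ (fderiv ℝ Φ₀) x₀ v v +
      fderiv ℝ (fderiv ℝ Φ₀) x₀ (Complex.I • v) (Complex.I • v) := by
  obtain ⟨c, hc, hH⟩ := S.exists_hessian_weight_ge
  obtain ⟨c', hc', hA⟩ := S.exists_mixed_ge
  refine ⟨c / 2 * c' ^ 2, by positivity, fun v => ?_⟩
  have h1 := hH v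
  have h2 := hH (Complex.I • v)
  have h3 : fderiv ℂ (fderiv ℂ f) (x₀, toC y₀) (Complex.I • v, 0) (Complex.I • v, 0) =
      -fderiv ℂ (fderiv ℂ f) (x₀, toC y₀) (v, 0) (v, 0) := by
    have : ((Complex.I • v, 0) : Cn n × Cn n) = Complex.I • (v, 0) := by simp
    rw [this, map_smul, map_smul, smul_apply, smul_smul, Complex.I_mul_I, neg_smul, one_smul]
  rw [h3, map_smul, Complex.neg_im] at h2
  set w := mixed f (x₀, toC y₀) v with hw
  have h4 : imC (Complex.I • w) = reC w := by ext j; simp [imC, reC]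
  rw [h4] at h2
  have h5 : (c' * ‖v‖) ^ 2 ≤ (‖reC w‖ + ‖imC w‖) ^ 2 := by
    gcongr
    exact (hA v).trans (norm_le_reC_add_imC w)
  have h6 : (‖reC w‖ + ‖imC w‖) ^ 2 ≤ 2 * (‖reC w‖ ^ 2 + ‖imC w‖ ^ 2) := by
    nlinarith [sq_nonneg (‖reC w‖ - ‖imC w‖)]
  have h7 : c / 2 * (c' * ‖v‖) ^ 2 ≤ c / 2 * (2 * (‖reC w‖ ^ 2 + ‖imC w‖ ^ 2)) := by
    gcongr; exact h5.trans h6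
  linarith

/-- Over a critical point the covector of the weight is the `x`-gradient of the phase. -/
lemma exists_wcov_eq (S : Setting f x₀ y₀ η₀ Φ₀) : ∃ r > 0,
    ∀ x ∈ Metric.ball x₀ r, ∀ y ∈ Metric.ball y₀ r, imC (gradY f (x, toC y)) = 0 →
      wcov Φ₀ x = gradX f (x, toC y) := by
  obtain ⟨c, hc, r, hr, hM⟩ := S.exists_weight_ge
  obtain ⟨r', hr', hE⟩ := S.exists_weight_eq
  obtain ⟨r₂, hr₂, hA⟩ := Metric.eventually_nhds_iff_ball.1 S.eventually_analyticAt
  obtain ⟨r₃, hr₃, hS⟩ := Metric.eventually_nhds_iff_ball.1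
    ((S.smooth.of_le (m := 1) (mod_cast le_top)).eventually (by simp))
  refine ⟨min (min r r') (min r₂ r₃), by positivity, fun x hx y hy h0 => ?_⟩
  simp only [Metric.mem_ball, lt_min_iff] at hx hy
  have hf : AnalyticAt ℂ f (x, toC y) := hA (x, y) (by
    rw [← ball_prod_same]; exact ⟨hx.2.1, hy.2.1⟩)
  have hΦ : DifferentiableAt ℝ Φ₀ x := (hS x hx.2.2).differentiableAt (by norm_num)
  have hval := hE x hx.1.2 y hy.1.2 h0
  -- `Φ₀(x) + Im f(x, y)` is nonnegative and vanishes at the critical pair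
  have hmin : IsLocalMin (fun x => Φ₀ x + imPhase f (x, y)) x := by
    filter_upwards [Metric.isOpen_ball.mem_nhds (x := x) (s := Metric.ball x₀ r) hx.1.1] with x' hx'
    have h1 := hM x' hx' y hy.1.1
    rw [hval]
    have : 0 ≤ c * ‖imC (gradY f (x', toC y))‖ ^ 2 := by positivity
    linarith
  have hd : HasFDerivAt (fun x => imPhase f (x, y))
      ((fderiv ℝ (imPhase f) (x, y)).comp (ContinuousLinearMap.inl ℝ (Cn n) (Rn n))) x := by
    have h1 : DifferentiableAt ℝ (imPhase f) (x, y) :=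
      (contDiffAt_imPhase (m := 1) hf.contDiffAt).differentiableAt (by norm_num)
    exact h1.hasFDerivAt.comp (f := fun x => (x, y)) x (hasFDerivAt_prodMk_left x y)
  have hz := hmin.hasFDerivAt_eq_zero (hΦ.hasFDerivAt.add hd)
  have hdΦ : ∀ v, fderiv ℝ Φ₀ x v = -(fderiv ℂ f (x, toC y) (v, 0)).im := by
    intro v
    have h1 := congrArg (fun l => l v) hz
    simp only [add_apply, ContinuousLinearMap.comp_apply,
      ContinuousLinearMap.inl_apply, zero_apply] at h1
    rw [fderiv_imPhase hf.differentiableAt] at h1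
    simp only [toC_zero] at h1
    linarith
  ext j
  have h : HasFDerivAt (fun x => (Φ₀ x : ℂ)) (Complex.ofRealCLM.comp (fderiv ℝ Φ₀ x)) x :=
    Complex.ofRealCLM.hasFDerivAt.comp x hΦ.hasFDerivAt
  have hI : ((Complex.I • Pi.single j 1, 0) : Cn n × Cn n) = Complex.I • (Pi.single j 1, 0) := by
    simp
  simp only [wcov, cov, pd, del, h.fderiv, ContinuousLinearMap.comp_apply, Complex.ofRealCLM_apply,
    hdΦ, Pi.smul_apply, smul_eq_mul, gradX]
  rw [hI, map_smul, smul_eq_mul]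
  set a := fderiv ℂ f (x, toC y) (Pi.single j 1, 0)
  apply Complex.ext <;> simp <;> ring

/-- The holomorphic implicit function: near `(x₀, y₀, η₀)` the equation `-f'_y(x, y) = η` is
equivalent to `x = X(y, η)`. -/
lemma exists_implicit (S : Setting f x₀ y₀ η₀ Φ₀) : ∃ X : Cn n × Cn n → Cn n,
    AnalyticAt ℂ X (toC y₀, toC η₀) ∧ X (toC y₀, toC η₀) = x₀ ∧
      ∀ᶠ v in 𝓝 (((toC y₀, toC η₀), x₀) : (Cn n × Cn n) × Cn n),
        gradY f (v.2, v.1.1) = -v.1.2 ↔ X v.1 = v.2 := by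
  set F : (Cn n × Cn n) × Cn n → Cn n := fun v => gradY f (v.2, v.1.1) + v.1.2 with hF
  set u : (Cn n × Cn n) × Cn n := ((toC y₀, toC η₀), x₀) with hu
  have hC : ContDiffAt ℂ ∞ f (x₀, toC y₀) := S.holo.contDiffAt
  have hcd : ContDiffAt ℂ ω F u := by
    refine ContDiffAt.add ?_ (by fun_prop)
    exact ContDiffAt.comp (g := gradY f) (f := fun v : (Cn n × Cn n) × Cn n => (v.2, v.1.1)) u
      (analyticAt_gradY S.holo).contDiffAt (by fun_prop)
  have hder : fderiv ℂ F u ∘L .inr ℂ (Cn n × Cn n) (Cn n) = mixed f (x₀, toC y₀) := by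
    have h1 : HasFDerivAt (fun x => F ((toC y₀, toC η₀), x))
        (fderiv ℂ F u ∘L .inr ℂ (Cn n × Cn n) (Cn n)) x₀ :=
      (hcd.differentiableAt (by simp)).hasFDerivAt.comp x₀ (hasFDerivAt_prodMk_right _ x₀)
    have h2 : HasFDerivAt (fun x => F ((toC y₀, toC η₀), x)) (mixed f (x₀, toC y₀)) x₀ := by
      have := ((hasFDerivAt_gradY (hC.of_le two_le_infty)).comp (f := fun x => (x, toC y₀)) x₀
        (hasFDerivAt_prodMk_left x₀ (toC y₀))).add_const (toC η₀)
      refine this.congr_fderiv ?_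
      ext v j
      rfl
    exact h1.unique h2
  have hinv : (fderiv ℂ F u ∘L .inr ℂ (Cn n × Cn n) (Cn n)).IsInvertible := by
    rw [hder]; exact S.mixed_isInvertible
  have hF0 : F u = 0 := by simp [hF, hu, S.real]
  refine ⟨hcd.implicitFunction (by simp) hinv, (hcd.contDiffAt_implicitFunction (by simp) hinv).analyticAt,
    hcd.implicitFunction_apply_self (by simp) hinv, ?_⟩
  filter_upwards [hcd.eventually_apply_eq_iff_implicitFunction (by simp) hinv] with v hv
  rw [hF0] at hv
  rw [← hv, eq_neg_iff_add_eq_zero]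

end Setting

end FBI

namespace FBI

/-! ### The chart given by the projected canonical transformation -/

variable {n : ℕ}

/-- The inclusion of the real phase space in the complex one. -/
noncomputable def toCC (ρ : Rn n × Rn n) : Cn n × Cn n := (toC ρ.1, toC ρ.2)

/-- The inclusion of phase spaces as a continuous linear map. -/
noncomputable def toCCL (n : ℕ) : Rn n × Rn n →L[ℝ] Cn n × Cn n := (toCL n).prodMap (toCL n)

lemma imC_neg_toC (y : Rn n) : imC (-toC y) = 0 := by ext j; simp [imC, toC]

/-- The differential of the identity `f'_y(X(y, η), y) = -η`. -/
lemma fderiv_implicit {f : Cn n × Cn n → ℂ} {X : Cn n × Cn n → Cn n} {w : Cn n × Cn n}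
    (hf : ContDiffAt ℂ 2 f (X w, w.1)) (hX : DifferentiableAt ℂ X w)
    (h : ∀ᶠ v in 𝓝 w, gradY f (X v, v.1) = -v.2) (v : Cn n × Cn n) (j : Fin n) :
    fderiv ℂ (fderiv ℂ f) (X w, w.1) (fderiv ℂ X w v, v.1) (0, Pi.single j 1) = -v.2 j := by
  have h1 : HasFDerivAt (fun v : Cn n × Cn n => (X v, v.1))
      ((fderiv ℂ X w).prod (ContinuousLinearMap.fst ℂ (Cn n) (Cn n))) w :=
    hX.hasFDerivAt.prodMk hasFDerivAt_fst
  have h2 := (hasFDerivAt_gradY hf).comp (f := fun v : Cn n × Cn n => (X v, v.1)) w h1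
  have h3 : HasFDerivAt (fun v : Cn n × Cn n => -v.2)
      (-ContinuousLinearMap.snd ℂ (Cn n) (Cn n)) w := hasFDerivAt_snd.neg
  have h4 := (h2.congr_of_eventuallyEq (h.mono fun v hv => hv.symm)).unique h3
  have h5 := congrArg (fun l => l v j) h4
  simpa using h5

/-- The local chart `ρ = (y, η) ↦ x = X(y, η)` given by the projection of the canonical
transformation: `X` is holomorphic near the real point `ρ`, solves `f'_y(X, y) = -η`, and at real
points the weight and its covector are read off from the phase. -/
structure ChartAt (f : Cn n × Cn n → ℂ) (Φ₀ : Cn n → ℝ) (X : Cn n × Cn n → Cn n)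
    (ρ : Rn n × Rn n) : Prop where
  smooth : AnalyticAt ℂ X (toCC ρ)
  holo : AnalyticAt ℂ f (X (toCC ρ), toC ρ.1)
  eqn : ∀ᶠ v in 𝓝 (toCC ρ), gradY f (X v, v.1) = -v.2
  weight : Φ₀ (X (toCC ρ)) = -Setting.imPhase f (X (toCC ρ), ρ.1)
  covector : wcov Φ₀ (X (toCC ρ)) = gradX f (X (toCC ρ), toC ρ.1)

namespace ChartAt

variable {f : Cn n × Cn n → ℂ} {Φ₀ : Cn n → ℝ} {X : Cn n × Cn n → Cn n} {ρ : Rn n × Rn n}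

lemma critical (h : ChartAt f Φ₀ X ρ) : gradY f (X (toCC ρ), toC ρ.1) = -toC ρ.2 :=
  h.eqn.self_of_nhds

lemma fderiv_eqn (h : ChartAt f Φ₀ X ρ) (v : Cn n × Cn n) (j : Fin n) :
    fderiv ℂ (fderiv ℂ f) (X (toCC ρ), toC ρ.1) (fderiv ℂ X (toCC ρ) v, v.1)
      (0, Pi.single j 1) = -v.2 j :=
  fderiv_implicit h.holo.contDiffAt h.smooth.differentiableAt h.eqn v j

lemma mixed_injective (h : ChartAt f Φ₀ X ρ) :
    Function.Injective (mixed f (X (toCC ρ), toC ρ.1)) := by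
  have hs : Function.Surjective (mixed f (X (toCC ρ), toC ρ.1) : Cn n →ₗ[ℂ] Cn n) := by
    intro v
    refine ⟨fderiv ℂ X (toCC ρ) (0, -v), ?_⟩
    ext j
    have := h.fderiv_eqn (0, -v) j
    rw [← mixed_apply] at this
    simpa using this
  exact LinearMap.injective_iff_surjective.2 hs

end ChartAt

namespace Setting

variable {f : Cn n × Cn n → ℂ} {x₀ : Cn n} {y₀ η₀ : Rn n} {Φ₀ : Cn n → ℝ}

/-- The projection of the canonical transformation to `x`-space restricts to a local chart of the real
phase space; being onto comes from the attainment of the supremum that defines the weight. -/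
lemma exists_chart (S : Setting f x₀ y₀ η₀ Φ₀) : ∃ X : Cn n × Cn n → Cn n,
    X (toCC (y₀, η₀)) = x₀ ∧ (∀ᶠ ρ in 𝓝 (y₀, η₀), ChartAt f Φ₀ X ρ) ∧
    ∀ U ∈ 𝓝 ((y₀, η₀) : Rn n × Rn n), ∀ᶠ x in 𝓝 x₀, ∃ ρ ∈ U, X (toCC ρ) = x := by
  obtain ⟨X, hX, hX0, hiff⟩ := S.exists_implicit
  obtain ⟨r, hr, hE⟩ := S.exists_weight_eq
  obtain ⟨r', hr', hW⟩ := S.exists_wcov_eq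
  have hcc : Tendsto toCC (𝓝 ((y₀, η₀) : Rn n × Rn n)) (𝓝 (toC y₀, toC η₀)) :=
    (toCCL n).continuous.tendsto _
  have hXt : Tendsto X (𝓝 (toC y₀, toC η₀)) (𝓝 x₀) := by
    have := hX.continuousAt.tendsto
    rwa [hX0] at this
  refine ⟨X, hX0, ?_, ?_⟩
  · have h1 : ∀ᶠ v in 𝓝 ((toC y₀, toC η₀) : Cn n × Cn n), AnalyticAt ℂ X v :=
      hX.eventually_analyticAt
    have h2 : ∀ᶠ v in 𝓝 ((toC y₀, toC η₀) : Cn n × Cn n), AnalyticAt ℂ f (X v, v.1) := by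
      have : Tendsto (fun v : Cn n × Cn n => (X v, v.1)) (𝓝 (toC y₀, toC η₀))
          (𝓝 (x₀, toC y₀)) := hXt.prodMk_nhds continuous_fst.continuousAt
      exact this.eventually S.holo.eventually_analyticAt
    have h3 : ∀ᶠ v in 𝓝 ((toC y₀, toC η₀) : Cn n × Cn n), gradY f (X v, v.1) = -v.2 := by
      have : Tendsto (fun v : Cn n × Cn n => (v, X v)) (𝓝 (toC y₀, toC η₀))
          (𝓝 ((toC y₀, toC η₀), x₀)) := tendsto_id.prodMk_nhds hXt
      filter_upwards [this.eventually hiff] with v hv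
      exact hv.2 rfl
    filter_upwards [hcc.eventually (h1.and (h2.and h3.eventually_nhds)),
      hcc.eventually (hXt.eventually (Metric.ball_mem_nhds x₀ (lt_min hr hr'))),
      continuous_fst.continuousAt.eventually (Metric.ball_mem_nhds y₀ (lt_min hr hr'))]
      with ρ hρ hx hy
    have hc : imC (gradY f (X (toCC ρ), toC ρ.1)) = 0 := by
      have := hρ.2.2.self_of_nhds
      rw [show toC ρ.1 = (toCC ρ).1 from rfl, this]
      exact imC_neg_toC _
    simp only [lt_min_iff] at hx hy
    exact ⟨hρ.1, hρ.2.1, hρ.2.2, hE _ hx.1 _ hy.1 hc, hW _ hx.2 _ hy.2 hc⟩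
  · intro U hU
    -- the pairs `(x, y)` for which `(y, -f'_y(x, y))` is controlled by the implicit function
    have hg : ContinuousAt (fun u : Cn n × Rn n => gradY f (u.1, toC u.2)) (x₀, y₀) :=
      ContinuousAt.comp (g := gradY f) (f := incl n)
        (by simpa using (contDiffAt_gradY S.holo.contDiffAt).continuousAt)
        (incl n).continuous.continuousAt
    have hη : ContinuousAt (fun u : Cn n × Rn n => (u.2, -reC (gradY f (u.1, toC u.2))))
        (x₀, y₀) :=
      continuous_snd.continuousAt.prodMk (continuous_reC.continuousAt.comp hg).neg
    have hη0 : -reC (gradY f (x₀, toC y₀)) = η₀ := by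
      rw [S.real]; ext j; simp [reC, toC]
    have ht : Tendsto (fun u : Cn n × Rn n => ((toC u.2, -gradY f (u.1, toC u.2)), u.1))
        (𝓝 (x₀, y₀)) (𝓝 ((toC y₀, toC η₀), x₀)) := by
      have h1 : ContinuousAt (fun u : Cn n × Rn n => ((toC u.2, -gradY f (u.1, toC u.2)), u.1))
          (x₀, y₀) :=
        ((continuous_toC.comp continuous_snd).continuousAt.prodMk hg.neg).prodMk
          continuous_fst.continuousAt
      have h2 := h1.tendsto
      simpa [S.real] using h2
    have hU' : ∀ᶠ u in 𝓝 ((x₀, y₀) : Cn n × Rn n), (u.2, -reC (gradY f (u.1, toC u.2))) ∈ U := by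
      refine hη.preimage_mem_nhds ?_
      simp only [hη0]
      exact hU
    obtain ⟨ε, hε, hball⟩ := Metric.eventually_nhds_iff_ball.1 (hU'.and (ht.eventually hiff))
    filter_upwards [S.eventually_exists_critical hε, Metric.ball_mem_nhds x₀ hε] with x hx hxε
    obtain ⟨y, hy, hcrit⟩ := hx
    obtain ⟨hyU, hyX⟩ := hball (x, y) (by rw [← ball_prod_same]; exact ⟨hxε, hy⟩)
    refine ⟨_, hyU, ?_⟩
    have hreal : toC (-reC (gradY f (x, toC y))) = -gradY f (x, toC y) := by
      ext j
      have := congrFun hcrit j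
      simp only [imC, Pi.zero_apply] at this
      apply Complex.ext
      · simp [toC, reC]
      · simp [toC, reC, this]
    have := hyX.1 (by simp)
    simpa [toCC, hreal] using this

/-- The chart has a Lipschitz inverse on real points. -/
lemma exists_chart_antilipschitz (S : Setting f x₀ y₀ η₀ Φ₀) {X : Cn n × Cn n → Cn n}
    (hX0 : X (toCC (y₀, η₀)) = x₀) (hX : ChartAt f Φ₀ X (y₀, η₀)) :
    ∃ K > 0, ∃ r > 0, ∀ ρ ∈ Metric.ball (y₀, η₀) r, ∀ ρ' ∈ Metric.ball (y₀, η₀) r,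
      ‖ρ - ρ'‖ ≤ K * ‖X (toCC ρ) - X (toCC ρ')‖ := by
  have hst : HasStrictFDerivAt (fun ρ => X (toCC ρ))
      (((fderiv ℂ X (toCC (y₀, η₀))).restrictScalars ℝ).comp (toCCL n)) (y₀, η₀) := by
    have h1 : HasStrictFDerivAt X ((fderiv ℂ X (toCC (y₀, η₀))).restrictScalars ℝ)
        (toCC (y₀, η₀)) := hX.smooth.hasStrictFDerivAt.restrictScalars ℝ
    exact h1.comp (y₀, η₀) (toCCL n).hasStrictFDerivAt
  set l := ((fderiv ℂ X (toCC (y₀, η₀))).restrictScalars ℝ).comp (toCCL n) with hl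
  have hinj : LinearMap.ker (l : Rn n × Rn n →ₗ[ℝ] Cn n) = ⊥ := by
    rw [LinearMap.ker_eq_bot']
    rintro ⟨v, μ⟩ hv
    have hv' : fderiv ℂ X (toCC (y₀, η₀)) (toC v, toC μ) = 0 := hv
    have heq : ∀ j, fderiv ℂ (fderiv ℂ f) (x₀, toC y₀) (0, toC v) (0, Pi.single j 1) =
        -(μ j : ℂ) := fun j => by
      have := hX.fderiv_eqn (toC v, toC μ) j
      rwa [hv', hX0] at this
    have hv0 : v = 0 := by
      by_contra hne
      have hpos := S.pos v hne
      have hsum := clm_apply_eq_sum ((fderiv ℂ (fderiv ℂ f) (x₀, toC y₀) (0, toC v)).comp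
        (ContinuousLinearMap.inr ℂ (Cn n) (Cn n))) (toC v)
      simp only [ContinuousLinearMap.comp_apply, ContinuousLinearMap.inr_apply, heq] at hsum
      rw [hsum, Complex.im_sum] at hpos
      simp [toC] at hpos
    subst hv0
    have hμ : μ = 0 := by
      ext j
      have := heq j
      rw [toC_zero, show ((0, 0) : Cn n × Cn n) = 0 from rfl, map_zero, zero_apply] at this
      simpa using this.symm
    simp [hμ]
  obtain ⟨K, hK, hanti⟩ := LinearMap.exists_antilipschitzWith (l : Rn n × Rn n →ₗ[ℝ] Cn n) hinj
  have hK' : (0 : ℝ) < K := by exact_mod_cast hK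
  have hlo := hst.isLittleO.def (c := 1 / (2 * K)) (by positivity)
  rw [nhds_prod_eq] at hlo
  obtain ⟨r, hr, hb⟩ := Metric.eventually_nhds_iff_ball.1
    (show ∀ᶠ q in 𝓝 (((y₀, η₀), (y₀, η₀)) : (Rn n × Rn n) × (Rn n × Rn n)), _ by
      rw [nhds_prod_eq]; exact hlo)
  refine ⟨2 * K, by positivity, r, hr, fun ρ hρ ρ' hρ' => ?_⟩
  have h1 := hb (ρ, ρ') (by rw [← ball_prod_same]; exact ⟨hρ, hρ'⟩)
  simp only [] at h1
  have h2 := hanti.le_mul_dist (ρ - ρ') 0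
  simp only [dist_zero_right, map_zero, ContinuousLinearMap.coe_coe] at h2
  have h3 : ‖l (ρ - ρ')‖ ≤ ‖X (toCC ρ) - X (toCC ρ')‖ + 1 / (2 * K) * ‖ρ - ρ'‖ := by
    have : l (ρ - ρ') = (X (toCC ρ) - X (toCC ρ')) -
        (X (toCC ρ) - X (toCC ρ') - l (ρ - ρ')) := by abel
    rw [this]
    exact (norm_sub_le _ _).trans (by gcongr)
  have h4 : (K : ℝ) * ‖l (ρ - ρ')‖ ≤ K * ‖X (toCC ρ) - X (toCC ρ')‖ + 1 / 2 * ‖ρ - ρ'‖ := by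
    have : K * (‖X (toCC ρ) - X (toCC ρ')‖ + 1 / (2 * K) * ‖ρ - ρ'‖) =
      K * ‖X (toCC ρ) - X (toCC ρ')‖ + 1 / 2 * ‖ρ - ρ'‖ := by field_simp
    rw [← this]
    gcongr
  linarith

end Setting

end FBI

namespace FBI

/-! ### The Hamilton field and the canonical transformation -/

variable {n : ℕ}

/-- A smooth symbol near `(x₀, ξ₀)` whose differential is complex linear at the points of `Λ_{Φ₀}`. -/
structure Symbol (Φ₀ : Cn n → ℝ) (pt : Cn n × Cn n → ℂ) (x₀ ξ₀ : Cn n) : Prop where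
  smooth : ∀ᶠ z in 𝓝 (x₀, ξ₀), ContDiffAt ℝ ∞ pt z
  holo : ∀ᶠ z in 𝓝 (x₀, ξ₀), z ∈ LambdaSet Φ₀ →
    ∀ v, fderiv ℝ pt z (Complex.I • v) = Complex.I * fderiv ℝ pt z v

/-- The vector `∂p̃/∂ξ` at the point of `Λ_{Φ₀}` above `x`. -/
noncomputable def xiGrad (Φ₀ : Cn n → ℝ) (pt : Cn n × Cn n → ℂ) (x : Cn n) : Cn n :=
  fun j => fderiv ℝ pt (x, wcov Φ₀ x) (0, Pi.single j 1)

/-- The Hamilton vector field `(∂b/∂η, -∂b/∂y)`. -/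
noncomputable def hamVec (b : Rn n × Rn n → ℝ) (ρ : Rn n × Rn n) : Rn n × Rn n :=
  (fun j => fderiv ℝ b ρ (0, Pi.single j 1), fun j => -fderiv ℝ b ρ (Pi.single j 1, 0))

lemma hamD_eq (b g : Rn n × Rn n → ℝ) (ρ : Rn n × Rn n) :
    hamD b g ρ = fderiv ℝ g ρ (hamVec b ρ) := by
  have h1 := clm_apply_eq_sum ((fderiv ℝ g ρ).comp (ContinuousLinearMap.inl ℝ (Rn n) (Rn n)))
    (hamVec b ρ).1
  have h2 := clm_apply_eq_sum ((fderiv ℝ g ρ).comp (ContinuousLinearMap.inr ℝ (Rn n) (Rn n)))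
    (hamVec b ρ).2
  have h3 : hamVec b ρ = ((hamVec b ρ).1, 0) + (0, (hamVec b ρ).2) := by simp
  rw [h3, map_add]
  simp only [ContinuousLinearMap.comp_apply, ContinuousLinearMap.inl_apply,
    ContinuousLinearMap.inr_apply] at h1 h2
  rw [h1, h2, ← Finset.sum_add_distrib, hamD]
  refine Finset.sum_congr rfl fun j _ => ?_
  simp only [hamVec, smul_eq_mul]
  ring

lemma contDiffOn_hamVec {b : Rn n × Rn n → ℝ} {O : Set (Rn n × Rn n)} (hO : IsOpen O)
    (hb : ContDiffOn ℝ ∞ b O) : ContDiffOn ℝ ∞ (hamVec b) O := by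
  have h : ContDiffOn ℝ ∞ (fderiv ℝ b) O := hb.fderiv_of_isOpen hO (by simp)
  refine ContDiffOn.prodMk ?_ ?_
  · exact contDiffOn_pi.2 fun j => h.clm_apply contDiffOn_const
  · exact contDiffOn_pi.2 fun j => (h.clm_apply contDiffOn_const).neg

lemma contDiffOn_hamD {b g : Rn n × Rn n → ℝ} {O : Set (Rn n × Rn n)} (hO : IsOpen O)
    (hb : ContDiffOn ℝ ∞ b O) (hg : ContDiffOn ℝ ∞ g O) : ContDiffOn ℝ ∞ (hamD b g) O := by
  have : hamD b g = fun ρ => fderiv ℝ g ρ (hamVec b ρ) := funext (hamD_eq b g)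
  rw [this]
  exact (hg.fderiv_of_isOpen hO (by simp)).clm_apply (contDiffOn_hamVec hO hb)

lemma contDiffOn_hamD_iterate {b g : Rn n × Rn n → ℝ} {O : Set (Rn n × Rn n)} (hO : IsOpen O)
    (hb : ContDiffOn ℝ ∞ b O) (hg : ContDiffOn ℝ ∞ g O) (j : ℕ) :
    ContDiffOn ℝ ∞ ((hamD b)^[j] g) O := by
  induction j with
  | zero => simpa using hg
  | succ j ih => rw [Function.iterate_succ_apply']; exact contDiffOn_hamD hO hb ih

/-- A real-linear map commuting with multiplication by `i` is complex linear. -/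
lemma exists_complexLinear {E : Type*} [NormedAddCommGroup E] [NormedSpace ℂ E] (l : E →L[ℝ] ℂ)
    (h : ∀ v, l (Complex.I • v) = Complex.I * l v) : ∃ m : E →L[ℂ] ℂ, ∀ v, m v = l v := by
  refine ⟨⟨⟨⟨l, l.map_add⟩, fun c v => ?_⟩, l.continuous⟩, fun v => rfl⟩
  have hc : c • v = c.re • v + c.im • (Complex.I • v) := by
    conv_lhs => rw [← Complex.re_add_im c]
    rw [add_smul, mul_smul]
    rfl
  simp only [RingHom.id_apply]
  rw [hc, map_add, map_smul, map_smul, h]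
  simp only [Complex.real_smul, smul_eq_mul]
  nth_rewrite 3 [← Complex.re_add_im c]
  ring

/-- The canonical transformation `(y, η) ↦ (X, f'_x(X, y))`. -/
noncomputable def canon (f : Cn n × Cn n → ℂ) (X : Cn n × Cn n → Cn n) (v : Cn n × Cn n) :
    Cn n × Cn n := (X v, gradX f (X v, v.1))

namespace ChartAt

variable {f : Cn n × Cn n → ℂ} {Φ₀ : Cn n → ℝ} {X : Cn n × Cn n → Cn n} {ρ : Rn n × Rn n}

lemma canon_eq (h : ChartAt f Φ₀ X ρ) :
    canon f X (toCC ρ) = (X (toCC ρ), wcov Φ₀ (X (toCC ρ))) := by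
  rw [h.covector]; rfl

lemma hasFDerivAt_canon (h : ChartAt f Φ₀ X ρ) : HasFDerivAt (canon f X)
    ((fderiv ℂ X (toCC ρ)).prod ((ContinuousLinearMap.pi fun j =>
      (fderiv ℂ (fderiv ℂ f) (X (toCC ρ), toC ρ.1)).flip (Pi.single j 1, 0)).comp
        ((fderiv ℂ X (toCC ρ)).prod (ContinuousLinearMap.fst ℂ (Cn n) (Cn n))))) (toCC ρ) := by
  have hX := h.smooth.differentiableAt.hasFDerivAt
  have h1 : HasFDerivAt (fun v : Cn n × Cn n => (X v, v.1))
      ((fderiv ℂ X (toCC ρ)).prod (ContinuousLinearMap.fst ℂ (Cn n) (Cn n))) (toCC ρ) :=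
    hX.prodMk hasFDerivAt_fst
  exact hX.prodMk ((hasFDerivAt_gradX (f := f) (z := (X (toCC ρ), (toCC ρ).1))
    h.holo.contDiffAt).comp (f := fun v : Cn n × Cn n => (X v, v.1)) (toCC ρ) h1)

/-- The complex Hamilton vector of `p = p̃ ∘ κ` is mapped by `dX` to `∂p̃/∂ξ`, because `κ` is
canonical. -/
lemma fderiv_hamVec (h : ChartAt f Φ₀ X ρ) {pt : Cn n × Cn n → ℂ} {p : Rn n × Rn n → ℂ}
    (hpt : DifferentiableAt ℝ pt (canon f X (toCC ρ)))
    (hholo : ∀ v, fderiv ℝ pt (canon f X (toCC ρ)) (Complex.I • v) =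
      Complex.I * fderiv ℝ pt (canon f X (toCC ρ)) v)
    (hp : p =ᶠ[𝓝 ρ] fun ρ => pt (canon f X (toCC ρ))) :
    fderiv ℂ X (toCC ρ) (fun j => fderiv ℝ p ρ (0, Pi.single j 1),
      fun j => -fderiv ℝ p ρ (Pi.single j 1, 0)) = xiGrad Φ₀ pt (X (toCC ρ)) := by
  obtain ⟨m, hm⟩ := exists_complexLinear _ hholo
  set D2 := fderiv ℂ (fderiv ℂ f) (X (toCC ρ), toC ρ.1) with hD2
  set dX := fderiv ℂ X (toCC ρ) with hdX
  have hsymm : ∀ v w, D2 v w = D2 w v := symm_hessian h.holo.contDiffAt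
  -- the differential of `p` is the restriction to real vectors of a complex linear form
  set ℓ : Cn n × Cn n →L[ℂ] ℂ := m.comp (dX.prod ((ContinuousLinearMap.pi fun j =>
      D2.flip (Pi.single j 1, 0)).comp (dX.prod (ContinuousLinearMap.fst ℂ (Cn n) (Cn n)))))
    with hℓ
  have hℓ_apply : ∀ V, ℓ V = m (dX V, fun j => D2 (dX V, V.1) (Pi.single j 1, 0)) := fun V => rfl
  have hdp : ∀ δ, fderiv ℝ p ρ δ = ℓ (toCC δ) := by
    intro δ
    rw [hp.fderiv_eq]
    have h1 := hpt.hasFDerivAt.comp ρ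
      ((h.hasFDerivAt_canon.restrictScalars ℝ).comp (f := toCCL n) ρ (toCCL n).hasFDerivAt)
    have h2 : fderiv ℝ (fun ρ => pt (canon f X (toCC ρ))) ρ = _ := h1.fderiv
    rw [h2, hℓ_apply, hm]
    rfl
  have htoC : ∀ j, toC (Pi.single j 1 : Rn n) = Pi.single j 1 := fun j => by
    ext i; by_cases hij : i = j
    · subst hij; simp [toC]
    · simp [toC, hij]
  have hη : ∀ j, fderiv ℝ p ρ (0, Pi.single j 1) = ℓ (0, Pi.single j 1) := fun j => by
    rw [hdp, toCC]; simp only [htoC, toC_zero]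
  have hy : ∀ j, fderiv ℝ p ρ (Pi.single j 1, 0) = ℓ (Pi.single j 1, 0) := fun j => by
    rw [hdp, toCC]; simp only [htoC, toC_zero]
  simp only [hη, hy]
  set V : Cn n × Cn n := (fun j => ℓ (0, Pi.single j 1), fun j => -ℓ (Pi.single j 1, 0)) with hV
  apply h.mixed_injective
  ext j
  have hsplit : ∀ a b w, D2 (a, b) w = D2 (a, 0) w + D2 (0, b) w := fun a b w => by
    rw [← add_apply, ← map_add]; simp
  -- the direction `(e_j, -f''_{yy} e_j)` keeps `X` fixed
  set s : Cn n := fun k => D2 (0, Pi.single j 1) (0, Pi.single k 1) with hs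
  have hdX0 : dX (Pi.single j 1, -s) = 0 := by
    apply h.mixed_injective
    rw [map_zero]
    ext k
    have := h.fderiv_eqn (Pi.single j 1, -s) k
    rw [hsplit] at this
    rw [mixed_apply]
    simpa [hs] using this
  have e1 : mixed f (X (toCC ρ), toC ρ.1) (dX V) j = ℓ (Pi.single j 1, -s) := by
    have h1 := h.fderiv_eqn V j
    rw [hsplit] at h1
    have h2 : D2 (0, V.1) (0, Pi.single j 1) = ℓ (0, s) := by
      have h3 := clm_apply_eq_sum ((D2.flip (0, Pi.single j 1)).comp
        (ContinuousLinearMap.inr ℂ (Cn n) (Cn n))) V.1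
      have h4 := clm_apply_eq_sum (ℓ.comp (ContinuousLinearMap.inr ℂ (Cn n) (Cn n))) s
      simp only [ContinuousLinearMap.comp_apply, ContinuousLinearMap.inr_apply,
        ContinuousLinearMap.flip_apply] at h3 h4
      rw [h3, h4]
      refine Finset.sum_congr rfl fun k _ => ?_
      rw [hs]
      simp only [hV, smul_eq_mul]
      rw [hsymm (0, Pi.single k 1)]
      ring
    have h5 : ℓ (Pi.single j 1, -s) = ℓ (Pi.single j 1, 0) - ℓ (0, s) := by
      rw [← map_sub]; simp
    rw [h5, ← h2, mixed_apply]
    simp only [hV, neg_neg] at h1 ⊢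
    rw [← h1]
    ring
  rw [e1, hℓ_apply, hdX0]
  have h6 := clm_apply_eq_sum (m.comp (ContinuousLinearMap.inr ℂ (Cn n) (Cn n)))
    (fun k => D2 (0, Pi.single j 1) (Pi.single k 1, 0))
  have h7 := clm_apply_eq_sum ((D2.flip (0, Pi.single j 1)).comp
    (ContinuousLinearMap.inl ℂ (Cn n) (Cn n))) (xiGrad Φ₀ pt (X (toCC ρ)))
  simp only [ContinuousLinearMap.comp_apply, ContinuousLinearMap.inr_apply,
    ContinuousLinearMap.inl_apply, ContinuousLinearMap.flip_apply] at h6 h7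
  rw [h6, mixed_apply, h7]
  refine Finset.sum_congr rfl fun k _ => ?_
  rw [hsymm, hm, h.canon_eq, xiGrad, smul_eq_mul, smul_eq_mul, mul_comm]

/-- The Hamilton flow of `Im p` moves `X` with velocity `-i ∂p̃/∂ξ`, up to a term that vanishes with
the differential of `Re p`. -/
lemma fderiv_hamVec_im (h : ChartAt f Φ₀ X ρ) {pt : Cn n × Cn n → ℂ} {p : Rn n × Rn n → ℂ}
    (hpt : DifferentiableAt ℝ pt (canon f X (toCC ρ)))
    (hholo : ∀ v, fderiv ℝ pt (canon f X (toCC ρ)) (Complex.I • v) =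
      Complex.I * fderiv ℝ pt (canon f X (toCC ρ)) v)
    (hp : p =ᶠ[𝓝 ρ] fun ρ => pt (canon f X (toCC ρ))) (hpd : DifferentiableAt ℝ p ρ) :
    fderiv ℂ X (toCC ρ) (toCC (hamVec (fun ρ => (p ρ).im) ρ)) +
        Complex.I • xiGrad Φ₀ pt (X (toCC ρ)) =
      Complex.I • fderiv ℂ X (toCC ρ) (toCC (hamVec (fun ρ => (p ρ).re) ρ)) := by
  rw [← h.fderiv_hamVec hpt hholo hp]
  have him : fderiv ℝ (fun ρ => (p ρ).im) ρ = Complex.imCLM.comp (fderiv ℝ p ρ) :=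
    (Complex.imCLM.hasFDerivAt.comp ρ hpd.hasFDerivAt).fderiv
  have hre : fderiv ℝ (fun ρ => (p ρ).re) ρ = Complex.reCLM.comp (fderiv ℝ p ρ) :=
    (Complex.reCLM.hasFDerivAt.comp ρ hpd.hasFDerivAt).fderiv
  rw [← map_smul, ← map_smul, ← map_add]
  congr 1
  simp only [toCC, hamVec, him, hre]
  ext j <;> apply Complex.ext <;> simp [toC]

end ChartAt

lemma norm_hamVec_le (b : Rn n × Rn n → ℝ) (ρ : Rn n × Rn n) :
    ‖hamVec b ρ‖ ≤ ‖fderiv ℝ b ρ‖ := by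
  refine max_le ?_ ?_ <;> refine (pi_norm_le_iff_of_nonneg (norm_nonneg _)).2 fun j => ?_
  · have := (fderiv ℝ b ρ).le_opNorm (0, Pi.single j 1)
    rwa [Prod.norm_mk, norm_zero, Pi.norm_single, norm_one, max_eq_right zero_le_one,
      mul_one] at this
  · have := (fderiv ℝ b ρ).le_opNorm (Pi.single j 1, 0)
    rw [Prod.norm_mk, norm_zero, Pi.norm_single, norm_one, max_eq_left zero_le_one,
      mul_one] at this
    simpa [hamVec] using this

lemma norm_toCC (ρ : Rn n × Rn n) : ‖toCC ρ‖ = ‖ρ‖ := by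
  simp [toCC, Prod.norm_def]

end FBI

namespace FBI

/-! ### Characteristics -/

section Flow

variable {E : Type*} [NormedAddCommGroup E] [NormedSpace ℝ E]

/-- The local flow of a `C¹` vector field, staying in a prescribed neighbourhood. -/
lemma exists_local_flow [CompleteSpace E] {v : E → E} {u : E} (hv : ContDiffAt ℝ 1 v u) {U : Set E}
    (hU : U ∈ 𝓝 u) : ∃ r > 0, ∃ α : E → ℝ → E, ∀ ρ ∈ Metric.ball u r, α ρ 0 = ρ ∧
      ∀ s, |s| < r → α ρ s ∈ U ∧ HasDerivAt (α ρ) (v (α ρ s)) s := by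
  obtain ⟨ε, hε, a, r, L, K, hr, hpl⟩ := IsPicardLindelof.of_contDiffAt_one hv
  obtain ⟨α, hα, hcont⟩ := (hpl 0).exists_forall_mem_closedBall_eq_hasDerivWithinAt_continuousOn
  have hα0 : α (u, 0) = u := (hα u (Metric.mem_closedBall_self r.2)).1
  have hc : ContinuousAt α (u, 0) := by
    refine hcont.continuousAt ?_
    exact prod_mem_nhds (Metric.closedBall_mem_nhds u hr) (Icc_mem_nhds (by linarith) (by linarith))
  have hU' : ∀ᶠ q in 𝓝 (u, (0 : ℝ)), α q ∈ U := hc.preimage_mem_nhds (by rwa [hα0])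
  obtain ⟨r', hr', hb⟩ := Metric.eventually_nhds_iff_ball.1 hU'
  have hr0 : (0 : ℝ) < r := hr
  refine ⟨min (min r ε) r', by positivity, fun ρ s => α (ρ, s), fun ρ hρ => ?_⟩
  rw [Metric.mem_ball, lt_min_iff, lt_min_iff] at hρ
  have h1 := hα ρ (Metric.mem_closedBall.2 hρ.1.1.le)
  refine ⟨h1.1, fun s hs => ?_⟩
  rw [lt_min_iff, lt_min_iff] at hs
  refine ⟨hb (ρ, s) ?_, ?_⟩
  · rw [← ball_prod_same]
    exact ⟨hρ.2, by simpa using hs.2⟩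
  · have hs' := abs_lt.1 hs.1.2
    exact (h1.2 s ⟨by linarith, by linarith⟩).hasDerivAt
      (Icc_mem_nhds (by linarith) (by linarith))

/-- A nonnegative `C²` function controls the square of its gradient. -/
lemma exists_sq_norm_fderiv_le {a : E → ℝ} {u : E} (ha : ContDiffAt ℝ 2 a u)
    (hpos : ∀ᶠ z in 𝓝 u, 0 ≤ a z) : ∃ C > 0, ∀ᶠ z in 𝓝 u, ‖fderiv ℝ a z‖ ^ 2 ≤ C * a z := by
  obtain ⟨M, hM, hH⟩ := eventually_hessian_le ha
  have hcont : ContinuousAt (fderiv ℝ a) u :=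
    (ha.fderiv_right (m := 1) (by norm_num)).continuousAt
  have hB : ∀ᶠ z in 𝓝 u, ‖fderiv ℝ a z‖ < ‖fderiv ℝ a u‖ + 1 :=
    hcont.norm.tendsto.eventually_lt_const (by linarith)
  obtain ⟨r, hr, hb⟩ := Metric.eventually_nhds_iff_ball.1
    ((hpos.and hH).and (hB.and (ha.eventually (by simp))))
  set B := ‖fderiv ℝ a u‖ + 1
  have hB0 : 0 < B := by positivity
  set M' := max M (B / r) with hM'
  have hM'0 : 0 < M' := lt_max_of_lt_left hM
  refine ⟨4 * M', by positivity, ?_⟩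
  filter_upwards [Metric.ball_mem_nhds u (half_pos hr)] with z hz
  have hzr : z ∈ Metric.ball u r := Metric.ball_subset_ball (by linarith) hz
  refine sq_norm_le_of_quadratic_nonneg (σ := r / 2) _ hM'0 ?_ fun v hv => ?_
  · refine (hb z hzr).2.1.le.trans ?_
    have : B / r ≤ M' := le_max_right _ _
    rw [div_le_iff₀ hr] at this
    linarith
  · have hzv : z + v ∈ Metric.ball u r := by
      rw [mem_ball_iff_norm] at hz ⊢
      have : z + v - u = (z - u) + v := by abel
      rw [this]
      exact (norm_add_le _ _).trans_lt (by linarith)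
    have hseg : segment ℝ z (z + v) ⊆ Metric.ball u r :=
      (convex_ball _ _).segment_subset hzr hzv
    have := le_of_hessian_upper_bound (f := a) (x := z) (y := z + v) (c := M * ‖v‖ * ‖v‖)
      (fun w hw => (hb w (hseg hw)).2.2) (fun w hw => by
        rw [add_sub_cancel_left]
        exact (le_abs_self _).trans ((hb w (hseg hw)).1.2 v v))
    rw [add_sub_cancel_left] at this
    have h0 := (hb _ hzv).1.1
    have h1 : M * ‖v‖ * ‖v‖ / 2 ≤ M' * ‖v‖ ^ 2 := by
      have : M ≤ M' := le_max_left _ _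
      nlinarith [sq_nonneg ‖v‖]
    linarith

end Flow

variable {n : ℕ}

/-- An approximate characteristic `s ↦ z(s)`, `0 ≤ s ≤ t`, of the Hamilton-Jacobi equation,
linearized at `Φ₀`, which ends at `x`. With `α = Re p̃` on `Λ_{Φ₀}`, its velocity is `-i ∂p̃/∂ξ` up to
`O(α^{1/2})`, and the action `F(t) = ∫₀ᵗ α(z(s)) ds` is bounded below by `c t ^ (k + 1)`. -/
structure IsCharacteristic (Φ₀ : Cn n → ℝ) (pt : Cn n × Cn n → ℂ) (C c : ℝ) (k : ℕ) (t : ℝ)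
    (x : Cn n) (z : ℝ → Cn n) (F : ℝ → ℝ) : Prop where
  endpoint : z t = x
  zero : F 0 = 0
  action : c * t ^ (k + 1) ≤ F t
  curve : ∀ s ∈ Icc 0 t, ∃ v, HasDerivAt z v s ∧ ‖v‖ ≤ C ∧
    ‖v + Complex.I • xiGrad Φ₀ pt (z s)‖ ^ 2 ≤ C * (pt (z s, wcov Φ₀ (z s))).re
  deriv : ∀ s ∈ Icc 0 t, HasDerivAt F (pt (z s, wcov Φ₀ (z s))).re s

lemma contDiffAt_canon {f : Cn n × Cn n → ℂ} {X : Cn n × Cn n → Cn n} {v : Cn n × Cn n}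
    (hX : AnalyticAt ℂ X v) (hf : AnalyticAt ℂ f (X v, v.1)) : ContDiffAt ℂ ∞ (canon f X) v := by
  refine hX.contDiffAt.prodMk ?_
  exact ContDiffAt.comp (g := gradX f) (f := fun v : Cn n × Cn n => (X v, v.1)) v
    (contDiffAt_gradX hf.contDiffAt) (hX.contDiffAt.prodMk contDiffAt_fst)

namespace Setting

variable {f : Cn n × Cn n → ℂ} {x₀ ξ₀ : Cn n} {y₀ η₀ : Rn n} {Φ₀ : Cn n → ℝ}

/-- Approximate characteristics are obtained by transporting the Hamilton flow of `Im p` to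
`x`-space. The action is bounded below because the `k`-th derivative of `Re p` along the flow is
`H_{Im p}^k Re p > 0`. The map from end points to starting points has a Lipschitz inverse. -/
lemma exists_characteristics (S : Setting f x₀ y₀ η₀ Φ₀) {pt : Cn n × Cn n → ℂ}
    (hξ₀ : ξ₀ = gradX f (x₀, toC y₀)) (P : Symbol Φ₀ pt x₀ ξ₀) {X : Cn n × Cn n → Cn n}
    (hX0 : X (toCC (y₀, η₀)) = x₀) (hX : ∀ᶠ ρ in 𝓝 (y₀, η₀), ChartAt f Φ₀ X ρ)
    (hsurj : ∀ U ∈ 𝓝 ((y₀, η₀) : Rn n × Rn n), ∀ᶠ x in 𝓝 x₀, ∃ ρ ∈ U, X (toCC ρ) = x)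
    {p : Rn n × Rn n → ℂ} (hp : ∀ᶠ ρ in 𝓝 (y₀, η₀), p ρ = pt (canon f X (toCC ρ)))
    (hpos : ∀ᶠ ρ in 𝓝 (y₀, η₀), 0 ≤ (p ρ).re) {k : ℕ}
    (hk : 0 < (hamD (fun ρ => (p ρ).im))^[k] (fun ρ => (p ρ).re) (y₀, η₀)) :
    ∃ r > 0, ∃ C > 0, ∃ c > 0, ∃ Z : ℝ → Cn n → ℝ → Cn n, ∃ F : ℝ → Cn n → ℝ → ℝ,
      ∀ t ∈ Icc 0 r, ∀ x ∈ Metric.ball x₀ r, IsCharacteristic Φ₀ pt C c k t x (Z t x) (F t x) ∧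
        ∀ x' ∈ Metric.ball x₀ r, ‖x - x'‖ ≤ C * ‖Z t x 0 - Z t x' 0‖ := by
  set ρ₀ : Rn n × Rn n := (y₀, η₀) with hρ₀
  have hX₀ : ChartAt f Φ₀ X ρ₀ := hX.self_of_nhds
  have hcanon0 : canon f X (toCC ρ₀) = (x₀, ξ₀) := by
    rw [hξ₀, ← hX0]; rfl
  have hcanont : Tendsto (fun ρ => canon f X (toCC ρ)) (𝓝 ρ₀) (𝓝 (x₀, ξ₀)) := by
    rw [← hcanon0]
    exact ContinuousAt.comp (g := canon f X) (f := toCCL n)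
      (contDiffAt_canon hX₀.smooth hX₀.holo).continuousAt (toCCL n).continuous.continuousAt
  -- a ball on which `p` is smooth and the chart is available
  obtain ⟨R, hR, hO⟩ := Metric.eventually_nhds_iff_ball.1
    ((hX.and hp.eventually_nhds).and ((hcanont.eventually P.smooth).and
      (hcanont.eventually P.holo)))
  set O := Metric.ball ρ₀ R with hOdef
  have hOo : IsOpen O := Metric.isOpen_ball
  have hρ₀O : ρ₀ ∈ O := Metric.mem_ball_self hR
  have hpO : ContDiffOn ℝ ∞ p O := by
    intro ρ hρ
    obtain ⟨⟨h1, h2⟩, h3, -⟩ := hO ρ hρ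
    refine ContDiffAt.contDiffWithinAt ?_
    refine ContDiffAt.congr_of_eventuallyEq ?_ h2
    exact ContDiffAt.comp (g := pt) (f := fun ρ => canon f X (toCC ρ)) ρ h3
      (ContDiffAt.comp (g := canon f X) (f := toCCL n) ρ
        ((contDiffAt_canon h1.smooth h1.holo).restrict_scalars ℝ) (toCCL n).contDiff.contDiffAt)
  set a : Rn n × Rn n → ℝ := fun ρ => (p ρ).re with ha
  set b : Rn n × Rn n → ℝ := fun ρ => (p ρ).im with hb
  have haO : ContDiffOn ℝ ∞ a O := Complex.reCLM.contDiff.comp_contDiffOn hpO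
  have hbO : ContDiffOn ℝ ∞ b O := Complex.imCLM.contDiff.comp_contDiffOn hpO
  have hHO : ContDiffOn ℝ ∞ (hamVec b) O := contDiffOn_hamVec hOo hbO
  have haj : ∀ j, ContDiffOn ℝ ∞ ((hamD b)^[j] a) O := contDiffOn_hamD_iterate hOo hbO haO
  have hOn : O ∈ 𝓝 ρ₀ := hOo.mem_nhds hρ₀O
  -- the constants
  obtain ⟨Ca, hCa, hCa'⟩ := exists_sq_norm_fderiv_le
    (((haO.contDiffAt hOn).of_le two_le_infty)) hpos
  obtain ⟨K, hK, rK, hrK, hanti⟩ := S.exists_chart_antilipschitz hX0 hX₀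
  set c := (hamD b)^[k] a ρ₀ / 2 with hc
  have hc0 : 0 < c := by positivity
  have hck : ∀ᶠ ρ in 𝓝 ρ₀, c < (hamD b)^[k] a ρ :=
    ((haj k).continuousOn.continuousAt hOn).tendsto.eventually_const_lt (half_lt_self hk)
  have hH1 : ContDiffAt ℝ 1 (hamVec b) ρ₀ := (hHO.contDiffAt hOn).of_le (by simp)
  obtain ⟨KH, UH, hUH, hlipH⟩ := hH1.exists_lipschitzOnWith
  have hXr : ContDiffAt ℝ 1 (fun ρ => X (toCC ρ)) ρ₀ :=
    ContDiffAt.comp (g := X) (f := toCCL n) ρ₀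
        ((hX₀.smooth.contDiffAt (n := 1)).restrict_scalars ℝ) (toCCL n).contDiff.contDiffAt
  obtain ⟨KX, UX, hUX, hlipX⟩ := hXr.exists_lipschitzOnWith
  set B := ‖fderiv ℂ X (toCC ρ₀)‖ + 1 with hB
  have hB0 : 0 < B := by positivity
  have hBd : ∀ᶠ ρ in 𝓝 ρ₀, ‖fderiv ℂ X (toCC ρ)‖ < B := by
    have h1 : ContinuousAt (fun ρ => fderiv ℂ X (toCC ρ)) ρ₀ :=
      ContinuousAt.comp (g := fderiv ℂ X) (f := toCCL n) hX₀.smooth.fderiv.continuousAt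
        (toCCL n).continuous.continuousAt
    exact h1.norm.tendsto.eventually_lt_const (by rw [hB]; linarith)
  set B' := ‖hamVec b ρ₀‖ + 1 with hB'
  have hB'0 : 0 < B' := by positivity
  have hBd' : ∀ᶠ ρ in 𝓝 ρ₀, ‖hamVec b ρ‖ < B' :=
    hH1.continuousAt.norm.tendsto.eventually_lt_const (by rw [hB']; linarith)
  have hgood : ∀ᶠ ρ in 𝓝 ρ₀, (ρ ∈ O ∧ ρ ∈ UH ∧ ρ ∈ UX ∧ ρ ∈ Metric.ball ρ₀ rK) ∧
      (0 ≤ a ρ ∧ ‖fderiv ℝ a ρ‖ ^ 2 ≤ Ca * a ρ ∧ c < (hamD b)^[k] a ρ) ∧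
      ‖fderiv ℂ X (toCC ρ)‖ < B ∧ ‖hamVec b ρ‖ < B' := by
    filter_upwards [hOn, hUH, hUX, Metric.ball_mem_nhds ρ₀ hrK, hpos, hCa', hck, hBd, hBd']
      with ρ h1 h2 h3 h4 h5 h6 h7 h8 h9
    exact ⟨⟨h1, h2, h3, h4⟩, ⟨h5, h6, h7⟩, h8, h9⟩
  obtain ⟨r, hr, α, hα⟩ := exists_local_flow hH1 hgood
  have hsurj' := hsurj _ (Metric.ball_mem_nhds ρ₀ hr)
  obtain ⟨r', hr', hball⟩ := Metric.eventually_nhds_iff_ball.1 hsurj'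
  choose! κ hκ hXκ using hball
  have hXderiv : ∀ ρ ∈ O, HasFDerivAt (fun ρ => X (toCC ρ))
      (((fderiv ℂ X (toCC ρ)).restrictScalars ℝ).comp (toCCL n)) ρ := fun ρ hρ =>
    ((hO ρ hρ).1.1.smooth.differentiableAt.hasFDerivAt.restrictScalars ℝ).comp
      (f := toCCL n) ρ (toCCL n).hasFDerivAt
  have hval : ∀ ρ ∈ O, (pt (X (toCC ρ), wcov Φ₀ (X (toCC ρ)))).re = a ρ := fun ρ hρ => by
    rw [← (hO ρ hρ).1.1.canon_eq, ha, ← (hO ρ hρ).1.2.self_of_nhds]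
  set T := min (r / 2) r' with hT
  have hT0 : 0 < T := by positivity
  set C := B * B' + B ^ 2 * Ca + KX * Real.exp (KH * T) * K + 1 with hC
  have hC0 : 0 < C := by positivity
  refine ⟨T, hT0, C, hC0, c / ((k + 1 : ℕ) ^ (k + 1) * 2 ^ (k + 1)), by positivity,
    fun t x s => X (toCC (α (κ x) (s - t))),
    fun t x s => ∫ u in (0 : ℝ)..s, a (α (κ x) (u - t)), fun t ht x hx => ?_⟩
  have hxκ : ∀ x ∈ Metric.ball x₀ T, κ x ∈ Metric.ball ρ₀ r ∧ X (toCC (κ x)) = x := fun x hx =>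
    have hx' := Metric.ball_subset_ball (min_le_right _ _) hx
    ⟨hκ x hx', hXκ x hx'⟩
  have htr : t < r := by
    have := ht.2.trans (min_le_left _ _)
    linarith
  have hst : ∀ s ∈ Icc 0 t, |s - t| < r := fun s hs =>
    abs_lt.2 ⟨by linarith [hs.1], by linarith [hs.2]⟩
  have hder : ∀ x ∈ Metric.ball x₀ T, ∀ s, |s - t| < r →
      HasDerivAt (fun s => α (κ x) (s - t)) (hamVec b (α (κ x) (s - t))) s := fun x hx s hs =>
    ((hα _ (hxκ x hx).1).2 _ hs).2.comp_sub_const s t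
  have hin := fun x hx s hs => ((hα _ (hxκ x hx).1).2 (s - t) hs).1
  have hend : ∀ x ∈ Metric.ball x₀ T, α (κ x) (t - t) = κ x := fun x hx => by
    rw [sub_self]; exact (hα _ (hxκ x hx).1).1
  set γ := fun s => α (κ x) (s - t) with hγ
  set J : Set ℝ := {s | |s - t| < r} with hJ
  have hJo : IsOpen J := isOpen_lt (by fun_prop) continuous_const
  have hIJ : Icc 0 t ⊆ J := fun s hs => hst s hs
  have haγ : ContinuousOn (fun s => a (γ s)) J := fun s hs =>
    (ContinuousAt.comp (g := a) (f := γ)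
      (haO.continuousOn.continuousAt (hOo.mem_nhds (hin x hx s hs).1.1))
      (hder x hx s hs).continuousAt).continuousWithinAt
  have hFd : ∀ s ∈ Icc 0 t, HasDerivAt (fun s => ∫ u in (0 : ℝ)..s, a (γ u)) (a (γ s)) s := by
    intro s hs
    refine intervalIntegral.integral_hasDerivAt_right ?_ ?_ ?_
    · refine (haγ.mono ?_).intervalIntegrable
      rw [uIcc_of_le hs.1]
      exact (Icc_subset_Icc_right hs.2).trans hIJ
    · exact haγ.stronglyMeasurableAtFilter hJo s (hIJ hs)
    · exact haγ.continuousAt (hJo.mem_nhds (hIJ hs))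
  refine ⟨⟨?_, by simp, ?_, fun s hs => ?_, fun s hs => ?_⟩, fun x' hx' => ?_⟩
  · simp only [hend x hx]; exact (hxκ x hx).2
  · -- lower bound of the action by finite differences
    -- `G 0` is the action, and `G (j + 1)` is the function `H_{Im p}^j Re p` along the flow
    set G : ℕ → ℝ → ℝ := fun j => Nat.casesOn j (fun s => ∫ u in (0 : ℝ)..s, a (γ u))
      (fun j s => (hamD b)^[j] a (γ s)) with hG
    refine le_of_iterated_deriv_lower_bound (m := k + 1) (c := c) (t := t) (Nat.succ_pos k) ht.1
      G ?_ ?_ ?_ ?_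
    · intro j _ s hs
      rcases j with _ | j
      · exact (hFd s hs).hasDerivWithinAt
      · have hsO := (hin x hx s (hst s hs)).1.1
        have h1 : DifferentiableAt ℝ ((hamD b)^[j] a) (γ s) :=
          ((haj j).contDiffAt (hOo.mem_nhds hsO)).differentiableAt (by simp)
        have h2 := h1.hasFDerivAt.comp_hasDerivAt s (hder x hx s (hst s hs))
        have h3 : G (j + 1 + 1) s = fderiv ℝ ((hamD b)^[j] a) (γ s) (hamVec b (γ s)) := by
          simp only [hG, Function.iterate_succ_apply', hamD_eq]
        rw [h3]
        exact h2.hasDerivWithinAt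
    · intro s hs
      exact (hin x hx s (hst s hs)).2.1.2.2.le
    · simp [hG]
    · refine monotoneOn_of_hasDerivWithinAt_nonneg (convex_Icc 0 t)
        (fun s hs => (hFd s hs).continuousAt.continuousWithinAt)
        (fun s hs => (hFd s (interior_subset hs)).hasDerivWithinAt) fun s hs => ?_
      exact (hin x hx s (hst s (interior_subset hs))).2.1.1
  · -- the velocity differs from `-i ∂p̃/∂ξ` by `O(|d Re p|)`, and `|d Re p|² = O(Re p)`
    obtain ⟨⟨hsO, -, -, -⟩, ⟨ha0, ha1, -⟩, hXB, hHB⟩ := hin x hx s (hst s hs)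
    have hd := (hXderiv _ hsO).comp_hasDerivAt s (hder x hx s (hst s hs))
    obtain ⟨⟨h1, h2⟩, h3, h4⟩ := hO _ hsO
    have hcan := h1.canon_eq
    have hkey := h1.fderiv_hamVec_im (h3.differentiableAt (by simp))
      (h4 (by rw [hcan]; rfl)) h2 ((hpO.contDiffAt (hOo.mem_nhds hsO)).differentiableAt (by simp))
    refine ⟨_, hd, ?_, ?_⟩
    · have e1 : ‖fderiv ℂ X (toCC (γ s)) (toCC (hamVec b (γ s)))‖ ≤ B * B' := by
        refine (ContinuousLinearMap.le_opNorm _ _).trans ?_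
        rw [norm_toCC]
        gcongr
      refine e1.trans ?_
      have : 0 ≤ B ^ 2 * Ca + KX * Real.exp (KH * T) * K := by positivity
      linarith
    · have e2 : ‖fderiv ℂ X (toCC (γ s)) (toCC (hamVec b (γ s))) +
          Complex.I • xiGrad Φ₀ pt (X (toCC (γ s)))‖ ≤ B * ‖fderiv ℝ a (γ s)‖ := by
        rw [hkey, norm_smul, Complex.norm_I, one_mul]
        refine (ContinuousLinearMap.le_opNorm _ _).trans ?_
        rw [norm_toCC]
        gcongr
        exact norm_hamVec_le _ _
      rw [hval _ hsO]
      calc _ ≤ (B * ‖fderiv ℝ a (γ s)‖) ^ 2 := by gcongr; exact e2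
        _ = B ^ 2 * ‖fderiv ℝ a (γ s)‖ ^ 2 := by ring
        _ ≤ B ^ 2 * (Ca * a (γ s)) := by gcongr
        _ = B ^ 2 * Ca * a (γ s) := by ring
        _ ≤ C * a (γ s) := by
          have : 0 ≤ B * B' + KX * Real.exp (KH * T) * K := by positivity
          have hle : B ^ 2 * Ca ≤ C := by linarith
          gcongr
  · rw [hval _ (hin x hx s (hst s hs)).1.1]
    exact hFd s hs
  · -- the backward flow is Lipschitz
    set γ' := fun s => α (κ x') (s - t) with hγ'
    have h0 : (0 : ℝ) ∈ Icc 0 t := ⟨le_rfl, ht.1⟩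
    have ht' : t ∈ Icc 0 t := ⟨ht.1, le_rfl⟩
    have hgr := dist_le_of_trajectories_ODE_of_mem (v := fun _ => hamVec b) (s := fun _ => UH)
      (K := KH) (f := γ) (g := γ') (a := 0) (b := t) (δ := dist (γ 0) (γ' 0))
      (fun _ _ => hlipH)
      (fun s hs => (hder x hx s (hst s hs)).continuousAt.continuousWithinAt)
      (fun s hs => (hder x hx s (hst s (Ico_subset_Icc_self hs))).hasDerivWithinAt)
      (fun s hs => (hin x hx s (hst s (Ico_subset_Icc_self hs))).1.2.1)
      (fun s hs => (hder x' hx' s (hst s hs)).continuousAt.continuousWithinAt)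
      (fun s hs => (hder x' hx' s (hst s (Ico_subset_Icc_self hs))).hasDerivWithinAt)
      (fun s hs => (hin x' hx' s (hst s (Ico_subset_Icc_self hs))).1.2.1) le_rfl t ht'
    have e1 : ‖γ 0 - γ' 0‖ ≤ K * ‖X (toCC (γ 0)) - X (toCC (γ' 0))‖ :=
      hanti _ (hin x hx 0 (hst 0 h0)).1.2.2.2 _ (hin x' hx' 0 (hst 0 h0)).1.2.2.2
    have e2 : dist (X (toCC (γ t))) (X (toCC (γ' t))) ≤ KX * dist (γ t) (γ' t) :=
      hlipX.dist_le_mul _ (hin x hx t (hst t ht')).1.2.2.1 _ (hin x' hx' t (hst t ht')).1.2.2.1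
    simp only [hγ, hγ', hend x hx, hend x' hx', (hxκ x hx).2, (hxκ x' hx').2] at e2
    simp only [hγ, hγ', hend x hx, hend x' hx', sub_zero, dist_eq_norm] at hgr e2 e1
    have e3 : Real.exp (KH * t) ≤ Real.exp (KH * T) := by
      gcongr
      exact ht.2
    set N := ‖X (toCC (α (κ x) (0 - t))) - X (toCC (α (κ x') (0 - t)))‖ with hN
    calc ‖x - x'‖ ≤ KX * ‖κ x - κ x'‖ := e2
      _ ≤ KX * (K * N * Real.exp (KH * T)) := by
        gcongr
        refine hgr.trans ?_
        gcongr
      _ = KX * Real.exp (KH * T) * K * N := by ring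
      _ ≤ C * N := by
        have : 0 ≤ B * B' + B ^ 2 * Ca := by positivity
        have hle : KX * Real.exp (KH * T) * K ≤ C := by linarith
        gcongr

end Setting

end FBI

namespace FBI

/-! ### Growth of the defect along characteristics -/

variable {n : ℕ}

/-- `d` is the defect `Φ₀ - Φ_s` of an approximate solution of the Hamilton-Jacobi equation: it
solves `∂ₛ d = Re p̃(z, (2/i) ∂(Φ₀ - d))` up to `O((√s + |z - y|) ^ N)`, its gradient is
`O(√s + |z - y|)`, its Hessian is bounded above, and it is nonnegative at `s = 0`. The square root
makes room for functions that are smooth in `√s`. -/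
structure IsDefect (Φ₀ : Cn n → ℝ) (pt : Cn n × Cn n → ℂ) (x₀ : Cn n) (r K : ℝ) (N : ℕ) (y : Cn n)
    (d : ℝ → Cn n → ℝ) : Prop where
  cont : ContinuousOn (fun q : ℝ × Cn n => d q.1 q.2) (Icc 0 r ×ˢ Metric.ball x₀ r)
  diff : ∀ s ∈ Ioo 0 r, ∀ z ∈ Metric.ball x₀ r,
    DifferentiableAt ℝ (fun q : ℝ × Cn n => d q.1 q.2) (s, z)
  eqn : ∀ s ∈ Ioo 0 r, ∀ z ∈ Metric.ball x₀ r,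
    |deriv (fun s => d s z) s - (pt (z, wcov Φ₀ z - wcov (d s) z)).re| ≤
      K * (√s + ‖z - y‖) ^ N
  grad : ∀ s ∈ Icc 0 r, ∀ z ∈ Metric.ball x₀ r, ‖fderiv ℝ (d s) z‖ ≤ K * (√s + ‖z - y‖)
  taylor : ∀ s ∈ Icc 0 r, ∀ z ∈ Metric.ball x₀ r, ∀ v, z + v ∈ Metric.ball x₀ r →
    d s (z + v) ≤ d s z + fderiv ℝ (d s) z v + K * ‖v‖ ^ 2
  init : ∀ z ∈ Metric.ball x₀ r, 0 ≤ d 0 z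

/-- The real part of the symbol near `Λ_{Φ₀}`: nonnegative on `Λ_{Φ₀}`, Lipschitz in the covector,
and with a second-order Taylor lower bound. -/
structure SymbolBounds (Φ₀ : Cn n → ℝ) (pt : Cn n × Cn n → ℂ) (x₀ : Cn n) (r L : ℝ) : Prop where
  nonneg : ∀ z ∈ Metric.ball x₀ r, 0 ≤ (pt (z, wcov Φ₀ z)).re
  lipschitz : ∀ z ∈ Metric.ball x₀ r, ∀ v, ‖v‖ ≤ r →
    (pt (z, wcov Φ₀ z)).re - L * ‖v‖ ≤ (pt (z, wcov Φ₀ z + v)).re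
  taylor : ∀ z ∈ Metric.ball x₀ r, ∀ v, ‖v‖ ≤ r →
    (pt (z, wcov Φ₀ z)).re + (∑ j, v j * xiGrad Φ₀ pt z j).re - L * ‖v‖ ^ 2 ≤
      (pt (z, wcov Φ₀ z + v)).re

lemma le_sqrt_self {t : ℝ} (h0 : 0 ≤ t) (h1 : t ≤ 1) : t ≤ √t :=
  Real.le_sqrt_of_sq_le (by nlinarith)

lemma continuousAt_wcov {Φ₀ : Cn n → ℝ} {x₀ : Cn n} (h : ContDiffAt ℝ 1 Φ₀ x₀) :
    ContinuousAt (wcov Φ₀) x₀ := by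
  have h1 : ContDiffAt ℝ 1 (fun x => (Φ₀ x : ℂ)) x₀ := Complex.ofRealCLM.contDiff.contDiffAt.comp x₀ h
  have h2 : ContinuousAt (fderiv ℝ fun x => (Φ₀ x : ℂ)) x₀ :=
    (h1.fderiv_right (m := 0) (by norm_num)).continuousAt
  refine continuousAt_pi.2 fun j => ?_
  simp only [wcov, cov, pd, del, Pi.smul_apply, smul_eq_mul]
  have h3 : ∀ v, ContinuousAt (fun x => fderiv ℝ (fun x => (Φ₀ x : ℂ)) x v) x₀ := fun v =>
    h2.clm_apply continuousAt_const
  exact ((((h3 _).sub (continuousAt_const.mul (h3 _))).div_const 2)).const_mul _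

/-- A smooth symbol whose real part is nonnegative on `Λ_{Φ₀}` satisfies the symbol bounds: since the
differential is complex linear there, its `ξ`-part is the linear form given by `xiGrad`. -/
lemma exists_symbolBounds {Φ₀ : Cn n → ℝ} {pt : Cn n × Cn n → ℂ} {x₀ ξ₀ : Cn n}
    (hΦ : ContDiffAt ℝ 1 Φ₀ x₀) (hξ : wcov Φ₀ x₀ = ξ₀) (P : Symbol Φ₀ pt x₀ ξ₀)
    (hpos : ∀ᶠ x in 𝓝 x₀, 0 ≤ (pt (x, wcov Φ₀ x)).re) :
    ∃ r > 0, ∃ L > 0, SymbolBounds Φ₀ pt x₀ r L := by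
  set g : Cn n × Cn n → ℝ := fun z => (pt z).re with hg
  have hgs : ∀ {z}, ContDiffAt ℝ ∞ pt z → ContDiffAt ℝ 2 g z := fun h =>
    (Complex.reCLM.contDiff.contDiffAt.comp _ h).of_le two_le_infty
  have hg0 : ContDiffAt ℝ 2 g (x₀, ξ₀) := hgs P.smooth.self_of_nhds
  obtain ⟨M, hM, hH⟩ := eventually_hessian_le hg0
  have hB : ∀ᶠ z in 𝓝 (x₀, ξ₀), ‖fderiv ℝ g z‖ < ‖fderiv ℝ g (x₀, ξ₀)‖ + 1 :=
    (hg0.fderiv_right (m := 1) (by norm_num)).continuousAt.norm.tendsto.eventually_lt_const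
      (by linarith)
  set B := ‖fderiv ℝ g (x₀, ξ₀)‖ + 1
  have hB0 : 0 < B := by positivity
  obtain ⟨R, hR, hb⟩ := Metric.eventually_nhds_iff_ball.1
    ((P.smooth.and P.holo).and (hH.and hB))
  have hω := (continuousAt_wcov hΦ).tendsto
  rw [hξ] at hω
  obtain ⟨r, hr, hb'⟩ := Metric.eventually_nhds_iff_ball.1
    (hpos.and (hω.eventually (Metric.ball_mem_nhds ξ₀ (half_pos hR))))
  refine ⟨min r (R / 3), by positivity, B + M, by positivity, ?_⟩
  have hmem : ∀ z ∈ Metric.ball x₀ (min r (R / 3)), ∀ v : Cn n, ‖v‖ ≤ min r (R / 3) →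
      (z, wcov Φ₀ z + v) ∈ Metric.ball (x₀, ξ₀) R := by
    intro z hz v hv
    rw [Metric.mem_ball, lt_min_iff] at hz
    have h1 : wcov Φ₀ z ∈ Metric.ball ξ₀ (R / 2) := (hb' z hz.1).2
    have h2 := hv.trans (min_le_right _ _)
    rw [← ball_prod_same]
    refine ⟨Metric.mem_ball.2 (by linarith [hz.2]), ?_⟩
    rw [mem_ball_iff_norm] at h1 ⊢
    have : wcov Φ₀ z + v - ξ₀ = (wcov Φ₀ z - ξ₀) + v := by abel
    rw [this]
    exact (norm_add_le _ _).trans_lt (by linarith)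
  have hmem0 : ∀ z ∈ Metric.ball x₀ (min r (R / 3)), (z, wcov Φ₀ z) ∈ Metric.ball (x₀, ξ₀) R := by
    intro z hz
    have := hmem z hz 0 (by rw [norm_zero]; positivity)
    rwa [add_zero] at this
  have hseg : ∀ z ∈ Metric.ball x₀ (min r (R / 3)), ∀ v : Cn n, ‖v‖ ≤ min r (R / 3) →
      segment ℝ (z, wcov Φ₀ z) (z, wcov Φ₀ z + v) ⊆ Metric.ball (x₀, ξ₀) R := fun z hz v hv =>
    (convex_ball _ _).segment_subset (hmem0 z hz) (hmem z hz v hv)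
  have hnorm : ∀ v : Cn n, ‖((0, v) : Cn n × Cn n)‖ = ‖v‖ := fun v => by
    rw [Prod.norm_mk, norm_zero, max_eq_right (norm_nonneg _)]
  refine ⟨fun z hz => (hb' z (Metric.ball_subset_ball (min_le_left _ _) hz)).1,
    fun z hz v hv => ?_, fun z hz v hv => ?_⟩
  · have := (convex_segment (z, wcov Φ₀ z) (z, wcov Φ₀ z + v)).norm_image_sub_le_of_norm_fderiv_le
      (f := g) (C := B) (𝕜 := ℝ)
      (fun w hw => (hgs (hb w (hseg z hz v hv hw)).1.1).differentiableAt (by norm_num))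
      (fun w hw => (hb w (hseg z hz v hv hw)).2.2.le)
      (left_mem_segment ℝ _ _) (right_mem_segment ℝ _ _)
    have e1 : ((z, wcov Φ₀ z + v) : Cn n × Cn n) - (z, wcov Φ₀ z) = (0, v) := by simp
    rw [e1, hnorm, Real.norm_eq_abs] at this
    have h2 := (abs_le.1 this).1
    have h3 : 0 ≤ M * ‖v‖ := by positivity
    simp only [hg] at h2
    linarith
  · have := le_of_hessian_lower_bound (f := g) (c := -(M * ‖v‖ * ‖v‖))
      (x := (z, wcov Φ₀ z)) (y := (z, wcov Φ₀ z + v))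
      (fun w hw => hgs (hb w (hseg z hz v hv hw)).1.1)
      (fun w hw => by
        have e1 : ((z, wcov Φ₀ z + v) : Cn n × Cn n) - (z, wcov Φ₀ z) = (0, v) := by simp
        rw [e1, ← hnorm v]
        exact (abs_le.1 ((hb w (hseg z hz v hv hw)).2.1 (0, v) (0, v))).1)
    have e1 : ((z, wcov Φ₀ z + v) : Cn n × Cn n) - (z, wcov Φ₀ z) = (0, v) := by simp
    rw [e1] at this
    obtain ⟨⟨hs, hh⟩, -⟩ := hb _ (hmem0 z hz)
    obtain ⟨m, hm⟩ := exists_complexLinear _ (hh rfl)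
    have e2 : fderiv ℝ g (z, wcov Φ₀ z) (0, v) = (∑ j, v j * xiGrad Φ₀ pt z j).re := by
      have h1 : fderiv ℝ g (z, wcov Φ₀ z) = Complex.reCLM.comp (fderiv ℝ pt (z, wcov Φ₀ z)) :=
        (Complex.reCLM.hasFDerivAt.comp _ (hs.differentiableAt (by simp)).hasFDerivAt).fderiv
      have h2 := clm_apply_eq_sum (m.comp (ContinuousLinearMap.inr ℂ (Cn n) (Cn n))) v
      simp only [ContinuousLinearMap.comp_apply, ContinuousLinearMap.inr_apply, hm] at h2
      rw [h1, ContinuousLinearMap.comp_apply, h2]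
      rfl
    rw [e2] at this
    simp only [hg] at this
    have h3 : 0 ≤ M * ‖v‖ ^ 2 := by positivity
    have h4 : 0 ≤ B * ‖v‖ ^ 2 := by positivity
    linarith

namespace IsDefect

variable {Φ₀ : Cn n → ℝ} {pt : Cn n × Cn n → ℂ} {x₀ y : Cn n} {r K : ℝ} {N : ℕ} {d : ℝ → Cn n → ℝ}

lemma hasFDerivAt (D : IsDefect Φ₀ pt x₀ r K N y d) {s : ℝ} (hs : s ∈ Ioo 0 r) {z : Cn n}
    (hz : z ∈ Metric.ball x₀ r) : ∃ A : ℝ × Cn n →L[ℝ] ℝ,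
      HasFDerivAt (fun q : ℝ × Cn n => d q.1 q.2) A (s, z) ∧
        A (1, 0) = deriv (fun s => d s z) s ∧
        A.comp (ContinuousLinearMap.inr ℝ ℝ (Cn n)) = fderiv ℝ (d s) z ∧
        DifferentiableAt ℝ (d s) z := by
  have h := (D.diff s hs z hz).hasFDerivAt
  have h1 : HasDerivAt (fun s => d s z) _ s :=
    h.comp_hasDerivAt (f := fun s => (s, z)) s ((hasDerivAt_id s).prodMk (hasDerivAt_const s z))
  have h2 : HasFDerivAt (d s) _ z :=
    h.comp (f := fun z => (s, z)) z (hasFDerivAt_prodMk_right s z)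
  exact ⟨_, h, h1.deriv.symm, h2.fderiv.symm, h2.differentiableAt⟩

lemma norm_wcov_le {g : Cn n → ℝ} {z : Cn n} (hg : DifferentiableAt ℝ g z) :
    ‖wcov g z‖ ≤ 2 * ‖fderiv ℝ g z‖ := by
  rw [wcov, cov, norm_smul, norm_div, Complex.norm_I, Complex.norm_ofNat, div_one]
  gcongr
  exact norm_pd_le hg

lemma mono (D : IsDefect Φ₀ pt x₀ r K N y d) {r' : ℝ} (hr : r' ≤ r) :
    IsDefect Φ₀ pt x₀ r' K N y d where
  cont := D.cont.mono (prod_mono (Icc_subset_Icc_right hr) (Metric.ball_subset_ball hr))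
  diff s hs z hz := D.diff s ⟨hs.1, hs.2.trans_le hr⟩ z (Metric.ball_subset_ball hr hz)
  eqn s hs z hz := D.eqn s ⟨hs.1, hs.2.trans_le hr⟩ z (Metric.ball_subset_ball hr hz)
  grad s hs z hz := D.grad s ⟨hs.1, hs.2.trans hr⟩ z (Metric.ball_subset_ball hr hz)
  taylor s hs z hz v hv := D.taylor s ⟨hs.1, hs.2.trans hr⟩ z (Metric.ball_subset_ball hr hz) v
    (Metric.ball_subset_ball hr hv)
  init z hz := D.init z (Metric.ball_subset_ball hr hz)

/-- Minimum principle: the defect is bounded below by the error terms. -/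
lemma exists_lower_bound {r₁ L : ℝ} (hr₁ : 0 < r₁) (hL : 0 < L)
    (B : SymbolBounds Φ₀ pt x₀ r₁ L) {r K : ℝ} (hr : 0 < r) (hK : 0 < K) (N : ℕ) :
    ∃ ρ > 0, ρ ≤ 1 ∧ ρ ≤ r ∧ ∃ C > 0, ∀ y ∈ Metric.ball x₀ ρ, ∀ d, IsDefect Φ₀ pt x₀ r K N y d →
      ∀ t ∈ Icc 0 ρ, ∀ x ∈ Metric.ball x₀ ρ, -(C * (√t + ‖x - y‖) ^ N) ≤ d t x := by
  -- the cone has slope `2 * L` because the covector of `d` is bounded by twice its gradient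
  set L' := 2 * L with hL'
  set R := min (min r r₁) 1 with hR
  have hR0 : 0 < R := by positivity
  -- on this scale the gradient of the defect is at most `r₁ / 2`
  set q := r₁ / (2 * K) with hq
  have hq0 : 0 < q := by positivity
  set ρ := min (R / (2 * (1 + L'))) (min ((q / (4 * (1 + L'))) ^ 2) (q / (8 * (1 + L')))) with hρ
  have hL'0 : 0 < L' := by positivity
  have hρ0 : 0 < ρ := by positivity
  have hρR : ρ * (1 + L') ≤ R / 2 := by
    have : ρ ≤ R / (2 * (1 + L')) := min_le_left _ _
    rw [le_div_iff₀ (by positivity)] at this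
    linarith
  have hρR' : ρ < R := by nlinarith
  have hRr : R ≤ r := (min_le_left _ _).trans (min_le_left _ _)
  have hRr₁ : R ≤ r₁ := (min_le_left _ _).trans (min_le_right _ _)
  have hR1 : R ≤ 1 := min_le_right _ _
  refine ⟨ρ, hρ0, hρR'.le.trans hR1, hρR'.le.trans hRr, K * (1 + L') ^ N, by positivity,
    fun y hy d D t ht x hx => ?_⟩
  rw [mem_ball_iff_norm] at hx hy
  set lam := √t + ‖x - y‖ with hlam
  have hlam0 : 0 ≤ lam := by positivity
  have ht1 : t ≤ 1 := ht.2.trans (hρR'.le.trans hR1)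
  have htsq : t ≤ √t := le_sqrt_self ht.1 ht1
  -- on the backward cone the error scale `√s + ‖z - y‖` is comparable with its value at `(t, x)`
  have hcone : ∀ s ∈ Icc 0 t, ∀ z, ‖z - x‖ ≤ L' * (t - s) →
      z ∈ Metric.ball x₀ R ∧ √s + ‖z - y‖ ≤ (1 + L') * lam := by
    intro s hs z hz
    have h1 : L' * (t - s) ≤ L' * t := by gcongr; linarith [hs.1]
    constructor
    · rw [mem_ball_iff_norm]
      have : z - x₀ = (z - x) + (x - x₀) := by abel
      rw [this]
      have h2 : L' * t ≤ L' * ρ := by gcongr; exact ht.2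
      refine (norm_add_le _ _).trans_lt ?_
      linarith
    · have : z - y = (z - x) + (x - y) := by abel
      rw [this]
      have h2 : √s ≤ √t := Real.sqrt_le_sqrt hs.2
      have h3 : L' * t ≤ L' * √t := by gcongr
      have h4 : 0 ≤ L' * ‖x - y‖ := by positivity
      have h5 := norm_add_le (z - x) (x - y)
      rw [hlam]
      linarith
  have hlamq : (1 + L') * lam ≤ q := by
    have h1 : √t ≤ q / (4 * (1 + L')) := by
      refine Real.sqrt_le_iff.2 ⟨by positivity, ht.2.trans ?_⟩
      exact (min_le_right _ _).trans (min_le_left _ _)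
    have h2 : ‖x - y‖ ≤ 2 * ρ := by
      have : x - y = (x - x₀) - (y - x₀) := by abel
      rw [this]
      exact (norm_sub_le _ _).trans (by linarith)
    have h3 : ρ ≤ q / (8 * (1 + L')) := (min_le_right _ _).trans (min_le_right _ _)
    have h4 : lam ≤ q / (2 * (1 + L')) := by
      have : q / (2 * (1 + L')) = q / (4 * (1 + L')) + 2 * (q / (8 * (1 + L'))) := by
        field_simp; ring
      rw [this, hlam]
      linarith
    rw [le_div_iff₀ (by positivity)] at h4
    nlinarith
  have := le_of_cone_inequality (d := d) (t := t) (L := L') (m := 0) (e := K * ((1 + L') * lam) ^ N)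
    (x := x) ht.1 hL'0.le ?_ ?_ ?_
  · have h1 : K * ((1 + L') * lam) ^ N * t ≤ K * ((1 + L') * lam) ^ N * 1 := by gcongr
    rw [mul_one, mul_pow, ← mul_assoc] at h1
    rw [mul_pow, ← mul_assoc] at this
    linarith
  · refine D.cont.mono ?_
    rintro ⟨s, z⟩ ⟨h0, h1, h2⟩
    have h3 := hcone s ⟨h0, h1⟩ z h2
    exact ⟨⟨h0, h1.trans (ht.2.trans (hρR'.le.trans hRr))⟩, Metric.ball_subset_ball hRr h3.1⟩
  · intro s hs z hz
    obtain ⟨hzR, hsz⟩ := hcone s ⟨hs.1.le, hs.2⟩ z hz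
    have hs' : s ∈ Ioo 0 r := ⟨hs.1, (hs.2.trans ht.2).trans_lt (hρR'.trans_le hRr)⟩
    have hzr : z ∈ Metric.ball x₀ r := Metric.ball_subset_ball hRr hzR
    obtain ⟨A, hA, hA1, hA2, hdz⟩ := D.hasFDerivAt hs' hzr
    refine ⟨A, hA, ?_⟩
    rw [hA1, hA2]
    have h1 := (abs_le.1 (D.eqn s hs' z hzr)).1
    have h2 := D.grad s (Ioo_subset_Icc_self hs') z hzr
    have h3 : K * (√s + ‖z - y‖) ≤ r₁ / 2 := by
      have : K * (√s + ‖z - y‖) ≤ K * q := by gcongr; exact hsz.trans hlamq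
      rw [hq] at this
      refine this.trans (le_of_eq ?_)
      field_simp
    have hw := norm_wcov_le hdz
    have h4 := B.lipschitz z (Metric.ball_subset_ball hRr₁ hzR) (-wcov (d s) z) (by
      rw [norm_neg]; linarith)
    rw [← sub_eq_add_neg, norm_neg] at h4
    have h5 := B.nonneg z (Metric.ball_subset_ball hRr₁ hzR)
    have h6 : K * (√s + ‖z - y‖) ^ N ≤ K * ((1 + L') * lam) ^ N := by gcongr
    have h7 : L * ‖wcov (d s) z‖ ≤ L * (2 * ‖fderiv ℝ (d s) z‖) := by gcongr
    rw [hL']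
    linarith
  · intro z hz
    refine D.init z (Metric.ball_subset_ball hRr (hcone 0 ⟨le_rfl, ht.1⟩ z (by simpa using hz)).1)

/-- Since the defect is almost nonnegative, it controls the square of its gradient. -/
lemma exists_sq_norm_grad_le {r₁ L : ℝ} (hr₁ : 0 < r₁) (hL : 0 < L)
    (B : SymbolBounds Φ₀ pt x₀ r₁ L) {r K : ℝ} (hr : 0 < r) (hK : 0 < K) (N : ℕ) :
    ∃ ρ > 0, ρ ≤ 1 ∧ ρ ≤ r ∧ ∃ C > 0, ∀ y ∈ Metric.ball x₀ ρ, ∀ d, IsDefect Φ₀ pt x₀ r K N y d →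
      ∀ t ∈ Icc 0 ρ, ∀ x ∈ Metric.ball x₀ ρ,
        ‖fderiv ℝ (d t) x‖ ^ 2 ≤ 4 * K * (d t x + C * (√t + ‖x - y‖) ^ N) := by
  obtain ⟨ρ, hρ, hρ1, hρr, C, hC, h⟩ := exists_lower_bound hr₁ hL B hr hK N
  set ρ' := min (ρ / 5) ((ρ / 5) ^ 2) with hρ'
  have hρ'0 : 0 < ρ' := by positivity
  have hρ'5 : ρ' ≤ ρ / 5 := min_le_left _ _
  refine ⟨ρ', hρ'0, by linarith, by linarith, C * 2 ^ N, by positivity,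
    fun y hy d D t ht x hx => ?_⟩
  set lam := √t + ‖x - y‖ with hlam
  have hlam0 : 0 ≤ lam := by positivity
  have hx' := hx
  have hy' := hy
  rw [mem_ball_iff_norm] at hx hy
  have hxy : ‖x - y‖ ≤ 2 * ρ' := by
    have : x - y = (x - x₀) - (y - x₀) := by abel
    rw [this]
    exact (norm_sub_le _ _).trans (by linarith)
  have hlamρ : lam ≤ 3 * (ρ / 5) := by
    have h1 : √t ≤ ρ / 5 := Real.sqrt_le_iff.2 ⟨by positivity, ht.2.trans (min_le_right _ _)⟩
    rw [hlam]; linarith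
  have hxr : x ∈ Metric.ball x₀ r := Metric.ball_subset_ball (by linarith) hx'
  have htr : t ∈ Icc 0 r := ⟨ht.1, ht.2.trans (by linarith)⟩
  -- the lower bound at `x + v`, `‖v‖ ≤ lam`, and the Taylor upper bound of `d` at `x`
  refine sq_norm_le_of_quadratic_nonneg (σ := lam) _ hK ?_ fun v hv => ?_
  · have := D.grad t htr x hxr
    have : 0 ≤ K * lam := by positivity
    linarith
  · have hxv : x + v ∈ Metric.ball x₀ ρ := by
      rw [mem_ball_iff_norm]
      have : x + v - x₀ = (x - x₀) + v := by abel
      rw [this]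
      exact (norm_add_le _ _).trans_lt (by linarith)
    have h1 := h y (Metric.ball_subset_ball (by linarith) hy') d D t
      ⟨ht.1, ht.2.trans (by linarith)⟩ (x + v) hxv
    have h2 := D.taylor t htr x hxr v (Metric.ball_subset_ball hρr hxv)
    have h3 : √t + ‖x + v - y‖ ≤ 2 * lam := by
      have : x + v - y = (x - y) + v := by abel
      rw [this]
      have := norm_add_le (x - y) v
      linarith
    have h4 : C * (√t + ‖x + v - y‖) ^ N ≤ C * 2 ^ N * lam ^ N := by
      rw [mul_assoc, ← mul_pow]; gcongr
    linarith

set_option maxHeartbeats 1000000 in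
/-- The main comparison estimate: along a characteristic ending at `(t, x)` the defect grows at
least like the action `∫ Re p̃`, up to the error terms. -/
theorem exists_action_lower_bound {r₁ L : ℝ} (hr₁ : 0 < r₁) (hL : 0 < L)
    (B : SymbolBounds Φ₀ pt x₀ r₁ L) {r₂ C₂ c₂ : ℝ} {k : ℕ} (hr₂ : 0 < r₂) (hC₂ : 0 < C₂)
    (hc₂ : 0 < c₂) {Z : ℝ → Cn n → ℝ → Cn n} {F : ℝ → Cn n → ℝ → ℝ}
    (hZ : ∀ t ∈ Icc 0 r₂, ∀ x ∈ Metric.ball x₀ r₂, IsCharacteristic Φ₀ pt C₂ c₂ k t x (Z t x) (F t x))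
    {r K : ℝ} (hr : 0 < r) (hK : 0 < K) (N : ℕ) :
    ∃ ρ > 0, ∃ c > 0, ∃ C > 0, ∀ y ∈ Metric.ball x₀ ρ, ∀ d, IsDefect Φ₀ pt x₀ r K N y d →
      ∀ t ∈ Icc 0 ρ, ∀ x ∈ Metric.ball x₀ ρ, ‖Z t x 0 - x‖ ≤ C * t ∧ Z t x 0 ∈ Metric.ball x₀ r ∧
        c * (t ^ (k + 1) + d 0 (Z t x 0)) ≤ d t x + C * (√t + ‖x - y‖) ^ N := by
  obtain ⟨ρ, hρ, hρ1, hρr, C₁, hC₁, hgrad⟩ := exists_sq_norm_grad_le hr₁ hL B hr hK N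
  set q := r₁ / (2 * K) with hq
  have hq0 : 0 < q := by positivity
  set R := min (min ρ r₁) r₂ with hR
  have hR0 : 0 < R := by positivity
  set ρ' := min (R / (2 * (1 + C₂))) (min ((q / (4 * (1 + C₂))) ^ 2) (q / (8 * (1 + C₂)))) with hρ'
  have hρ'0 : 0 < ρ' := by positivity
  have hρR : ρ' * (1 + C₂) ≤ R / 2 := by
    have : ρ' ≤ R / (2 * (1 + C₂)) := min_le_left _ _
    rw [le_div_iff₀ (by positivity)] at this
    linarith
  have hρR' : ρ' < R := by nlinarith
  have hRρ : R ≤ ρ := (min_le_left _ _).trans (min_le_left _ _)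
  have hRr₁ : R ≤ r₁ := (min_le_left _ _).trans (min_le_right _ _)
  have hRr₂ : R ≤ r₂ := min_le_right _ _
  -- the rate in Grönwall's inequality: the coefficient of `‖∇d‖²` times that of its bound by `d`
  set A := (4 * L + C₂ / 2) * (4 * K) + 1 with hA
  have hA0 : 0 < A := by positivity
  set E := (C₁ + K) * (1 + C₂) ^ N with hE
  have hE0 : 0 < E := by positivity
  refine ⟨ρ', hρ'0, Real.exp (-A) * min 1 (c₂ / 2), by positivity, E + C₂, by positivity,
    fun y hy d D t ht x hx => ?_⟩
  have hy' := hy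
  have hch := hZ t ⟨ht.1, ht.2.trans (hρR'.le.trans hRr₂)⟩ x
    (Metric.ball_subset_ball (hρR'.le.trans hRr₂) hx)
  rw [mem_ball_iff_norm] at hx hy
  set z := Z t x with hz
  set lam := √t + ‖x - y‖ with hlam
  have hlam0 : 0 ≤ lam := by positivity
  have ht1 : t ≤ 1 := ht.2.trans (hρR'.le.trans (hRρ.trans hρ1))
  have htsq : t ≤ √t := le_sqrt_self ht.1 ht1
  choose! V hV hVC hVπ using hch.curve
  have hzx : ∀ s ∈ Icc 0 t, ‖z s - x‖ ≤ C₂ * t := by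
    intro s hs
    have := (convex_Icc 0 t).norm_image_sub_le_of_norm_hasDerivWithin_le (f := z) (f' := V)
      (C := C₂) (fun s hs => (hV s hs).hasDerivWithinAt) (fun s hs => hVC s hs)
      (right_mem_Icc.2 ht.1) hs
    rw [hch.endpoint] at this
    refine this.trans ?_
    gcongr
    rw [Real.norm_eq_abs, abs_sub_comm, abs_of_nonneg (by linarith [hs.2])]
    linarith [hs.1]
  have hcurve : ∀ s ∈ Icc 0 t, z s ∈ Metric.ball x₀ R ∧ √s + ‖z s - y‖ ≤ (1 + C₂) * lam := by
    intro s hs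
    have h1 := hzx s hs
    constructor
    · rw [mem_ball_iff_norm]
      have : z s - x₀ = (z s - x) + (x - x₀) := by abel
      rw [this]
      have h2 : C₂ * t ≤ C₂ * ρ' := by gcongr; exact ht.2
      refine (norm_add_le _ _).trans_lt ?_
      linarith
    · have : z s - y = (z s - x) + (x - y) := by abel
      rw [this]
      have h2 : √s ≤ √t := Real.sqrt_le_sqrt hs.2
      have h3 : C₂ * t ≤ C₂ * √t := by gcongr
      have h4 : 0 ≤ C₂ * ‖x - y‖ := by positivity
      have h5 := norm_add_le (z s - x) (x - y)
      rw [hlam]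
      linarith
  have hlamq : (1 + C₂) * lam ≤ q := by
    have h1 : √t ≤ q / (4 * (1 + C₂)) := by
      refine Real.sqrt_le_iff.2 ⟨by positivity, ht.2.trans ?_⟩
      exact (min_le_right _ _).trans (min_le_left _ _)
    have h2 : ‖x - y‖ ≤ 2 * ρ' := by
      have : x - y = (x - x₀) - (y - x₀) := by abel
      rw [this]
      exact (norm_sub_le _ _).trans (by linarith)
    have h3 : ρ' ≤ q / (8 * (1 + C₂)) := (min_le_right _ _).trans (min_le_right _ _)
    have h4 : lam ≤ q / (2 * (1 + C₂)) := by
      have : q / (2 * (1 + C₂)) = q / (4 * (1 + C₂)) + 2 * (q / (8 * (1 + C₂))) := by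
        field_simp; ring
      rw [this, hlam]
      linarith
    rw [le_div_iff₀ (by positivity)] at h4
    nlinarith
  set Λ := ((1 + C₂) * lam) ^ N with hΛ
  have hΛ0 : 0 ≤ Λ := by positivity
  have h0t : (0 : ℝ) ∈ Icc 0 t := ⟨le_rfl, ht.1⟩
  have hball : ∀ s ∈ Icc 0 t, z s ∈ Metric.ball x₀ r := fun s hs =>
    Metric.ball_subset_ball (hRρ.trans hρr) (hcurve s hs).1
  refine ⟨(hzx 0 h0t).trans (mul_le_mul_of_nonneg_right (by linarith) ht.1), hball 0 h0t, ?_⟩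
  set α : ℝ → ℝ := fun s => (pt (z s, wcov Φ₀ (z s))).re with hα
  have hα0 : ∀ s ∈ Icc 0 t, 0 ≤ α s := fun s hs =>
    B.nonneg _ (Metric.ball_subset_ball hRr₁ (hcurve s hs).1)
  set u : ℝ → ℝ := fun s => d s (z s) with hu
  -- the differential inequality `u' ≥ α / 2 - A (u + error)` along the characteristic
  have hder : ∀ s ∈ Ioo 0 t, ∃ u', HasDerivAt u u' s ∧
      α s / 2 - A * (u s + (C₁ + K) * Λ) ≤ u' := by
    intro s hs
    have hsI := Ioo_subset_Icc_self hs
    have hsr : s ∈ Ioo 0 r := ⟨hs.1, hs.2.trans_le (ht.2.trans (hρR'.le.trans (hRρ.trans hρr)))⟩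
    obtain ⟨hzR, hsz⟩ := hcurve s hsI
    obtain ⟨G, hG, hG1, hG2, hdz⟩ := D.hasFDerivAt hsr (hball s hsI)
    have hud : HasDerivAt u _ s := hG.comp_hasDerivAt (f := fun s => (s, z s)) s
      ((hasDerivAt_id s).prodMk (hV s hsI))
    refine ⟨_, hud, ?_⟩
    have e1 : G (1, V s) = G (1, 0) + fderiv ℝ (d s) (z s) (V s) := by
      rw [← hG2, ContinuousLinearMap.comp_apply, ContinuousLinearMap.inr_apply, ← map_add]
      simp
    rw [e1, hG1]
    set l := fderiv ℝ (d s) (z s) with hl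
    have h1 := (abs_le.1 (D.eqn s hsr (z s) (hball s hsI))).1
    have h2 := D.grad s (Ioo_subset_Icc_self hsr) (z s) (hball s hsI)
    have h3 : K * (√s + ‖z s - y‖) ≤ r₁ / 2 := by
      have : K * (√s + ‖z s - y‖) ≤ K * q := by gcongr; exact hsz.trans hlamq
      rw [hq] at this
      refine this.trans (le_of_eq ?_)
      field_simp
    have hw := norm_wcov_le hdz
    have h4 := B.taylor (z s) (Metric.ball_subset_ball hRr₁ hzR) (-wcov (d s) (z s)) (by
      rw [norm_neg]; linarith)
    rw [← sub_eq_add_neg, norm_neg] at h4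
    -- the linear term is the derivative of `d` in the direction `i ∂p̃/∂ξ`
    have h5 : (∑ j, (-wcov (d s) (z s)) j * xiGrad Φ₀ pt (z s) j).re =
        l (Complex.I • xiGrad Φ₀ pt (z s)) := by
      rw [hl, fderiv_eq_re_pd hdz]
      have : 2 * (∑ j, (Complex.I • xiGrad Φ₀ pt (z s)) j *
          pd (fun x => (d s x : ℂ)) (z s) j).re = (2 * ∑ j, (Complex.I • xiGrad Φ₀ pt (z s)) j *
          pd (fun x => (d s x : ℂ)) (z s) j).re := by simp
      rw [this, Finset.mul_sum]
      congr 1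
      refine Finset.sum_congr rfl fun j _ => ?_
      simp only [wcov, cov, Pi.neg_apply, Pi.smul_apply, smul_eq_mul, Complex.div_I]
      ring
    rw [h5] at h4
    have h6 : K * (√s + ‖z s - y‖) ^ N ≤ K * Λ := by rw [hΛ]; gcongr
    have h7 : L * ‖wcov (d s) (z s)‖ ^ 2 ≤ L * (2 * ‖l‖) ^ 2 := by gcongr
    -- the velocity error is absorbed by Young's inequality, at the price of half of `α`
    have h8 : -(α s / 2 + C₂ / 2 * ‖l‖ ^ 2) ≤ l (V s + Complex.I • xiGrad Φ₀ pt (z s)) := by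
      set ζ := V s + Complex.I • xiGrad Φ₀ pt (z s) with hζ
      have g1 := (abs_le.1 (l.le_opNorm ζ)).1
      have g2 : ‖ζ‖ ^ 2 ≤ C₂ * α s := hVπ s hsI
      have g3 : ‖l‖ * ‖ζ‖ ≤ C₂ / 2 * ‖l‖ ^ 2 + ‖ζ‖ ^ 2 / (2 * C₂) := by
        have g4 : 0 ≤ (C₂ * ‖l‖ - ‖ζ‖) ^ 2 / (2 * C₂) := by positivity
        have g5 : (C₂ * ‖l‖ - ‖ζ‖) ^ 2 / (2 * C₂) =
            C₂ / 2 * ‖l‖ ^ 2 + ‖ζ‖ ^ 2 / (2 * C₂) - ‖l‖ * ‖ζ‖ := by field_simp; ring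
        linarith
      have g4 : ‖ζ‖ ^ 2 / (2 * C₂) ≤ α s / 2 := by
        rw [div_le_div_iff₀ (by positivity) two_pos]
        linarith
      linarith
    rw [map_add] at h8
    have h9 : ‖l‖ ^ 2 ≤ 4 * K * (u s + C₁ * Λ) := by
      have g1 := hgrad y (Metric.ball_subset_ball (hρR'.le.trans hRρ) hy') d D s
        ⟨hs.1.le, hs.2.le.trans (ht.2.trans (hρR'.le.trans hRρ))⟩ (z s)
        (Metric.ball_subset_ball hRρ hzR)
      refine g1.trans ?_
      have : C₁ * (√s + ‖z s - y‖) ^ N ≤ C₁ * Λ := by rw [hΛ]; gcongr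
      gcongr
    have h10 : (4 * L + C₂ / 2) * ‖l‖ ^ 2 ≤ (A - 1) * (u s + C₁ * Λ) := by
      have : (A - 1) * (u s + C₁ * Λ) = (4 * L + C₂ / 2) * (4 * K * (u s + C₁ * Λ)) := by
        rw [hA]; ring
      rw [this]
      gcongr
    have h11 : 0 ≤ u s + C₁ * Λ := by
      have : 0 ≤ 4 * K * (u s + C₁ * Λ) := (sq_nonneg _).trans h9
      exact nonneg_of_mul_nonneg_right this (by positivity)
    have h12 : 0 ≤ (A - 1) * (K * Λ) := by
      have : 0 ≤ A - 1 := by rw [hA]; simp; positivity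
      positivity
    have e2 : A * (u s + (C₁ + K) * Λ) =
        (A - 1) * (u s + C₁ * Λ) + (u s + C₁ * Λ) + (A - 1) * (K * Λ) + K * Λ := by ring
    have e3 : L * (2 * ‖l‖) ^ 2 + C₂ / 2 * ‖l‖ ^ 2 = (4 * L + C₂ / 2) * ‖l‖ ^ 2 := by ring
    have e4 : (pt (z s, wcov Φ₀ (z s))).re = α s := rfl
    linarith
  have hucont : ContinuousOn u (Icc 0 t) := by
    have h1 : ContinuousOn (fun s => (s, z s)) (Icc 0 t) :=
      continuousOn_id.prodMk fun s hs => (hV s hs).continuousAt.continuousWithinAt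
    exact D.cont.comp h1 fun s hs =>
      ⟨⟨hs.1, hs.2.trans (ht.2.trans (hρR'.le.trans (hRρ.trans hρr)))⟩, hball s hs⟩
  choose! u' hu' hu'le using hder
  -- Grönwall's inequality in integrated form: `F / 2` is subtracted as the action accumulated so far
  have hmono : MonotoneOn (fun s => Real.exp (A * s) * (u s + (C₁ + K) * Λ) - F t x s / 2)
      (Icc 0 t) := by
    refine monotoneOn_of_hasDerivWithinAt_nonneg (convex_Icc 0 t)
      (f' := fun s => Real.exp (A * s) * (u' s + A * (u s + (C₁ + K) * Λ)) - α s / 2) ?_ ?_ ?_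
    · refine ((by fun_prop : Continuous fun s => Real.exp (A * s)).continuousOn.mul
        (hucont.add continuousOn_const)).sub (ContinuousOn.div_const ?_ 2)
      exact fun s hs => (hch.deriv s hs).continuousAt.continuousWithinAt
    · intro s hs
      rw [interior_Icc] at hs ⊢
      have h1 : HasDerivAt (fun s => Real.exp (A * s)) (Real.exp (A * s) * A) s := by
        simpa using ((hasDerivAt_id s).const_mul A).exp
      have h2 := (h1.mul ((hu' s hs).add_const ((C₁ + K) * Λ))).sub
        ((hch.deriv s (Ioo_subset_Icc_self hs)).div_const 2)
      refine HasDerivAt.hasDerivWithinAt (h2.congr_deriv ?_)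
      simp only [hα]
      ring
    · intro s hs
      rw [interior_Icc] at hs
      have h1 := hu'le s hs
      have h2 : α s / 2 ≤ u' s + A * (u s + (C₁ + K) * Λ) := by linarith
      have h3 : 1 ≤ Real.exp (A * s) := Real.one_le_exp (mul_nonneg hA0.le hs.1.le)
      have h4 := hα0 s (Ioo_subset_Icc_self hs)
      have h5 : 1 * (α s / 2) ≤ Real.exp (A * s) * (u' s + A * (u s + (C₁ + K) * Λ)) := by
        gcongr
      linarith
  have hfin := hmono h0t (right_mem_Icc.2 ht.1) ht.1
  simp only [mul_zero, Real.exp_zero, one_mul, hch.zero, zero_div, sub_zero] at hfin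
  have hut : u t = d t x := by simp only [hu]; rw [hch.endpoint]
  have hd0 : 0 ≤ d 0 (z 0) := D.init _ (hball 0 h0t)
  have hu0 : u 0 = d 0 (z 0) := rfl
  rw [hut, hu0] at hfin
  have hact := hch.action
  set W := d t x + (C₁ + K) * Λ with hW
  have hCΛ : 0 ≤ (C₁ + K) * Λ := by positivity
  have hsum : min 1 (c₂ / 2) * (t ^ (k + 1) + d 0 (z 0)) ≤ Real.exp (A * t) * W := by
    have ht0 : 0 ≤ t ^ (k + 1) := pow_nonneg ht.1 _
    have h1 : min 1 (c₂ / 2) * t ^ (k + 1) ≤ c₂ / 2 * t ^ (k + 1) := by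
      gcongr; exact min_le_right _ _
    have h2 : min 1 (c₂ / 2) * d 0 (z 0) ≤ 1 * d 0 (z 0) := by gcongr; exact min_le_left _ _
    linarith
  have hmin0 : 0 ≤ min 1 (c₂ / 2) * (t ^ (k + 1) + d 0 (z 0)) := by
    have ht0 : 0 ≤ t ^ (k + 1) := pow_nonneg ht.1 _
    positivity
  have hW0 : 0 ≤ W := nonneg_of_mul_nonneg_right (hmin0.trans hsum) (Real.exp_pos _)
  have hexp : Real.exp (A * t) ≤ Real.exp A := by
    gcongr
    nlinarith
  have hfin2 : Real.exp (-A) * (min 1 (c₂ / 2) * (t ^ (k + 1) + d 0 (z 0))) ≤ W := by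
    calc _ ≤ Real.exp (-A) * (Real.exp A * W) := by
          exact mul_le_mul_of_nonneg_left
            (hsum.trans (mul_le_mul_of_nonneg_right hexp hW0)) (Real.exp_pos _).le
      _ = W := by rw [← mul_assoc, ← Real.exp_add]; simp
  rw [mul_assoc]
  refine hfin2.trans ?_
  rw [hW, hΛ, mul_pow, ← mul_assoc, hE]
  have : 0 ≤ C₂ * lam ^ N := by positivity
  linarith

end IsDefect

end FBI

namespace FBI

/-! ### Smoothness up to the boundary and the standing hypotheses -/

variable {n : ℕ}

section SmoothNear

variable {E F : Type*} [NormedAddCommGroup E] [NormedSpace ℝ E]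
  [NormedAddCommGroup F] [NormedSpace ℝ F]

lemma SmoothNear.eventually_contDiffAt {g : E → F} {a : E} (h : SmoothNear g univ a) :
    ∀ᶠ z in 𝓝 a, ContDiffAt ℝ ∞ g z := by
  obtain ⟨U, hU, hg⟩ := h
  rw [nhdsWithin_univ] at hU
  filter_upwards [eventually_mem_nhds_iff.2 hU] with z hz
  exact hg.contDiffAt hz

/-- The substitution `t = τ²` turns a function smooth for `t ≥ 0` into one that is smooth on a full
neighbourhood. -/
lemma SmoothNear.eventually_contDiffAt_sq {g : ℝ × E → F} {a : E}
    (h : SmoothNear g (Ici (0 : ℝ) ×ˢ univ) (0, a)) :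
    ∀ᶠ q in 𝓝 ((0 : ℝ), a), ContDiffAt ℝ ∞ (fun q : ℝ × E => g (q.1 ^ 2, q.2)) q := by
  obtain ⟨U, hU, hg⟩ := h
  obtain ⟨O, hO, haO, hOU⟩ := mem_nhdsWithin.1 hU
  have hm : ContDiff ℝ ∞ fun q : ℝ × E => (q.1 ^ 2, q.2) := by fun_prop
  have hopen : IsOpen ((fun q : ℝ × E => (q.1 ^ 2, q.2)) ⁻¹' O) := hO.preimage hm.continuous
  have hmem : ((0 : ℝ), a) ∈ (fun q : ℝ × E => (q.1 ^ 2, q.2)) ⁻¹' O := by simpa using haO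
  filter_upwards [hopen.mem_nhds hmem] with q hq
  exact (hg.comp hm.contDiffOn fun q hq => hOU ⟨hq, sq_nonneg q.1, mem_univ _⟩).contDiffAt
    (hopen.mem_nhds hq)

/-- At positive times smoothness up to the boundary is smoothness on a full neighbourhood. -/
lemma SmoothNear.eventually_contDiffAt_of_pos {g : ℝ × E → F} {a : E}
    (h : SmoothNear g (Ici (0 : ℝ) ×ˢ univ) (0, a)) :
    ∀ᶠ q in 𝓝 ((0 : ℝ), a), 0 < q.1 → ContDiffAt ℝ ∞ g q := by
  obtain ⟨U, hU, hg⟩ := h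
  obtain ⟨O, hO, haO, hOU⟩ := mem_nhdsWithin.1 hU
  filter_upwards [hO.mem_nhds haO] with q hq h0
  refine hg.contDiffAt (mem_of_superset ((hO.inter (isOpen_Ioi.prod isOpen_univ)).mem_nhds
    ⟨hq, h0, mem_univ _⟩) ?_)
  rintro w ⟨hw, hw0, -⟩
  exact hOU ⟨hw, (mem_Ioi.1 hw0).le, mem_univ _⟩

end SmoothNear

lemma eventually_halfNhds_iff {E : Type*} [NormedAddCommGroup E] {a : E} {P : ℝ × E → Prop} :
    (∀ᶠ q in halfNhds a, P q) ↔
      ∃ r > 0, ∀ t ∈ Icc 0 r, ∀ x ∈ Metric.ball a r, P (t, x) := by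
  rw [halfNhds, eventually_nhdsWithin_iff, Metric.eventually_nhds_iff_ball]
  constructor
  · rintro ⟨r, hr, h⟩
    refine ⟨r / 2, half_pos hr, fun t ht x hx => h (t, x) ?_ ⟨ht.1, mem_univ _⟩⟩
    rw [← ball_prod_same]
    refine ⟨?_, Metric.ball_subset_ball (by linarith) hx⟩
    rw [mem_ball_iff_norm, sub_zero, Real.norm_eq_abs, abs_of_nonneg ht.1]
    linarith [ht.2]
  · rintro ⟨r, hr, h⟩
    refine ⟨r, hr, fun q hq h0 => h q.1 ⟨h0.1, ?_⟩ q.2 ?_⟩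
    · rw [← ball_prod_same] at hq
      have := hq.1
      rw [mem_ball_iff_norm, sub_zero, Real.norm_eq_abs] at this
      exact ((le_abs_self _).trans_lt this).le
    · rw [← ball_prod_same] at hq
      exact hq.2

/-- The comparison estimate provided by the characteristics: there are foot points `Z t x`,
depending on `x` in a bi-Lipschitz way, for which every defect grows at least like the action. -/
def HasFootpoints (Φ₀ : Cn n → ℝ) (pt : Cn n × Cn n → ℂ) (x₀ : Cn n) (k : ℕ) : Prop :=
  ∃ r₀ > 0, ∃ C₀ > 0, ∃ Z : ℝ → Cn n → Cn n,
    (∀ t ∈ Icc 0 r₀, ∀ x ∈ Metric.ball x₀ r₀, ∀ x' ∈ Metric.ball x₀ r₀,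
      ‖x - x'‖ ≤ C₀ * ‖Z t x - Z t x'‖) ∧
    ∀ r > 0, ∀ K > 0, ∀ N : ℕ, ∃ ρ > 0, ∃ c > 0, ∃ C > 0, ∀ y ∈ Metric.ball x₀ ρ, ∀ d,
      IsDefect Φ₀ pt x₀ r K N y d → ∀ t ∈ Icc 0 ρ, ∀ x ∈ Metric.ball x₀ ρ,
        ‖Z t x - x‖ ≤ C * t ∧ Z t x ∈ Metric.ball x₀ r ∧
          c * (t ^ (k + 1) + d 0 (Z t x)) ≤ d t x + C * (√t + ‖x - y‖) ^ N

lemma SolvesHJ.contDiffAt_zero {pt : Cn n × Cn n → ℂ} {x₀ : Cn n} {Φ : ℝ → Cn n → ℝ}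
    (h : SolvesHJ pt x₀ Φ) : ContDiffAt ℝ ∞ (Φ 0) x₀ := by
  have h1 := h.1.eventually_contDiffAt_sq.self_of_nhds
  have h2 : ContDiffAt ℝ ∞ (fun x : Cn n => ((0 : ℝ), x)) x₀ := by fun_prop
  have h3 := ContDiffAt.comp (f := fun x : Cn n => ((0 : ℝ), x))
    (g := fun q : ℝ × Cn n => Φ (q.1 ^ 2) q.2) x₀ h1 h2
  refine h3.congr_of_eventuallyEq (Eventually.of_forall fun x => ?_)
  simp

lemma pd_congr {g g' : Cn n → ℂ} {x : Cn n} (h : g =ᶠ[𝓝 x] g') : pd g x = pd g' x := by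
  ext j
  simp only [pd, del, h.fderiv_eq]

/-- The hypotheses on the phase, restated in terms of complex Fréchet derivatives. -/
lemma IsFBIPhase.setting {φ : Cn n → Cn n → ℂ} {x₀ : Cn n} {y₀ η₀ : Rn n} {Φ₀ : Cn n → ℝ}
    (h : IsFBIPhase φ x₀ y₀ η₀) (hΦ : IsFBIWeight φ x₀ y₀ Φ₀) (hs : ContDiffAt ℝ ∞ Φ₀ x₀) :
    Setting (fun z => φ z.1 z.2) x₀ y₀ η₀ Φ₀ := by
  set f : Cn n × Cn n → ℂ := fun z => φ z.1 z.2 with hf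
  have hd : ∀ᶠ z in 𝓝 (x₀, toC y₀), DifferentiableAt ℂ f z :=
    h.holo.eventually_analyticAt.mono fun z hz => hz.differentiableAt
  have hgrad := hasFDerivAt_gradY (f := f) (z := (x₀, toC y₀)) h.holo.contDiffAt
  set D2 := fderiv ℂ (fderiv ℂ f) (x₀, toC y₀) with hD2
  -- the two Hessian matrices
  have hyy : ∀ i j, pd (fun y => pd (φ x₀) y j) (toC y₀) i =
      D2 (0, Pi.single i 1) (0, Pi.single j 1) := by
    intro i j
    have h1 : ∀ᶠ y in 𝓝 (toC y₀), pd (φ x₀) y j = gradY f (x₀, y) j :=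
      ((Continuous.prodMk_right x₀).continuousAt.eventually hd).mono fun y hy =>
        congrFun (pd_right (f := f) hy) j
    have h2 : HasFDerivAt (fun y => gradY f (x₀, y) j) _ (toC y₀) :=
      ((hasFDerivAt_pi'.1 hgrad j).comp (f := fun y => (x₀, y)) (toC y₀)
        (hasFDerivAt_prodMk_right x₀ (toC y₀)))
    rw [pd_congr h1, pd_eq h2.differentiableAt, h2.fderiv]
    simp [ContinuousLinearMap.flip_apply]
  have hxy : ∀ i j, pd (fun x => pd (φ x) (toC y₀) j) x₀ i =
      D2 (Pi.single i 1, 0) (0, Pi.single j 1) := by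
    intro i j
    have h1 : ∀ᶠ x in 𝓝 x₀, pd (φ x) (toC y₀) j = gradY f (x, toC y₀) j :=
      ((Continuous.prodMk_left (toC y₀)).continuousAt.eventually hd).mono fun x hx =>
        congrFun (pd_right (f := f) hx) j
    have h2 : HasFDerivAt (fun x => gradY f (x, toC y₀) j) _ x₀ :=
      ((hasFDerivAt_pi'.1 hgrad j).comp (f := fun x => (x, toC y₀)) x₀
        (hasFDerivAt_prodMk_left x₀ (toC y₀)))
    rw [pd_congr h1, pd_eq h2.differentiableAt, h2.fderiv]
    simp [ContinuousLinearMap.flip_apply]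
  refine ⟨h.holo, fun v hv => ?_, fun v hv => ?_, ?_, hs, hΦ⟩
  · have h1 := (Matrix.posDef_iff_dotProduct_mulVec.1 h.pos).2 hv
    have h2 : D2 (0, toC v) (0, toC v) =
        ∑ i, (v i : ℂ) * ∑ j, (v j : ℂ) * D2 (0, Pi.single i 1) (0, Pi.single j 1) := by
      have h3 := clm_apply_eq_sum ((D2.flip (0, toC v)).comp
        (ContinuousLinearMap.inr ℂ (Cn n) (Cn n))) (toC v)
      simp only [ContinuousLinearMap.comp_apply, ContinuousLinearMap.inr_apply,
        ContinuousLinearMap.flip_apply, smul_eq_mul] at h3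
      rw [h3]
      refine Finset.sum_congr rfl fun i _ => ?_
      have h4 := clm_apply_eq_sum ((D2 (0, Pi.single i 1)).comp
        (ContinuousLinearMap.inr ℂ (Cn n) (Cn n))) (toC v)
      simp only [ContinuousLinearMap.comp_apply, ContinuousLinearMap.inr_apply,
        smul_eq_mul] at h4
      rw [h4]
      rfl
    have h5 : (D2 (0, toC v) (0, toC v)).im = star v ⬝ᵥ Matrix.mulVec (Matrix.of fun i j : Fin n =>
        (pd (fun y => pd (φ x₀) y j) (toC y₀) i).im) v := by
      rw [h2, Complex.im_sum]
      simp only [dotProduct, Matrix.mulVec, Matrix.of_apply, hyy, Pi.star_apply, star_trivial]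
      refine Finset.sum_congr rfl fun i _ => ?_
      rw [Complex.im_ofReal_mul, Complex.im_sum]
      congr 1
      refine Finset.sum_congr rfl fun j _ => ?_
      rw [Complex.im_ofReal_mul]
      ring
    rw [h5]
    exact h1
  · refine Matrix.eq_zero_of_vecMul_eq_zero h.nondeg ?_
    ext j
    have h3 := clm_apply_eq_sum ((D2.flip (0, Pi.single j 1)).comp
      (ContinuousLinearMap.inl ℂ (Cn n) (Cn n))) v
    simp only [ContinuousLinearMap.comp_apply, ContinuousLinearMap.inl_apply,
      ContinuousLinearMap.flip_apply, smul_eq_mul] at h3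
    rw [hv] at h3
    simp only [Matrix.vecMul, dotProduct, Matrix.of_apply, hxy, Pi.zero_apply]
    exact h3.symm
  · rw [← h.real, neg_neg]
    exact (pd_right (f := f) hd.self_of_nhds).symm

lemma fderiv_I_smul_of_dbar_eq_zero {E : Type*} [NormedAddCommGroup E] [NormedSpace ℝ E]
    [Module ℂ E] {g : E → ℂ} {z v : E} (h : dbar g z v = 0) :
    fderiv ℝ g z (Complex.I • v) = Complex.I * fderiv ℝ g z v := by
  simp only [dbar, div_eq_zero_iff, two_ne_zero, or_false] at h
  have h1 : Complex.I * (fderiv ℝ g z v + Complex.I * fderiv ℝ g z (Complex.I • v)) = 0 := by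
    rw [h, mul_zero]
  rw [mul_add, ← mul_assoc, Complex.I_mul_I] at h1
  linear_combination -h1

lemma commutes_I_of_basis {E : Type*} [NormedAddCommGroup E] [NormedSpace ℂ E]
    [FiniteDimensional ℝ E] (l : E →L[ℝ] ℂ)
    (h : ∀ i, l (Complex.I • Module.finBasis ℝ E i) = Complex.I * l (Module.finBasis ℝ E i))
    (v : E) : l (Complex.I • v) = Complex.I * l v := by
  rw [← (Module.finBasis ℝ E).sum_repr v, Finset.smul_sum, map_sum, map_sum, Finset.mul_sum]
  refine Finset.sum_congr rfl fun i _ => ?_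
  rw [smul_comm Complex.I, l.map_smul, l.map_smul, h i, Complex.real_smul, Complex.real_smul]
  ring

/-- An almost holomorphic symbol has a complex linear differential on `Λ`. -/
lemma IsAlmostHolo.symbol {pt : Cn n × Cn n → ℂ} {Φ₀ : Cn n → ℝ} {x₀ ξ₀ : Cn n}
    (h : IsAlmostHolo pt (LambdaSet Φ₀) (x₀, ξ₀)) : Symbol Φ₀ pt x₀ ξ₀ := by
  refine ⟨h.1.eventually_contDiffAt, ?_⟩
  have hv : ∀ v : Cn n × Cn n, ∀ᶠ z in 𝓝 (x₀, ξ₀), z ∈ LambdaSet Φ₀ →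
      fderiv ℝ pt z (Complex.I • v) = Complex.I * fderiv ℝ pt z v := by
    intro v
    obtain ⟨C, hC⟩ := (h.2 1 v).bound
    filter_upwards [hC] with z hz hzΛ
    rw [Metric.infDist_zero_of_mem hzΛ, pow_one, norm_zero, mul_zero] at hz
    exact fderiv_I_smul_of_dbar_eq_zero (norm_le_zero_iff.1 hz)
  have hbasis : ∀ᶠ z in 𝓝 (x₀, ξ₀), ∀ i, z ∈ LambdaSet Φ₀ →
      fderiv ℝ pt z (Complex.I • Module.finBasis ℝ (Cn n × Cn n) i) =
        Complex.I * fderiv ℝ pt z (Module.finBasis ℝ (Cn n × Cn n) i) :=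
    eventually_all.2 fun i => hv _
  filter_upwards [hbasis] with z hz hzΛ
  exact commutes_I_of_basis _ fun i => hz i hzΛ

/-- In the chart, the pullback is `p = p̃ ∘ κ`. -/
lemma IsPullback.eventually_eq {φ : Cn n → Cn n → ℂ} {x₀ ξ₀ : Cn n} {y₀ η₀ : Rn n}
    {pt : Cn n × Cn n → ℂ} {p : Rn n × Rn n → ℂ} (h : IsPullback φ x₀ ξ₀ y₀ η₀ pt p)
    {Φ₀ : Cn n → ℝ} {X : Cn n × Cn n → Cn n}
    (hξ₀ : ξ₀ = gradX (fun z => φ z.1 z.2) (x₀, toC y₀)) (hX0 : X (toCC (y₀, η₀)) = x₀)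
    (hX : ∀ᶠ ρ in 𝓝 (y₀, η₀), ChartAt (fun z => φ z.1 z.2) Φ₀ X ρ) :
    ∀ᶠ ρ in 𝓝 (y₀, η₀), p ρ = pt (canon (fun z => φ z.1 z.2) X (toCC ρ)) := by
  set f : Cn n × Cn n → ℂ := fun z => φ z.1 z.2
  have h0 := hX.self_of_nhds
  have hc : ContinuousAt (fun ρ : Rn n × Rn n => canon f X (toCC ρ)) (y₀, η₀) :=
    ContinuousAt.comp (g := canon f X) (f := toCCL n)
      (contDiffAt_canon h0.smooth h0.holo).continuousAt (toCCL n).continuous.continuousAt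
  have hc0 : canon f X (toCC (y₀, η₀)) = (x₀, ξ₀) := by
    rw [hξ₀, ← hX0]; rfl
  have ht : Tendsto (fun ρ : Rn n × Rn n => (ρ, canon f X (toCC ρ))) (𝓝 (y₀, η₀))
      (𝓝 ((y₀, η₀), (x₀, ξ₀))) := by
    have := hc.tendsto
    rw [hc0] at this
    exact tendsto_id.prodMk_nhds this
  filter_upwards [hX, ht.eventually h] with ρ hρ hp
  have hd : DifferentiableAt ℂ f (X (toCC ρ), toC ρ.1) := hρ.holo.differentiableAt
  refine hp ⟨?_, ?_⟩
  · show toC ρ.2 = -pd (φ (X (toCC ρ))) (toC ρ.1)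
    have h1 : pd (φ (X (toCC ρ))) (toC ρ.1) = _ := pd_right (f := f) hd
    rw [h1, hρ.critical, neg_neg]
  · exact (pd_left (f := f) hd).symm

namespace Setting

variable {f : Cn n × Cn n → ℂ} {x₀ ξ₀ : Cn n} {y₀ η₀ : Rn n} {Φ₀ : Cn n → ℝ}

lemma wcov_base (S : Setting f x₀ y₀ η₀ Φ₀) : wcov Φ₀ x₀ = gradX f (x₀, toC y₀) := by
  obtain ⟨r, hr, h⟩ := S.exists_wcov_eq
  refine h x₀ (Metric.mem_ball_self hr) y₀ (Metric.mem_ball_self hr) ?_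
  rw [S.real, imC_neg_toC]

/-- Under the hypotheses on `p` the comparison estimate holds, the foot point `Z t x` being the
starting point of the characteristic that ends at `x` at time `t`. -/
theorem hasFootpoints (S : Setting f x₀ y₀ η₀ Φ₀) {pt : Cn n × Cn n → ℂ}
    (hξ₀ : ξ₀ = gradX f (x₀, toC y₀)) (P : Symbol Φ₀ pt x₀ ξ₀) {X : Cn n × Cn n → Cn n}
    (hX0 : X (toCC (y₀, η₀)) = x₀) (hX : ∀ᶠ ρ in 𝓝 (y₀, η₀), ChartAt f Φ₀ X ρ)
    (hsurj : ∀ U ∈ 𝓝 ((y₀, η₀) : Rn n × Rn n), ∀ᶠ x in 𝓝 x₀, ∃ ρ ∈ U, X (toCC ρ) = x)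
    {p : Rn n × Rn n → ℂ} (hp : ∀ᶠ ρ in 𝓝 (y₀, η₀), p ρ = pt (canon f X (toCC ρ)))
    (hpos : ∀ᶠ ρ in 𝓝 (y₀, η₀), 0 ≤ (p ρ).re) {k : ℕ}
    (hk : 0 < (hamD (fun ρ => (p ρ).im))^[k] (fun ρ => (p ρ).re) (y₀, η₀)) :
    HasFootpoints Φ₀ pt x₀ k := by
  obtain ⟨r₀, hr₀, C₀, hC₀, c₀, hc₀, Z, F, hZ⟩ :=
    S.exists_characteristics hξ₀ P hX0 hX hsurj hp hpos hk
  have hpos' : ∀ᶠ x in 𝓝 x₀, 0 ≤ (pt (x, wcov Φ₀ x)).re := by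
    filter_upwards [hsurj _ (hX.and (hp.and hpos))] with x hx
    obtain ⟨ρ, ⟨h1, h2, h3⟩, rfl⟩ := hx
    rwa [h2, h1.canon_eq] at h3
  obtain ⟨r₁, hr₁, L, hL, B⟩ := exists_symbolBounds
    (S.smooth.of_le (by simp)) (S.wcov_base.trans hξ₀.symm) P hpos'
  exact ⟨r₀, hr₀, C₀, hC₀, fun t x => Z t x 0, fun t ht x hx x' hx' => (hZ t ht x hx).2 x' hx',
    fun r hr K hK N => IsDefect.exists_action_lower_bound hr₁ hL B hr₀ hC₀ hc₀
      (fun t ht x hx => (hZ t ht x hx).1) hr hK N⟩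

end Setting

end FBI

namespace FBI

/-! ### Decay of the weight -/

variable {n : ℕ}

/-- A function that is smooth for `s ≥ 0`, critical in `z` on the diagonal and nonnegative at
`s = 0`, and that solves the defect equation approximately, is a defect near the base point,
uniformly in the parameter `y`. -/
lemma exists_isDefect {Φ₀ : Cn n → ℝ} {pt : Cn n × Cn n → ℂ} {x₀ : Cn n}
    {g : ℝ × (Cn n × Cn n) → ℝ} (hg : SmoothNear g (Ici (0 : ℝ) ×ˢ univ) (0, (x₀, x₀)))
    (hdiag : ∀ᶠ x in 𝓝 x₀, fderiv ℝ (fun z => g (0, (z, x))) x = 0)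
    (hinit : ∀ᶠ w in 𝓝 (x₀, x₀), 0 ≤ g (0, w)) {N : ℕ} {K₀ : ℝ}
    (heqn : ∀ᶠ q in halfNhds (x₀, x₀), |derivWithin (fun s => g (s, q.2)) (Ici 0) q.1 -
      (pt (q.2.1, wcov Φ₀ q.2.1 - wcov (fun z => g (q.1, (z, q.2.2))) q.2.1)).re| ≤
        K₀ * (√q.1 + ‖q.2.1 - q.2.2‖) ^ N) :
    ∃ r > 0, ∃ K > 0, ∀ y ∈ Metric.ball x₀ r,
      IsDefect Φ₀ pt x₀ r K N y (fun s z => g (s, (z, y))) := by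
  -- `G` is smooth on both sides of `0`, and `g (s, ·) = G (√s, ·)` for `s ≥ 0`
  set G : ℝ × (Cn n × Cn n) → ℝ := fun q => g (q.1 ^ 2, q.2) with hG
  have hGs : ∀ᶠ q in 𝓝 ((0 : ℝ), (x₀, x₀)), ContDiffAt ℝ 2 G q :=
    hg.eventually_contDiffAt_sq.mono fun q hq => hq.of_le two_le_infty
  have hG0 : ContDiffAt ℝ 2 G (0, (x₀, x₀)) := hGs.self_of_nhds
  obtain ⟨M, hM, hH⟩ := eventually_hessian_le hG0
  obtain ⟨L, T, hT, hL⟩ :=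
    (hG0.fderiv_right (m := 1) (by norm_num)).exists_lipschitzOnWith (𝕂 := ℝ)
  obtain ⟨R, hR, hb⟩ := Metric.eventually_nhds_iff_ball.1 ((hGs.and hH).and
    ((eventually_mem_nhds_iff.2 hT).and hg.eventually_contDiffAt_of_pos))
  obtain ⟨R₁, hR₁, hdiag⟩ := Metric.eventually_nhds_iff_ball.1 hdiag
  obtain ⟨R₂, hR₂, hinit⟩ := Metric.eventually_nhds_iff_ball.1 hinit
  obtain ⟨R₃, hR₃, heqn⟩ := eventually_halfNhds_iff.1 heqn
  set r := min (min (R / 2) ((R / 2) ^ 2)) (min R₁ (min R₂ R₃)) with hr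
  have hr0 : 0 < r := by positivity
  have hrR : r ≤ R / 2 := (min_le_left _ _).trans (min_le_left _ _)
  have hrR' : r ≤ (R / 2) ^ 2 := (min_le_left _ _).trans (min_le_right _ _)
  have hrR₁ : r ≤ R₁ := (min_le_right _ _).trans (min_le_left _ _)
  have hrR₂ : r ≤ R₂ := (min_le_right _ _).trans ((min_le_right _ _).trans (min_le_left _ _))
  have hrR₃ : r ≤ R₃ := (min_le_right _ _).trans ((min_le_right _ _).trans (min_le_right _ _))
  have hsq : ∀ s ∈ Icc 0 r, √s < R := fun s hs => by
    have : √s ≤ R / 2 := Real.sqrt_le_iff.2 ⟨by positivity, hs.2.trans hrR'⟩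
    linarith
  have hmem : ∀ τ, |τ| < R → ∀ z ∈ Metric.ball x₀ r, ∀ y ∈ Metric.ball x₀ r,
      (τ, (z, y)) ∈ Metric.ball ((0 : ℝ), (x₀, x₀)) R := by
    intro τ hτ z hz y hy
    rw [← ball_prod_same, ← ball_prod_same]
    refine ⟨by simpa using hτ, ?_, ?_⟩
    · exact Metric.ball_subset_ball (by linarith) hz
    · exact Metric.ball_subset_ball (by linarith) hy
  have hmem' : ∀ s ∈ Icc 0 r, ∀ z ∈ Metric.ball x₀ r, ∀ y ∈ Metric.ball x₀ r,
      (√s, (z, y)) ∈ Metric.ball ((0 : ℝ), (x₀, x₀)) R := fun s hs z hz y hy =>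
    hmem _ (by rw [abs_of_nonneg (Real.sqrt_nonneg _)]; exact hsq s hs) z hz y hy
  have hgG : ∀ s, 0 ≤ s → ∀ w, g (s, w) = G (√s, w) := fun s hs w => by
    simp only [hG, Real.sq_sqrt hs]
  set J : Cn n →L[ℝ] ℝ × (Cn n × Cn n) :=
    (ContinuousLinearMap.inr ℝ ℝ (Cn n × Cn n)).comp (ContinuousLinearMap.inl ℝ (Cn n) (Cn n))
    with hJ
  have hJn : ∀ v, ‖J v‖ = ‖v‖ := fun v => by simp [hJ]
  have hfd : ∀ s ∈ Icc 0 r, ∀ z ∈ Metric.ball x₀ r, ∀ y ∈ Metric.ball x₀ r,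
      fderiv ℝ (fun z => g (s, (z, y))) z = (fderiv ℝ G (√s, (z, y))).comp J := by
    intro s hs z hz y hy
    have h1 : DifferentiableAt ℝ G (√s, (z, y)) :=
      (hb _ (hmem' s hs z hz y hy)).1.1.differentiableAt (by norm_num)
    have h2 : HasFDerivAt (fun z : Cn n => (√s, (z, y))) J z :=
      (hasFDerivAt_prodMk_right (√s) (z, y)).comp (f := fun z : Cn n => (z, y)) z
        (hasFDerivAt_prodMk_left z y)
    have h3 := h1.hasFDerivAt.comp (f := fun z : Cn n => (√s, (z, y))) z h2
    rw [← h3.fderiv]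
    congr 1
    ext z
    exact hgG s hs.1 _
  refine ⟨r, hr0, max (max K₀ L) M + 1, by positivity, fun y hy => ?_⟩
  have hKK₀ : K₀ ≤ max (max K₀ L) M + 1 := by
    linarith [(le_max_left K₀ (L : ℝ)).trans (le_max_left _ M)]
  have hKL : (L : ℝ) ≤ max (max K₀ L) M + 1 := by
    linarith [(le_max_right K₀ (L : ℝ)).trans (le_max_left _ M)]
  have hKM : M ≤ max (max K₀ L) M + 1 := by linarith [le_max_right (max K₀ (L : ℝ)) M]
  set K := max (max K₀ L) M + 1
  refine ⟨?_, ?_, ?_, ?_, ?_, ?_⟩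
  · rintro ⟨s, z⟩ ⟨hs, hz⟩
    have h1 : ContinuousAt G (√s, (z, y)) := (hb _ (hmem' s hs z hz y hy)).1.1.continuousAt
    have h2 : ContinuousAt (fun q : ℝ × Cn n => (√q.1, (q.2, y))) (s, z) := by fun_prop
    have h3 : ContinuousAt (fun q : ℝ × Cn n => G (√q.1, (q.2, y))) (s, z) :=
      ContinuousAt.comp (g := G) (f := fun q : ℝ × Cn n => (√q.1, (q.2, y))) h1 h2
    refine h3.continuousWithinAt.congr (fun q hq => hgG q.1 hq.1.1 _) (hgG s hs.1 _)
  · intro s hs z hz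
    have h0 := (hb _ (hmem s (by
      rw [abs_of_pos hs.1]; linarith [hs.2]) z hz y hy)).2.2 hs.1
    have h1 : DifferentiableAt ℝ (fun q : ℝ × Cn n => (q.1, (q.2, y))) (s, z) := by fun_prop
    exact DifferentiableAt.comp (g := g) (f := fun q : ℝ × Cn n => (q.1, (q.2, y))) (s, z)
      (h0.differentiableAt (by simp)) h1
  · intro s hs z hz
    have h1 := heqn s ⟨hs.1.le, hs.2.le.trans hrR₃⟩ (z, y) (by
      rw [← ball_prod_same]
      exact ⟨Metric.ball_subset_ball hrR₃ hz, Metric.ball_subset_ball hrR₃ hy⟩)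
    simp only at h1
    rw [derivWithin_of_mem_nhds (Ici_mem_nhds hs.1)] at h1
    exact h1.trans (by gcongr)
  · intro s hs z hz
    -- the gradient of `G` in `z` vanishes at `(0, y, y)` and is Lipschitz
    have hz0 : (fderiv ℝ G (√0, (y, y))).comp J = 0 := by
      rw [← hfd 0 ⟨le_rfl, hr0.le⟩ y hy y hy]
      exact hdiag y (Metric.ball_subset_ball hrR₁ hy)
    have h1 := hL.dist_le_mul _ (mem_of_mem_nhds (hb _ (hmem' s hs z hz y hy)).2.1) _
      (mem_of_mem_nhds (hb _ (hmem' 0 ⟨le_rfl, hr0.le⟩ y hy y hy)).2.1)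
    rw [dist_eq_norm, dist_eq_norm] at h1
    have h2 : ‖((√s, (z, y)) : ℝ × (Cn n × Cn n)) - (√0, (y, y))‖ ≤ √s + ‖z - y‖ := by
      simp only [Real.sqrt_zero, Prod.mk_sub_mk, sub_zero, sub_self, Prod.norm_mk, norm_zero,
        Real.norm_eq_abs, abs_of_nonneg (Real.sqrt_nonneg s)]
      refine max_le (by linarith [norm_nonneg (z - y)]) (max_le ?_ (by positivity))
      linarith [Real.sqrt_nonneg s]
    show ‖fderiv ℝ (fun z => g (s, (z, y))) z‖ ≤ _
    rw [hfd s hs z hz y hy]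
    refine ContinuousLinearMap.opNorm_le_bound _ (by positivity) fun v => ?_
    have h3 : (fderiv ℝ G (√s, (z, y))).comp J v =
        (fderiv ℝ G (√s, (z, y)) - fderiv ℝ G (√0, (y, y))) (J v) := by
      have : fderiv ℝ G (√0, (y, y)) (J v) = 0 := congrArg (fun l => l v) hz0
      rw [sub_apply, this, sub_zero]
      rfl
    rw [h3]
    refine (ContinuousLinearMap.le_opNorm _ _).trans ?_
    rw [hJn]
    gcongr
    exact h1.trans (by gcongr)
  · intro s hs z hz v hv
    have e1 : ((√s, (z + v, y)) : ℝ × (Cn n × Cn n)) - (√s, (z, y)) = J v := by simp [hJ]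
    have hseg : segment ℝ ((√s, (z, y)) : ℝ × (Cn n × Cn n)) (√s, (z + v, y)) ⊆
        Metric.ball (0, (x₀, x₀)) R :=
      (convex_ball _ _).segment_subset (hmem' s hs z hz y hy) (hmem' s hs _ hv y hy)
    have h1 := le_of_hessian_upper_bound (f := G) (c := M * ‖v‖ * ‖v‖)
      (fun w hw => (hb w (hseg hw)).1.1) (fun w hw => by
        rw [e1, ← hJn v]
        exact (abs_le.1 ((hb w (hseg hw)).1.2 (J v) (J v))).2)
    rw [e1] at h1
    show g (s, (z + v, y)) ≤ g (s, (z, y)) + fderiv ℝ (fun z => g (s, (z, y))) z v + K * ‖v‖ ^ 2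
    rw [hfd s hs z hz y hy, hgG s hs.1, hgG s hs.1, ContinuousLinearMap.comp_apply]
    have h2 : M * ‖v‖ ^ 2 ≤ K * ‖v‖ ^ 2 := by gcongr
    have h3 : 0 ≤ M * ‖v‖ ^ 2 := by positivity
    linarith
  · intro z hz
    exact hinit (z, y) (by
      rw [← ball_prod_same]
      exact ⟨Metric.ball_subset_ball hrR₂ hz, Metric.ball_subset_ball hrR₂ hy⟩)

lemma wcov_sub {g₁ g₂ : Cn n → ℝ} {x : Cn n} (h₁ : DifferentiableAt ℝ g₁ x)
    (h₂ : DifferentiableAt ℝ g₂ x) : wcov (fun x => g₁ x - g₂ x) x = wcov g₁ x - wcov g₂ x := by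
  have e1 : HasFDerivAt (fun x => (g₁ x : ℂ)) (Complex.ofRealCLM.comp (fderiv ℝ g₁ x)) x :=
    Complex.ofRealCLM.hasFDerivAt.comp x h₁.hasFDerivAt
  have e2 : HasFDerivAt (fun x => (g₂ x : ℂ)) (Complex.ofRealCLM.comp (fderiv ℝ g₂ x)) x :=
    Complex.ofRealCLM.hasFDerivAt.comp x h₂.hasFDerivAt
  have e3 : HasFDerivAt (fun x => ((g₁ x - g₂ x : ℝ) : ℂ))
      (Complex.ofRealCLM.comp (fderiv ℝ g₁ x - fderiv ℝ g₂ x)) x :=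
    Complex.ofRealCLM.hasFDerivAt.comp x (h₁.hasFDerivAt.sub h₂.hasFDerivAt)
  ext j
  simp only [wcov, cov, pd, del, e1.fderiv, e2.fderiv, e3.fderiv, Pi.smul_apply, Pi.sub_apply,
    smul_eq_mul]
  simp only [ContinuousLinearMap.comp_apply, sub_apply, Complex.ofRealCLM_apply,
    Complex.ofReal_sub]
  ring

lemma pow_absorb {c C : ℝ} (hc : 0 < c) (hC : 0 < C) : ∃ r > 0, ∀ s ∈ Icc 0 r, C * s ≤ c := by
  refine ⟨c / C, by positivity, fun s hs => ?_⟩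
  have := hs.2
  rw [le_div_iff₀ hC] at this
  linarith

lemma sqrt_pow_two_mul {t : ℝ} (ht : 0 ≤ t) (m : ℕ) : √t ^ (2 * m) = t ^ m := by
  rw [pow_mul, Real.sq_sqrt ht]

/-- The weight decreases: `Φ_t ≤ Φ₀ - t ^ (k + 1) / C`. -/
theorem SolvesHJ.exists_decay {pt : Cn n × Cn n → ℂ} {x₀ : Cn n} {Φ : ℝ → Cn n → ℝ}
    (hΦ : SolvesHJ pt x₀ Φ) {k : ℕ} (hF : HasFootpoints (Φ 0) pt x₀ k) :
    ∃ C > (0 : ℝ), ∀ᶠ q in halfNhds x₀, Φ q.1 q.2 ≤ Φ 0 q.2 - q.1 ^ (k + 1) / C := by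
  -- this defect does not depend on `y`, and satisfies its equation without error
  set g : ℝ × (Cn n × Cn n) → ℝ := fun q => Φ 0 q.2.1 - Φ q.1 q.2.1 with hg
  obtain ⟨-, -, -, -, Z, -, hF⟩ := hF
  have hsm : SmoothNear g (Ici (0 : ℝ) ×ˢ univ) (0, (x₀, x₀)) := by
    obtain ⟨U, hU, hs⟩ := hΦ.1
    obtain ⟨O, hO, haO, hOU⟩ := mem_nhdsWithin.1 hU
    have hc1 : Continuous fun q : ℝ × (Cn n × Cn n) => (q.1, q.2.1) := by fun_prop
    have hc2 : Continuous fun q : ℝ × (Cn n × Cn n) => ((0 : ℝ), q.2.1) := by fun_prop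
    refine ⟨((fun q : ℝ × (Cn n × Cn n) => (q.1, q.2.1)) ⁻¹' O ∩
      (fun q : ℝ × (Cn n × Cn n) => ((0 : ℝ), q.2.1)) ⁻¹' O) ∩ (Ici 0 ×ˢ univ), ?_, ?_⟩
    · refine inter_mem (mem_nhdsWithin_of_mem_nhds ?_) self_mem_nhdsWithin
      exact ((hO.preimage hc1).inter (hO.preimage hc2)).mem_nhds ⟨haO, haO⟩
    · have hd1 : ContDiff ℝ ∞ fun q : ℝ × (Cn n × Cn n) => (q.1, q.2.1) := by fun_prop
      have hd2 : ContDiff ℝ ∞ fun q : ℝ × (Cn n × Cn n) => ((0 : ℝ), q.2.1) := by fun_prop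
      refine (hs.comp hd2.contDiffOn fun q hq => hOU ⟨hq.1.2, mem_Ici.2 le_rfl, mem_univ _⟩).sub
        (hs.comp hd1.contDiffOn fun q hq => hOU ⟨hq.1.1, hq.2.1, mem_univ _⟩)
  have hzero : ∀ w, g (0, w) = 0 := fun w => by simp [hg]
  have heqn : ∀ᶠ q in halfNhds (x₀, x₀), |derivWithin (fun s => g (s, q.2)) (Ici 0) q.1 -
      (pt (q.2.1, wcov (Φ 0) q.2.1 - wcov (fun z => g (q.1, (z, q.2.2))) q.2.1)).re| ≤
        1 * (√q.1 + ‖q.2.1 - q.2.2‖) ^ (2 * (k + 2)) := by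
    obtain ⟨r, hr, h1⟩ := eventually_halfNhds_iff.1 hΦ.2
    obtain ⟨r', hr', h2⟩ := Metric.eventually_nhds_iff_ball.1 hΦ.1.eventually_contDiffAt_sq
    rw [eventually_halfNhds_iff]
    set R := min r (min (r' / 2) ((r' / 2) ^ 2))
    have hRr : R ≤ r := min_le_left _ _
    refine ⟨R, by positivity, fun t ht x hx => ?_⟩
    rw [← ball_prod_same] at hx
    have h3 := h1 t ⟨ht.1, ht.2.trans hRr⟩ x.1 (Metric.ball_subset_ball hRr hx.1)
    have hsq : √t ≤ r' / 2 := Real.sqrt_le_iff.2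
      ⟨by positivity, ht.2.trans ((min_le_right _ _).trans (min_le_right _ _))⟩
    have hd : ∀ τ, 0 ≤ τ → τ ≤ r' / 2 → DifferentiableAt ℝ (Φ (τ ^ 2)) x.1 := by
      intro τ hτ0 hτ
      have h4 := h2 (τ, x.1) (by
        rw [← ball_prod_same]
        refine ⟨?_, Metric.ball_subset_ball ?_ hx.1⟩
        · rw [mem_ball_iff_norm, sub_zero, Real.norm_eq_abs, abs_of_nonneg hτ0]; linarith
        · exact (min_le_right _ _).trans ((min_le_left _ _).trans (by linarith)))
      exact DifferentiableAt.comp (g := fun q : ℝ × Cn n => Φ (q.1 ^ 2) q.2)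
        (f := fun z : Cn n => (τ, z)) x.1 (h4.differentiableAt (by simp)) (by fun_prop)
    have hd0 : DifferentiableAt ℝ (Φ 0) x.1 := by
      simpa using hd 0 le_rfl (by positivity)
    have hdt : DifferentiableAt ℝ (Φ t) x.1 := by
      simpa [Real.sq_sqrt ht.1] using hd (√t) (Real.sqrt_nonneg _) hsq
    have h5 : wcov (fun z => g (t, (z, x.2))) x.1 = wcov (Φ 0) x.1 - wcov (Φ t) x.1 :=
      wcov_sub hd0 hdt
    have h6 : derivWithin (fun s => g (s, x)) (Ici 0) t = (pt (x.1, wcov (Φ t) x.1)).re := by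
      have := (h3.const_sub (Φ 0 x.1)).derivWithin (uniqueDiffOn_Ici 0 t ht.1)
      rw [neg_neg] at this
      exact this
    simp only
    rw [h5, h6, sub_sub_cancel, sub_self, abs_zero]
    positivity
  obtain ⟨r, hr, K, hK, hD⟩ := exists_isDefect (Φ₀ := Φ 0) (pt := pt) hsm
    (Eventually.of_forall fun x => by simp [hzero]) (Eventually.of_forall fun w => (hzero w).ge) heqn
  -- for `y = x` and `N = 2 (k + 2)` the error is `O(t ^ (k + 2))`, which `t ^ (k + 1)` absorbs
  obtain ⟨ρ, hρ, c, hc, C, hC, hb⟩ := hF r hr K hK (2 * (k + 2))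
  obtain ⟨ρ', hρ', habs⟩ := pow_absorb (half_pos hc) hC
  refine ⟨2 / c, by positivity, eventually_halfNhds_iff.2
    ⟨min ρ (min ρ' r), by positivity, fun t ht x hx => ?_⟩⟩
  have h1 : ρ ⊓ (ρ' ⊓ r) ≤ ρ := min_le_left _ _
  have h2 : ρ ⊓ (ρ' ⊓ r) ≤ ρ' := (min_le_right _ _).trans (min_le_left _ _)
  have h3 : ρ ⊓ (ρ' ⊓ r) ≤ r := (min_le_right _ _).trans (min_le_right _ _)
  have h4 := (hb x (Metric.ball_subset_ball h1 hx) _ (hD x (Metric.ball_subset_ball h3 hx)) t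
    ⟨ht.1, ht.2.trans h1⟩ x (Metric.ball_subset_ball h1 hx)).2.2
  rw [sub_self, norm_zero, add_zero, sqrt_pow_two_mul ht.1, hzero, add_zero] at h4
  have h5 : C * t ^ (k + 2) ≤ c / 2 * t ^ (k + 1) := by
    rw [pow_succ' t (k + 1), ← mul_assoc]
    exact mul_le_mul_of_nonneg_right (habs t ⟨ht.1, ht.2.trans h2⟩) (pow_nonneg ht.1 _)
  have h6 : t ^ (k + 1) / (2 / c) = c / 2 * t ^ (k + 1) := by field_simp
  simp only [hg] at h4
  show Φ t x ≤ Φ 0 x - t ^ (k + 1) / (2 / c)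
  rw [h6]
  linarith

end FBI

namespace FBI

/-! ### The exponent of the semigroup kernel at time zero -/

variable {n : ℕ}

/-- Componentwise conjugation as a real-linear map. -/
noncomputable def conjCL (n : ℕ) : Cn n →L[ℝ] Cn n :=
  ContinuousLinearMap.pi fun j =>
    (Complex.conjCLE : ℂ →L[ℝ] ℂ).comp (ContinuousLinearMap.proj j)

@[simp] lemma conjCL_apply (x : Cn n) : conjCL n x = conjC x := rfl

@[simp] lemma norm_conjC (x : Cn n) : ‖conjC x‖ = ‖x‖ := by
  simp [Pi.norm_def, conjC, nnnorm]

@[simp] lemma conjC_conjC (x : Cn n) : conjC (conjC x) = x := by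
  ext j; simp [conjC]

lemma conjC_sub (x y : Cn n) : conjC (x - y) = conjC x - conjC y := (conjCL n).map_sub x y

lemma conjC_I_smul (x : Cn n) : conjC (Complex.I • x) = -(Complex.I • conjC x) := by
  ext j; simp [conjC]

lemma continuous_conjC : Continuous (conjC : Cn n → Cn n) := (conjCL n).continuous

/-- The change of variables `(x, y) ↦ (x, ȳ)`. -/
noncomputable def conjSnd (n : ℕ) : Cn n × Cn n →L[ℝ] Cn n × Cn n :=
  (ContinuousLinearMap.id ℝ (Cn n)).prodMap (conjCL n)

@[simp] lemma conjSnd_apply (w : Cn n × Cn n) : conjSnd n w = (w.1, conjC w.2) := rfl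

lemma tendsto_conjSnd_halfNhds (x₀ : Cn n) :
    Tendsto (fun q : ℝ × (Cn n × Cn n) => (q.1, conjSnd n q.2)) (halfNhds (x₀, x₀))
      (halfNhds (x₀, conjC x₀)) := by
  refine tendsto_nhdsWithin_iff.2 ⟨?_, ?_⟩
  · refine Tendsto.mono_left ?_ nhdsWithin_le_nhds
    exact (by fun_prop : Continuous fun q : ℝ × (Cn n × Cn n) => (q.1, conjSnd n q.2)).tendsto _
  · filter_upwards [self_mem_nhdsWithin] with q hq
    exact ⟨hq.1, mem_univ _⟩

lemma tendsto_sqrt_halfNhds {E : Type*} [TopologicalSpace E] (a : E) :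
    Tendsto (fun q : ℝ × E => (√q.1, q.2)) (halfNhds a) (𝓝 (0, a)) := by
  refine Tendsto.mono_left ?_ nhdsWithin_le_nhds
  have := (by fun_prop : Continuous fun q : ℝ × E => (√q.1, q.2)).tendsto (0, a)
  simpa using this

lemma VanishesToInfiniteOrder.exists_bound {x₀ : Cn n} {g : ℝ × (Cn n × Cn n) → ℂ}
    (h : VanishesToInfiniteOrder x₀ g) (N : ℕ) : ∃ C > 0, ∀ᶠ q in halfNhds (x₀, x₀),
      ‖g (q.1, conjSnd n q.2)‖ ≤ C * (√q.1 + ‖q.2.1 - q.2.2‖) ^ N := by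
  obtain ⟨C, hC, hb⟩ := (h N).exists_pos
  refine ⟨C, hC, ?_⟩
  have h1 : ∀ᶠ q in halfNhds (x₀, x₀), q.1 ∈ Icc (0 : ℝ) 1 :=
    eventually_halfNhds_iff.2 ⟨1, one_pos, fun t ht _ _ => ht⟩
  filter_upwards [(tendsto_conjSnd_halfNhds x₀).eventually hb.bound, h1] with q hq ht
  refine hq.trans ?_
  simp only [conjSnd_apply]
  rw [← conjC_sub, norm_conjC, norm_sub_rev, norm_pow, Real.norm_eq_abs,
    abs_of_nonneg (add_nonneg ht.1 (norm_nonneg _))]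
  have := le_sqrt_self ht.1 ht.2
  have := ht.1
  gcongr

lemma VanishesToInfiniteOrder.eventually_eq_zero {x₀ : Cn n} {g : ℝ × (Cn n × Cn n) → ℂ}
    (h : VanishesToInfiniteOrder x₀ g) : ∀ᶠ x in 𝓝 x₀, g (0, (x, conjC x)) = 0 := by
  obtain ⟨C, hC, hb⟩ := h.exists_bound 1
  obtain ⟨r, hr, hb⟩ := eventually_halfNhds_iff.1 hb
  filter_upwards [Metric.ball_mem_nhds x₀ hr] with x hx
  have := hb 0 ⟨le_rfl, hr.le⟩ (x, x) (by rw [← ball_prod_same]; exact ⟨hx, hx⟩)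
  simpa using this

/-- A function vanishing to infinite order has zero differential at `(x₀, x̄₀)` at `t = 0`. -/
lemma VanishesToInfiniteOrder.hasFDerivAt {x₀ : Cn n} {g : ℝ × (Cn n × Cn n) → ℂ}
    (h : VanishesToInfiniteOrder x₀ g) :
    HasFDerivAt (fun w => g (0, w)) (0 : Cn n × Cn n →L[ℝ] ℂ) (x₀, conjC x₀) := by
  refine Asymptotics.IsBigO.hasFDerivAt (n := 2) ?_ one_lt_two
  obtain ⟨C, hC, hb⟩ := h.exists_bound 2
  obtain ⟨r, hr, hb⟩ := eventually_halfNhds_iff.1 hb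
  have hev : ∀ᶠ w in 𝓝 ((x₀, conjC x₀) : Cn n × Cn n), conjSnd n w ∈ Metric.ball (x₀, x₀) r := by
    refine (conjSnd n).continuous.continuousAt.preimage_mem_nhds ?_
    simpa using Metric.ball_mem_nhds (x₀, x₀) hr
  refine Asymptotics.IsBigO.of_bound (C * 2 ^ 2) ?_
  filter_upwards [hev] with w hw
  have h1 := hb 0 ⟨le_rfl, hr.le⟩ _ hw
  simp only [conjSnd_apply, conjC_conjC, Real.sqrt_zero, zero_add] at h1
  have h2 : ‖w.1 - conjC w.2‖ ≤ 2 * ‖w - (x₀, conjC x₀)‖ := by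
    have h3 : w.1 - conjC w.2 = (w.1 - x₀) - conjC (w.2 - conjC x₀) := by
      rw [conjC_sub, conjC_conjC]; abel
    rw [h3]
    refine (norm_sub_le _ _).trans ?_
    rw [norm_conjC]
    have h4 := norm_fst_le (w - (x₀, conjC x₀))
    have h5 := norm_snd_le (w - (x₀, conjC x₀))
    simp only [Prod.fst_sub, Prod.snd_sub] at h4 h5
    linarith
  refine h1.trans ?_
  rw [norm_pow, norm_norm, mul_assoc, ← mul_pow]
  gcongr

namespace IsSemigroupPhase

variable {pt : Cn n × Cn n → ℂ} {x₀ : Cn n} {Φ₀ : Cn n → ℝ} {Ψ : ℝ → Cn n → Cn n → ℂ}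

lemma eventually_contDiffAt_zero (S : IsSemigroupPhase pt x₀ Φ₀ Ψ) :
    ∀ᶠ w in 𝓝 (x₀, conjC x₀), ContDiffAt ℝ ∞ (fun w : Cn n × Cn n => Ψ 0 w.1 w.2) w := by
  have h0 : Tendsto (fun w : Cn n × Cn n => ((0 : ℝ), w)) (𝓝 (x₀, conjC x₀))
      (𝓝 (0, (x₀, conjC x₀))) := (Continuous.prodMk_right (0 : ℝ)).tendsto _
  have h1 := h0.eventually S.smooth.eventually_contDiffAt_sq
  filter_upwards [h1] with w hw
  have h3 := ContDiffAt.comp (f := fun w : Cn n × Cn n => ((0 : ℝ), w))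
    (g := fun q : ℝ × (Cn n × Cn n) => Ψ (q.1 ^ 2) q.2.1 q.2.2) w hw (by fun_prop)
  refine h3.congr_of_eventuallyEq (Eventually.of_forall fun x => ?_)
  simp

/-- On the diagonal the differential of the initial phase is complex linear. -/
lemma eventually_fderiv_I_smul (S : IsSemigroupPhase pt x₀ Φ₀ Ψ) : ∀ᶠ x in 𝓝 x₀, ∀ v,
    fderiv ℝ (fun w : Cn n × Cn n => Ψ 0 w.1 w.2) (x, conjC x) (Complex.I • v) =
      Complex.I * fderiv ℝ (fun w : Cn n × Cn n => Ψ 0 w.1 w.2) (x, conjC x) v := by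
  have h : ∀ᶠ x in 𝓝 x₀, ∀ i,
      fderiv ℝ (fun w : Cn n × Cn n => Ψ 0 w.1 w.2) (x, conjC x)
        (Complex.I • Module.finBasis ℝ (Cn n × Cn n) i) =
      Complex.I * fderiv ℝ (fun w : Cn n × Cn n => Ψ 0 w.1 w.2) (x, conjC x)
        (Module.finBasis ℝ (Cn n × Cn n) i) :=
    eventually_all.2 fun i => (S.almostHolo _).eventually_eq_zero.mono fun x hx =>
      fderiv_I_smul_of_dbar_eq_zero hx
  filter_upwards [h] with x hx
  exact commutes_I_of_basis _ hx

/-- At `(x₀, x̄₀)` the Hessian of the initial phase is complex bilinear. -/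
lemma hessian_I_smul (S : IsSemigroupPhase pt x₀ Φ₀ Ψ) (u v : Cn n × Cn n) :
    fderiv ℝ (fderiv ℝ fun w : Cn n × Cn n => Ψ 0 w.1 w.2) (x₀, conjC x₀) u (Complex.I • v) =
      Complex.I * fderiv ℝ (fderiv ℝ fun w : Cn n × Cn n => Ψ 0 w.1 w.2) (x₀, conjC x₀) u v := by
  set ψ : Cn n × Cn n → ℂ := fun w => Ψ 0 w.1 w.2 with hψ
  have hs : ContDiffAt ℝ 2 ψ (x₀, conjC x₀) :=
    S.eventually_contDiffAt_zero.self_of_nhds.of_le two_le_infty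
  have hd : DifferentiableAt ℝ (fderiv ℝ ψ) (x₀, conjC x₀) :=
    (hs.fderiv_right (m := 1) (by norm_num)).differentiableAt (by norm_num)
  have h1 := fun v => hd.hasFDerivAt.clm_apply (hasFDerivAt_const v (x₀, conjC x₀))
  have h2 := ((h1 v).add ((h1 (Complex.I • v)).const_mul Complex.I)).const_mul (1 / 2 : ℂ)
  have h3 : HasFDerivAt (fun w => dbar ψ w v) _ (x₀, conjC x₀) :=
    h2.congr_of_eventuallyEq (Eventually.of_forall fun w => by
      simp only [dbar, Pi.add_apply]; ring)
  have h4 := congrArg (fun l => l u) (h3.unique (S.almostHolo v).hasFDerivAt)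
  simp at h4
  linear_combination (-2 * Complex.I) * h4 +
    fderiv ℝ (fderiv ℝ ψ) (x₀, conjC x₀) u (Complex.I • v) * Complex.I_sq

/-- On the diagonal `dΦ₀ = 2 Re ∂_xΨ₀`. -/
lemma eventually_fderiv_weight (S : IsSemigroupPhase pt x₀ Φ₀ Ψ) : ∀ᶠ x in 𝓝 x₀, ∀ a,
    fderiv ℝ Φ₀ x a = 2 * (fderiv ℝ (fun w : Cn n × Cn n => Ψ 0 w.1 w.2) (x, conjC x) (a, 0)).re := by
  have h0 : Tendsto (fun x : Cn n => (x, conjC x)) (𝓝 x₀) (𝓝 (x₀, conjC x₀)) :=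
    (continuous_id.prodMk continuous_conjC).tendsto _
  filter_upwards [S.initial.eventually_nhds, S.eventually_fderiv_I_smul,
    h0.eventually S.eventually_contDiffAt_zero] with x hx hI hs a
  set ψ : Cn n × Cn n → ℂ := fun w => Ψ 0 w.1 w.2 with hψ
  set l := fderiv ℝ ψ (x, conjC x) with hl
  have h1 : HasFDerivAt (fun x => ψ (x, conjC x))
      (l.comp ((ContinuousLinearMap.id ℝ (Cn n)).prod (conjCL n))) x :=
    (hs.differentiableAt (by simp)).hasFDerivAt.comp (f := fun x => (x, conjC x)) x
      ((hasFDerivAt_id x).prodMk (conjCL n).hasFDerivAt)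
  have h2 : (fun x => ψ (x, conjC x)) =ᶠ[𝓝 x] fun x => (Φ₀ x : ℂ) := hx
  have hre : HasFDerivAt Φ₀ _ x := (Complex.reCLM.hasFDerivAt.comp x h1).congr_of_eventuallyEq
    (h2.mono fun y hy => by simp [hy])
  have him : HasFDerivAt (fun _ : Cn n => (0 : ℝ)) _ x :=
    (Complex.imCLM.hasFDerivAt.comp x h1).congr_of_eventuallyEq (h2.mono fun y hy => by simp [hy])
  have him' : ∀ b, (l (b, conjC b)).im = 0 := fun b =>
    (congrArg (fun L => L b) (him.unique (hasFDerivAt_const (0 : ℝ) x)))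
  have hsplit : ∀ b c, l (b, c) = l (b, 0) + l (0, c) := fun b c => by
    rw [← map_add]; simp
  -- compare with the direction `i a`
  have h3 := him' (Complex.I • a)
  have e1 : ((Complex.I • a, 0) : Cn n × Cn n) = Complex.I • (a, 0) := by simp
  have e2 : ((0, -(Complex.I • conjC a)) : Cn n × Cn n) = -(Complex.I • (0, conjC a)) := by simp
  rw [hsplit, conjC_I_smul, e1, e2, map_neg, hI, hI] at h3
  simp only [Complex.add_im, Complex.neg_im, Complex.I_mul_im] at h3
  have h4 : fderiv ℝ Φ₀ x a = (l (a, conjC a)).re := by rw [hre.fderiv]; rfl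
  rw [h4, hsplit, Complex.add_re]
  linarith

end IsSemigroupPhase

/-- The function `Φ₀(x) + Φ₀(y) - 2 Re Ψ_t(x, ȳ)`, which controls the size of the kernel of the
semigroup between the weighted spaces. -/
noncomputable def phaseDefect (Φ₀ : Cn n → ℝ) (Ψ : ℝ → Cn n → Cn n → ℂ)
    (q : ℝ × (Cn n × Cn n)) : ℝ :=
  Φ₀ q.2.1 + Φ₀ q.2.2 - 2 * (Ψ q.1 q.2.1 (conjC q.2.2)).re

namespace IsSemigroupPhase

variable {pt : Cn n × Cn n → ℂ} {x₀ : Cn n} {Φ₀ : Cn n → ℝ} {Ψ : ℝ → Cn n → Cn n → ℂ}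

lemma smoothNear_phaseDefect (S : IsSemigroupPhase pt x₀ Φ₀ Ψ) (hΦ : SmoothNear Φ₀ univ x₀) :
    SmoothNear (phaseDefect Φ₀ Ψ) (Ici (0 : ℝ) ×ˢ univ) (0, (x₀, x₀)) := by
  obtain ⟨U, hU, hs⟩ := S.smooth
  obtain ⟨V, hV, hsV⟩ := hΦ
  rw [nhdsWithin_univ] at hV
  have hV1 : {q : ℝ × (Cn n × Cn n) | q.2.1 ∈ V} ∈ 𝓝 ((0 : ℝ), (x₀, x₀)) :=
    (by fun_prop : Continuous fun q : ℝ × (Cn n × Cn n) => q.2.1).continuousAt.preimage_mem_nhds hV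
  have hV2 : {q : ℝ × (Cn n × Cn n) | q.2.2 ∈ V} ∈ 𝓝 ((0 : ℝ), (x₀, x₀)) :=
    (by fun_prop : Continuous fun q : ℝ × (Cn n × Cn n) => q.2.2).continuousAt.preimage_mem_nhds hV
  have hU' := tendsto_conjSnd_halfNhds x₀ hU
  refine ⟨_, inter_mem (inter_mem (mem_nhdsWithin_of_mem_nhds hV1)
    (mem_nhdsWithin_of_mem_nhds hV2)) hU', ?_⟩
  have hd1 : ContDiff ℝ ∞ fun q : ℝ × (Cn n × Cn n) => q.2.1 := by fun_prop
  have hd2 : ContDiff ℝ ∞ fun q : ℝ × (Cn n × Cn n) => q.2.2 := by fun_prop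
  have hd3 : ContDiff ℝ ∞ fun q : ℝ × (Cn n × Cn n) => (q.1, conjSnd n q.2) := by fun_prop
  refine ((hsV.comp hd1.contDiffOn fun q hq => hq.1.1).add
    (hsV.comp hd2.contDiffOn fun q hq => hq.1.2)).sub (contDiffOn_const.mul ?_)
  exact Complex.reCLM.contDiff.comp_contDiffOn (hs.comp hd3.contDiffOn fun q hq => hq.2)

lemma eventually_fderiv_phaseDefect (S : IsSemigroupPhase pt x₀ Φ₀ Ψ)
    (hΦ : ∀ᶠ x in 𝓝 x₀, DifferentiableAt ℝ Φ₀ x) :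
    ∀ᶠ w in 𝓝 (x₀, x₀), ∀ a, fderiv ℝ (fun w => phaseDefect Φ₀ Ψ (0, w)) w (a, 0) =
      fderiv ℝ Φ₀ w.1 a -
        2 * (fderiv ℝ (fun w : Cn n × Cn n => Ψ 0 w.1 w.2) (conjSnd n w) (a, 0)).re := by
  have h0 : Tendsto (conjSnd n) (𝓝 (x₀, x₀)) (𝓝 (x₀, conjC x₀)) := (conjSnd n).continuous.tendsto _
  filter_upwards [h0.eventually S.eventually_contDiffAt_zero, hΦ.prod_nhds hΦ] with w hs hw a
  set ψ : Cn n × Cn n → ℂ := fun w => Ψ 0 w.1 w.2 with hψ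
  have h1 := (Complex.reCLM.hasFDerivAt.comp w
    ((hs.differentiableAt (by simp)).hasFDerivAt.comp w (conjSnd n).hasFDerivAt)).const_mul 2
  have h2 := (hw.1.hasFDerivAt.comp w (hasFDerivAt_fst (𝕜 := ℝ) (p := w))).add
    (hw.2.hasFDerivAt.comp w (hasFDerivAt_snd (𝕜 := ℝ) (p := w)))
  have h3 : HasFDerivAt (fun w => phaseDefect Φ₀ Ψ (0, w)) _ w := h2.sub h1
  rw [h3.fderiv]
  have e1 : conjC (0 : Cn n) = 0 := (conjCL n).map_zero
  simp [e1]

/-- At `t = 0` the phase defect is critical in `x` on the diagonal. -/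
lemma eventually_fderiv_phaseDefect_diag (S : IsSemigroupPhase pt x₀ Φ₀ Ψ)
    (hΦ : ContDiffAt ℝ 2 Φ₀ x₀) :
    ∀ᶠ x in 𝓝 x₀, ∀ a, fderiv ℝ (fun w => phaseDefect Φ₀ Ψ (0, w)) (x, x) (a, 0) = 0 := by
  have hd : ∀ᶠ x in 𝓝 x₀, DifferentiableAt ℝ Φ₀ x :=
    (hΦ.eventually (by simp)).mono fun x hx => hx.differentiableAt (by norm_num)
  have h0 : Tendsto (fun x : Cn n => (x, x)) (𝓝 x₀) (𝓝 (x₀, x₀)) :=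
    (continuous_id.prodMk continuous_id).tendsto _
  filter_upwards [h0.eventually (S.eventually_fderiv_phaseDefect hd),
    S.eventually_fderiv_weight] with x h1 h2 a
  rw [h1, h2]
  simp

/-- At `t = 0` the exponent of the kernel is at least `c |x - y|²`. -/
lemma exists_phaseDefect_zero_ge (S : IsSemigroupPhase pt x₀ Φ₀ Ψ) (hΦ : SmoothNear Φ₀ univ x₀)
    {c : ℝ} (hc : 0 < c) (hlevi : ∀ v : Cn n, c * ‖v‖ ^ 2 ≤ fderiv ℝ (fderiv ℝ Φ₀) x₀ v v +
      fderiv ℝ (fderiv ℝ Φ₀) x₀ (Complex.I • v) (Complex.I • v)) :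
    ∃ c' > 0, ∀ᶠ w in 𝓝 (x₀, x₀), c' * ‖w.1 - w.2‖ ^ 2 ≤ phaseDefect Φ₀ Ψ (0, w) := by
  set ψ : Cn n × Cn n → ℂ := fun w => Ψ 0 w.1 w.2 with hψ
  set D : Cn n × Cn n → ℝ := fun w => phaseDefect Φ₀ Ψ (0, w) with hD
  have hΦ2 : ContDiffAt ℝ 2 Φ₀ x₀ :=
    hΦ.eventually_contDiffAt.self_of_nhds.of_le two_le_infty
  have hDs : ∀ᶠ w in 𝓝 (x₀, x₀), ContDiffAt ℝ 2 D w := by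
    have h0 : Tendsto (fun w : Cn n × Cn n => ((0 : ℝ), w)) (𝓝 (x₀, x₀))
      (𝓝 (0, (x₀, x₀))) := (Continuous.prodMk_right (0 : ℝ)).tendsto _
    filter_upwards [h0.eventually (S.smoothNear_phaseDefect hΦ).eventually_contDiffAt_sq] with w hw
    have h3 := ContDiffAt.comp (f := fun w : Cn n × Cn n => ((0 : ℝ), w))
      (g := fun q : ℝ × (Cn n × Cn n) => phaseDefect Φ₀ Ψ (q.1 ^ 2, q.2)) w
      (hw.of_le two_le_infty) (by fun_prop)
    refine h3.congr_of_eventuallyEq (Eventually.of_forall fun x => ?_)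
    simp [hD]
  have hψ2 : ContDiffAt ℝ 2 ψ (x₀, conjC x₀) :=
    S.eventually_contDiffAt_zero.self_of_nhds.of_le two_le_infty
  have hψd : DifferentiableAt ℝ (fderiv ℝ ψ) (x₀, conjC x₀) :=
    (hψ2.fderiv_right (m := 1) (by norm_num)).differentiableAt (by norm_num)
  have hΦd : DifferentiableAt ℝ (fderiv ℝ Φ₀) x₀ :=
    (hΦ2.fderiv_right (m := 1) (by norm_num)).differentiableAt (by norm_num)
  set B := fderiv ℝ (fderiv ℝ ψ) (x₀, conjC x₀) with hB
  have hB1 : ∀ u v, B u (Complex.I • v) = Complex.I * B u v := S.hessian_I_smul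
  have hBs : ∀ u v, B u v = B v u := fun u v => hψ2.isSymmSndFDerivAt (by simp) u v
  -- the Hessian of the weight in terms of that of the phase
  have hΦB : ∀ a, fderiv ℝ (fderiv ℝ Φ₀) x₀ a a =
      2 * (B (a, 0) (a, 0)).re + 2 * (B (0, conjC a) (a, 0)).re := by
    intro a
    rw [fderiv_fderiv_apply hΦ2]
    have h1 : (fun x => fderiv ℝ Φ₀ x a) =ᶠ[𝓝 x₀]
        fun x => 2 * (fderiv ℝ ψ (x, conjC x) (a, 0)).re :=
      S.eventually_fderiv_weight.mono fun x hx => hx a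
    have h2 : HasFDerivAt (fun x => fderiv ℝ ψ (x, conjC x)) _ x₀ :=
      hψd.hasFDerivAt.comp (f := fun x => (x, conjC x)) x₀
        ((hasFDerivAt_id x₀).prodMk (conjCL n).hasFDerivAt)
    have h3 := (Complex.reCLM.hasFDerivAt.comp x₀
      (h2.clm_apply (hasFDerivAt_const ((a, 0) : Cn n × Cn n) x₀))).const_mul 2
    have h4 : HasFDerivAt (fun x => 2 * (fderiv ℝ ψ (x, conjC x) (a, 0)).re) _ x₀ := h3
    rw [h1.fderiv_eq, h4.fderiv]
    have h5 : B (a, conjC a) = B (a, 0) + B (0, conjC a) := by rw [← map_add]; simp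
    simp [← hB, h5]
    ring
  have hDB : ∀ a, fderiv ℝ (fderiv ℝ D) (x₀, x₀) (a, 0) (a, 0) =
      fderiv ℝ (fderiv ℝ Φ₀) x₀ a a - 2 * (B (a, 0) (a, 0)).re := by
    intro a
    rw [fderiv_fderiv_apply hDs.self_of_nhds]
    have h1 : (fun w => fderiv ℝ D w (a, 0)) =ᶠ[𝓝 (x₀, x₀)]
        fun w => fderiv ℝ Φ₀ w.1 a - 2 * (fderiv ℝ ψ (conjSnd n w) (a, 0)).re :=
      (S.eventually_fderiv_phaseDefect (hΦ.eventually_contDiffAt.mono fun x hx =>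
        hx.differentiableAt (by simp))).mono fun w hw => hw a
    have h2 : HasFDerivAt (fun w => fderiv ℝ ψ (conjSnd n w)) _ (x₀, x₀) :=
      HasFDerivAt.comp (g := fderiv ℝ ψ) (x₀, x₀) hψd.hasFDerivAt (conjSnd n).hasFDerivAt
    have h3 := (Complex.reCLM.hasFDerivAt.comp (x₀, x₀)
      (h2.clm_apply (hasFDerivAt_const ((a, 0) : Cn n × Cn n) (x₀, x₀)))).const_mul 2
    have h4 : HasFDerivAt (fun w : Cn n × Cn n => fderiv ℝ Φ₀ w.1) _ (x₀, x₀) :=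
      HasFDerivAt.comp (g := fderiv ℝ Φ₀) (x₀, x₀) hΦd.hasFDerivAt
        (hasFDerivAt_fst (𝕜 := ℝ) (p := (x₀, x₀)))
    have h5 : HasFDerivAt
        (fun w => fderiv ℝ Φ₀ w.1 a - 2 * (fderiv ℝ ψ (conjSnd n w) (a, 0)).re) _ (x₀, x₀) :=
      (h4.clm_apply (hasFDerivAt_const a (x₀, x₀))).sub h3
    rw [h1.fderiv_eq, h5.fderiv]
    have e1 : conjC (0 : Cn n) = 0 := (conjCL n).map_zero
    simp [← hB, e1]
  -- averaging over `a` and `i a` cancels the pluriharmonic part `B (a, 0) (a, 0)` and leaves the Levi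
  -- form of the weight
  have hq : ∀ a, c / 2 * ‖a‖ ^ 2 ≤ fderiv ℝ (fderiv ℝ D) (x₀, x₀) (a, 0) (a, 0) := by
    intro a
    have h1 := hΦB a
    have h2 := hΦB (Complex.I • a)
    have e1 : ((Complex.I • a, 0) : Cn n × Cn n) = Complex.I • (a, 0) := by simp
    have e2 : ((0, -(Complex.I • conjC a)) : Cn n × Cn n) = -(Complex.I • (0, conjC a)) := by simp
    have e3 : B (Complex.I • (a, 0)) (Complex.I • (a, 0)) = -B (a, 0) (a, 0) := by
      rw [hB1, hBs, hB1, ← mul_assoc, Complex.I_mul_I]; ring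
    have e4 : B (-(Complex.I • (0, conjC a))) (Complex.I • (a, 0)) = B (0, conjC a) (a, 0) := by
      rw [hB1, hBs, map_neg, hB1, hBs]
      linear_combination -B (0, conjC a) (a, 0) * Complex.I_sq
    rw [conjC_I_smul, e1, e2, e3, e4, Complex.neg_re] at h2
    have h3 := hlevi a
    rw [hDB]
    linarith
  have hco := eventually_coercive (tendsto_hessian hDs.self_of_nhds)
    (fun v : Cn n => ((v, 0) : Cn n × Cn n)) (κ := 1) (half_pos hc) one_pos (fun v => by simp) hq
  obtain ⟨r, hr, hb⟩ := Metric.eventually_nhds_iff_ball.1 (hDs.and hco)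
  refine ⟨c / 2 / 2 / 2, by positivity, ?_⟩
  have h0 : Tendsto (fun w : Cn n × Cn n => w.2) (𝓝 (x₀, x₀)) (𝓝 x₀) := continuous_snd.tendsto _
  filter_upwards [Metric.ball_mem_nhds (x₀, x₀) hr,
    h0.eventually (S.eventually_fderiv_phaseDefect_diag hΦ2),
    h0.eventually S.initial] with w hw hdiag hinit
  have hw' := hw
  rw [← ball_prod_same] at hw'
  have hyy : (w.2, w.2) ∈ Metric.ball (x₀, x₀) r := by rw [← ball_prod_same]; exact ⟨hw'.2, hw'.2⟩
  have hseg : segment ℝ (w.2, w.2) w ⊆ Metric.ball (x₀, x₀) r :=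
    (convex_ball _ _).segment_subset hyy hw
  have e1 : w - (w.2, w.2) = (w.1 - w.2, 0) := by ext <;> simp
  have h1 := le_of_hessian_lower_bound (f := D) (c := c / 2 / 2 * ‖w.1 - w.2‖ ^ 2)
    (fun z hz => (hb z (hseg hz)).1) (fun z hz => by rw [e1]; exact (hb z (hseg hz)).2 _)
  rw [e1, hdiag] at h1
  have h2 : D (w.2, w.2) = 0 := by
    simp only [hD, phaseDefect, hinit, Complex.ofReal_re]; ring
  rw [h2] at h1
  show _ ≤ D w
  linarith

end IsSemigroupPhase

end FBI

namespace FBI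

/-! ### The exponent of the semigroup kernel at positive times -/

variable {n : ℕ}

lemma SmoothNear.eventually_contDiffWithinAt {E F : Type*} [NormedAddCommGroup E] [NormedSpace ℝ E]
    [NormedAddCommGroup F] [NormedSpace ℝ F] {g : E → F} {s : Set E} {a : E}
    (h : SmoothNear g s a) : ∀ᶠ z in 𝓝[s] a, z ∈ s → ContDiffWithinAt ℝ ∞ g s z := by
  obtain ⟨U, hU, hg⟩ := h
  filter_upwards [eventually_eventually_nhdsWithin.2 hU] with z hz hzs
  exact (hg z (mem_of_mem_nhdsWithin hzs hz)).mono_of_mem_nhdsWithin hz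

/-- The covector of `Φ₀ - g` for `g = Φ₀ + c - 2 Re F` is that of `F`, up to `∂̄F`. -/
lemma wcov_sub_wcov {Φ₀ : Cn n → ℝ} {F : Cn n → ℂ} {x : Cn n} {c : ℝ}
    (hΦ : DifferentiableAt ℝ Φ₀ x) (hF : DifferentiableAt ℝ F x) (j : Fin n) :
    (wcov Φ₀ x - wcov (fun z => Φ₀ z + c - 2 * (F z).re) x - cov F x) j =
      2 / Complex.I * (starRingEnd ℂ) (dbar F x (Pi.single j 1)) := by
  have e1 : HasFDerivAt (fun x => (Φ₀ x : ℂ)) (Complex.ofRealCLM.comp (fderiv ℝ Φ₀ x)) x :=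
    Complex.ofRealCLM.hasFDerivAt.comp x hΦ.hasFDerivAt
  have e2 : HasFDerivAt (fun z => Φ₀ z + c - 2 * (F z).re) _ x :=
    (hΦ.hasFDerivAt.add_const c).sub
      ((Complex.reCLM.hasFDerivAt.comp x hF.hasFDerivAt).const_mul 2)
  have e3 : HasFDerivAt (fun z => ((Φ₀ z + c - 2 * (F z).re : ℝ) : ℂ)) _ x :=
    Complex.ofRealCLM.hasFDerivAt.comp x e2
  simp only [wcov, cov, pd, del, dbar, e1.fderiv, e3.fderiv, Pi.smul_apply, Pi.sub_apply,
    smul_eq_mul]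
  set a := fderiv ℝ F x (Pi.single j 1)
  set b := fderiv ℝ F x (Complex.I • Pi.single j 1)
  simp only [ContinuousLinearMap.comp_apply, sub_apply, smul_apply, Complex.ofRealCLM_apply,
    Complex.reCLM_apply, smul_eq_mul, Complex.ofReal_sub, Complex.ofReal_mul, Complex.ofReal_ofNat,
    map_div₀, map_add, map_mul, Complex.conj_I, Complex.conj_ofNat, Complex.re_eq_add_conj]
  ring

namespace IsSemigroupPhase

variable {pt : Cn n × Cn n → ℂ} {x₀ ξ₀ : Cn n} {Φ₀ : Cn n → ℝ} {Ψ : ℝ → Cn n → Cn n → ℂ}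

lemma eventually_differentiableAt (S : IsSemigroupPhase pt x₀ Φ₀ Ψ) :
    ∀ᶠ q in halfNhds (x₀, x₀),
      DifferentiableAt ℝ (fun w : Cn n × Cn n => Ψ q.1 w.1 w.2) (conjSnd n q.2) ∧
      DifferentiableWithinAt ℝ (fun s => Ψ s q.2.1 (conjC q.2.2)) (Ici 0) q.1 := by
  have h1 := (tendsto_sqrt_halfNhds (x₀, conjC x₀)).eventually S.smooth.eventually_contDiffAt_sq
  have h2 : ∀ᶠ q in halfNhds (x₀, conjC x₀), _ := S.smooth.eventually_contDiffWithinAt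
  have h3 : ∀ᶠ q in halfNhds (x₀, x₀), q.1 ∈ Icc (0 : ℝ) 1 :=
    eventually_halfNhds_iff.2 ⟨1, one_pos, fun t ht _ _ => ht⟩
  filter_upwards [(tendsto_conjSnd_halfNhds x₀).eventually (h1.and h2), h3] with q hq ht
  constructor
  · have h4 := DifferentiableAt.comp (f := fun w : Cn n × Cn n => (√q.1, w))
      (g := fun q : ℝ × (Cn n × Cn n) => Ψ (q.1 ^ 2) q.2.1 q.2.2) (conjSnd n q.2)
      (hq.1.differentiableAt (by simp)) (by fun_prop)
    refine h4.congr_of_eventuallyEq (Eventually.of_forall fun w => ?_)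
    simp [Real.sq_sqrt ht.1]
  · have h4 : DifferentiableWithinAt ℝ (fun q : ℝ × (Cn n × Cn n) => Ψ q.1 q.2.1 q.2.2)
        (Ici (0 : ℝ) ×ˢ univ) (q.1, conjSnd n q.2) :=
      (hq.2 ⟨ht.1, mem_univ _⟩).differentiableWithinAt (by simp)
    exact DifferentiableWithinAt.comp (g := fun q : ℝ × (Cn n × Cn n) => Ψ q.1 q.2.1 q.2.2)
      (f := fun s : ℝ => (s, conjSnd n q.2)) q.1 h4 (by fun_prop)
      fun s hs => ⟨hs, mem_univ _⟩

/-- The covector of the phase defect tends to zero at the base point, so that the covectors entering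
the defect equation stay where the symbol is Lipschitz. -/
lemma tendsto_wcov_phaseDefect (S : IsSemigroupPhase pt x₀ Φ₀ Ψ) (hΦ : SmoothNear Φ₀ univ x₀) :
    Tendsto (fun q : ℝ × (Cn n × Cn n) => wcov (fun z => phaseDefect Φ₀ Ψ (q.1, (z, q.2.2))) q.2.1)
      (halfNhds (x₀, x₀)) (𝓝 0) := by
  set G : ℝ × (Cn n × Cn n) → ℝ := fun q => phaseDefect Φ₀ Ψ (q.1 ^ 2, q.2) with hG
  have hGs := (S.smoothNear_phaseDefect hΦ).eventually_contDiffAt_sq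
  have hG0 : ContDiffAt ℝ 1 G (0, (x₀, x₀)) := hGs.self_of_nhds.of_le (by simp)
  set J : Cn n →L[ℝ] ℝ × (Cn n × Cn n) :=
    (ContinuousLinearMap.inr ℝ ℝ (Cn n × Cn n)).comp (ContinuousLinearMap.inl ℝ (Cn n) (Cn n))
    with hJ
  have hd : ∀ τ z y, DifferentiableAt ℝ G (τ, (z, y)) →
      HasFDerivAt (fun z => G (τ, (z, y))) ((fderiv ℝ G (τ, (z, y))).comp J) z := by
    intro τ z y h1
    have h2 : HasFDerivAt (fun z : Cn n => (τ, (z, y))) J z :=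
      (hasFDerivAt_prodMk_right τ (z, y)).comp (f := fun z : Cn n => (z, y)) z
        (hasFDerivAt_prodMk_left z y)
    exact h1.hasFDerivAt.comp (f := fun z : Cn n => (τ, (z, y))) z h2
  have h0 : (fderiv ℝ G (0, (x₀, x₀))).comp J = 0 := by
    have h1 : HasFDerivAt (fun w => G (0, w))
        ((fderiv ℝ G (0, (x₀, x₀))).comp (ContinuousLinearMap.inr ℝ ℝ (Cn n × Cn n))) (x₀, x₀) :=
      (hG0.differentiableAt (by norm_num)).hasFDerivAt.comp (f := fun w : Cn n × Cn n => ((0 : ℝ), w))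
        (x₀, x₀) (hasFDerivAt_prodMk_right 0 (x₀, x₀))
    have h2 : (fun w => G (0, w)) = fun w => phaseDefect Φ₀ Ψ (0, w) := by ext w; simp [hG]
    rw [h2] at h1
    ext a
    have h3 := (S.eventually_fderiv_phaseDefect_diag
      (hΦ.eventually_contDiffAt.self_of_nhds.of_le two_le_infty)).self_of_nhds a
    rw [h1.fderiv] at h3
    exact h3
  have hc : ContinuousAt (fun q => (fderiv ℝ G q).comp J) (0, (x₀, x₀)) :=
    (hG0.fderiv_right (m := 0) (by norm_num)).continuousAt.clm_comp continuousAt_const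
  have hc1 := (hc.tendsto.comp (tendsto_sqrt_halfNhds (x₀, x₀))).norm.const_mul 2
  rw [h0, norm_zero, mul_zero] at hc1
  refine squeeze_zero_norm' ?_ hc1
  have h3 : ∀ᶠ q in halfNhds (x₀, x₀), q.1 ∈ Icc (0 : ℝ) 1 :=
    eventually_halfNhds_iff.2 ⟨1, one_pos, fun t ht _ _ => ht⟩
  filter_upwards [(tendsto_sqrt_halfNhds (x₀, x₀)).eventually hGs, h3] with q hq ht
  have h4 := hd (√q.1) q.2.1 q.2.2 (hq.differentiableAt (by simp))
  have h5 : (fun z => G (√q.1, (z, q.2.2))) = fun z => phaseDefect Φ₀ Ψ (q.1, (z, q.2.2)) := by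
    ext z; simp [hG, Real.sq_sqrt ht.1]
  rw [h5] at h4
  refine (IsDefect.norm_wcov_le h4.differentiableAt).trans ?_
  rw [h4.fderiv]
  rfl

/-- The exponent of the kernel satisfies the defect equation. -/
lemma exists_phaseDefect_eqn (S : IsSemigroupPhase pt x₀ Φ₀ Ψ) (hΦ : SmoothNear Φ₀ univ x₀)
    (hξ : wcov Φ₀ x₀ = ξ₀) (hpt : ContDiffAt ℝ 1 pt (x₀, ξ₀)) {N : ℕ} (hN : N ≠ 0) :
    ∃ K, ∀ᶠ q in halfNhds (x₀, x₀),
      |derivWithin (fun s => phaseDefect Φ₀ Ψ (s, q.2)) (Ici 0) q.1 -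
        (pt (q.2.1, wcov Φ₀ q.2.1 -
          wcov (fun z => phaseDefect Φ₀ Ψ (q.1, (z, q.2.2))) q.2.1)).re| ≤
        K * (√q.1 + ‖q.2.1 - q.2.2‖) ^ N := by
  obtain ⟨C₁, hC₁, heik⟩ := S.eikonal.exists_bound N
  choose C hC hbar using fun j : Fin n =>
    (S.almostHolo ((Pi.single j 1, 0) : Cn n × Cn n)).exists_bound N
  -- a `∂̄`-error in the covector enters the equation through the Lipschitz constant of the symbol
  obtain ⟨L, T, hT, hL⟩ := hpt.exists_lipschitzOnWith
  set C₂ := 2 * ∑ j, C j with hC₂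
  have hC₂0 : 0 ≤ C₂ := mul_nonneg zero_le_two (Finset.sum_nonneg fun j _ => (hC j).le)
  set A : ℝ × (Cn n × Cn n) → Cn n := fun q => cov (fun x => Ψ q.1 x (conjC q.2.2)) q.2.1 with hA
  set B : ℝ × (Cn n × Cn n) → Cn n := fun q => wcov Φ₀ q.2.1 -
    wcov (fun z => phaseDefect Φ₀ Ψ (q.1, (z, q.2.2))) q.2.1 with hB
  have hfst : Tendsto (fun q : ℝ × (Cn n × Cn n) => q.2.1) (halfNhds (x₀, x₀)) (𝓝 x₀) :=
    Tendsto.mono_left ((by fun_prop : Continuous fun q : ℝ × (Cn n × Cn n) => q.2.1).tendsto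
      (0, (x₀, x₀))) nhdsWithin_le_nhds
  have hΦd : ∀ᶠ x in 𝓝 x₀, DifferentiableAt ℝ Φ₀ x :=
    hΦ.eventually_contDiffAt.mono fun x hx => hx.differentiableAt (by simp)
  have hAB : ∀ᶠ q in halfNhds (x₀, x₀), ‖B q - A q‖ ≤ C₂ * (√q.1 + ‖q.2.1 - q.2.2‖) ^ N := by
    filter_upwards [eventually_all.2 hbar, S.eventually_differentiableAt, hfst.eventually hΦd]
      with q hq hd hΦq
    refine (pi_norm_le_iff_of_nonneg (by positivity)).2 fun j => ?_
    have h1 : HasFDerivAt (fun x => Ψ q.1 x (conjC q.2.2)) _ q.2.1 :=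
      hd.1.hasFDerivAt.comp (f := fun x : Cn n => (x, conjC q.2.2)) q.2.1
        (hasFDerivAt_prodMk_left q.2.1 (conjC q.2.2))
    have h2 := wcov_sub_wcov (c := Φ₀ q.2.2) hΦq h1.differentiableAt j
    have h3 : dbar (fun x => Ψ q.1 x (conjC q.2.2)) q.2.1 (Pi.single j 1) =
        dbar (fun z : Cn n × Cn n => Ψ q.1 z.1 z.2) (conjSnd n q.2) (Pi.single j 1, 0) := by
      simp only [dbar, h1.fderiv]
      simp
    have h4 : ‖(B q - A q) j‖ = 2 *
        ‖dbar (fun z : Cn n × Cn n => Ψ q.1 z.1 z.2) (conjSnd n q.2) (Pi.single j 1, 0)‖ := by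
      rw [← h3]
      show ‖(wcov Φ₀ q.2.1 - wcov (fun z => Φ₀ z + Φ₀ q.2.2 - 2 * (Ψ q.1 z (conjC q.2.2)).re) q.2.1 -
        cov (fun x => Ψ q.1 x (conjC q.2.2)) q.2.1) j‖ = _
      rw [h2, norm_mul, RCLike.norm_conj, norm_div, Complex.norm_I, Complex.norm_ofNat, div_one]
    rw [h4, hC₂, mul_assoc]
    gcongr
    refine (hq j).trans ?_
    gcongr
    exact Finset.single_le_sum (fun j _ => (hC j).le) (Finset.mem_univ j)
  have hlam : Tendsto (fun q : ℝ × (Cn n × Cn n) => C₂ * (√q.1 + ‖q.2.1 - q.2.2‖) ^ N)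
      (halfNhds (x₀, x₀)) (𝓝 0) := by
    have h1 := (by fun_prop : Continuous fun q : ℝ × (Cn n × Cn n) =>
      C₂ * (√q.1 + ‖q.2.1 - q.2.2‖) ^ N).tendsto (0, (x₀, x₀))
    simp only [Real.sqrt_zero, sub_self, norm_zero, add_zero, zero_pow hN, mul_zero] at h1
    exact h1.mono_left nhdsWithin_le_nhds
  have hBt : Tendsto B (halfNhds (x₀, x₀)) (𝓝 ξ₀) := by
    have h1 : ContinuousAt (wcov Φ₀) x₀ :=
      continuousAt_wcov (hΦ.eventually_contDiffAt.self_of_nhds.of_le (by simp))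
    have h2 := (h1.tendsto.comp hfst).sub (S.tendsto_wcov_phaseDefect hΦ)
    rw [hξ, sub_zero] at h2
    exact h2
  have hAt : Tendsto A (halfNhds (x₀, x₀)) (𝓝 ξ₀) := by
    have h1 := hBt.sub (squeeze_zero_norm' hAB hlam)
    simpa using h1
  refine ⟨C₁ + L * C₂, ?_⟩
  have hIcc : ∀ᶠ q in halfNhds (x₀, x₀), q.1 ∈ Icc (0 : ℝ) 1 :=
    eventually_halfNhds_iff.2 ⟨1, one_pos, fun t ht _ _ => ht⟩
  filter_upwards [hAB, heik, S.eventually_differentiableAt,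
    (hfst.prodMk_nhds hAt).eventually hT, (hfst.prodMk_nhds hBt).eventually hT, hIcc]
    with q h1 h2 h3 h4 h5 ht
  have h6 : derivWithin (fun s => phaseDefect Φ₀ Ψ (s, q.2)) (Ici 0) q.1 =
      -(2 * derivWithin (fun s => Ψ s q.2.1 (conjC q.2.2)) (Ici 0) q.1).re := by
    have g1 := Complex.reCLM.hasFDerivAt.comp_hasDerivWithinAt q.1 h3.2.hasDerivWithinAt
    have g2 : HasDerivWithinAt (fun s => phaseDefect Φ₀ Ψ (s, q.2)) _ (Ici 0) q.1 :=
      (g1.const_mul 2).const_sub (Φ₀ q.2.1 + Φ₀ q.2.2)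
    rw [g2.derivWithin (uniqueDiffOn_Ici 0 q.1 ht.1)]
    simp
  have h7 : ‖pt (q.2.1, A q) - pt (q.2.1, B q)‖ ≤ L * ‖B q - A q‖ := by
    have g1 := hL.dist_le_mul _ h4 _ h5
    rw [dist_eq_norm, dist_eq_norm, Prod.mk_sub_mk, sub_self, Prod.norm_mk, norm_zero,
      max_eq_right (norm_nonneg _), norm_sub_rev (A q)] at g1
    exact g1
  have h8 : ‖2 * derivWithin (fun s => Ψ s q.2.1 (conjC q.2.2)) (Ici 0) q.1 + pt (q.2.1, B q)‖ ≤
      C₁ * (√q.1 + ‖q.2.1 - q.2.2‖) ^ N + L * (C₂ * (√q.1 + ‖q.2.1 - q.2.2‖) ^ N) := by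
    have e : 2 * derivWithin (fun s => Ψ s q.2.1 (conjC q.2.2)) (Ici 0) q.1 + pt (q.2.1, B q) =
        (2 * derivWithin (fun s => Ψ s q.2.1 (conjC q.2.2)) (Ici 0) q.1 + pt (q.2.1, A q)) -
          (pt (q.2.1, A q) - pt (q.2.1, B q)) := by ring
    rw [e]
    refine (norm_sub_le _ _).trans (add_le_add h2 (h7.trans ?_))
    gcongr
  rw [h6, ← neg_add', abs_neg, ← Complex.add_re, add_mul, mul_assoc (L : ℝ)]
  exact (Complex.abs_re_le_norm _).trans h8

/-- Lower bound for the exponent of the kernel of the semigroup. -/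
theorem exists_phaseDefect_ge (S : IsSemigroupPhase pt x₀ Φ₀ Ψ) (hΦ : SmoothNear Φ₀ univ x₀)
    (hξ : wcov Φ₀ x₀ = ξ₀) (hpt : ContDiffAt ℝ 1 pt (x₀, ξ₀)) {k : ℕ}
    (hF : HasFootpoints Φ₀ pt x₀ k) {c₁ : ℝ} (hc₁ : 0 < c₁)
    (hinit : ∀ᶠ w in 𝓝 (x₀, x₀), c₁ * ‖w.1 - w.2‖ ^ 2 ≤ phaseDefect Φ₀ Ψ (0, w)) :
    ∃ ρ > 0, ∃ c > 0, ∃ C > 0, ∃ Z : ℝ → Cn n → Cn n, ∀ t ∈ Icc 0 ρ,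
      (∀ x ∈ Metric.ball x₀ ρ, ∀ x' ∈ Metric.ball x₀ ρ, ‖x - x'‖ ≤ C * ‖Z t x - Z t x'‖) ∧
      (∀ x ∈ Metric.ball x₀ ρ, ‖Z t x - x‖ ≤ C * t) ∧
      ∀ x ∈ Metric.ball x₀ ρ, ∀ y ∈ Metric.ball x₀ ρ,
        c * (t ^ (k + 1) + ‖Z t x - y‖ ^ 2) ≤ phaseDefect Φ₀ Ψ (t, (x, y)) := by
  obtain ⟨r₀, hr₀, C₀, hC₀, Z, hZ, hF⟩ := hF
  obtain ⟨K₀, heqn⟩ := S.exists_phaseDefect_eqn hΦ hξ hpt (N := 2 * (k + 2)) (by omega)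
  have hdiag : ∀ᶠ x in 𝓝 x₀, fderiv ℝ (fun z => phaseDefect Φ₀ Ψ (0, (z, x))) x = 0 := by
    have h1 : Tendsto (fun x : Cn n => (x, x)) (𝓝 x₀) (𝓝 (x₀, x₀)) :=
      (continuous_id.prodMk continuous_id).tendsto _
    have h2 : ∀ᶠ w in 𝓝 (x₀, x₀),
        DifferentiableAt ℝ (fun w => phaseDefect Φ₀ Ψ (0, w)) w := by
      have h0 : Tendsto (fun w : Cn n × Cn n => ((0 : ℝ), w)) (𝓝 (x₀, x₀))
        (𝓝 (0, (x₀, x₀))) := (Continuous.prodMk_right (0 : ℝ)).tendsto _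
      filter_upwards [h0.eventually (S.smoothNear_phaseDefect hΦ).eventually_contDiffAt_sq]
        with w hw
      have h3 := DifferentiableAt.comp (f := fun w : Cn n × Cn n => ((0 : ℝ), w))
        (g := fun q : ℝ × (Cn n × Cn n) => phaseDefect Φ₀ Ψ (q.1 ^ 2, q.2)) w
        (hw.differentiableAt (by simp)) (by fun_prop)
      refine h3.congr_of_eventuallyEq (Eventually.of_forall fun x => ?_)
      simp
    filter_upwards [S.eventually_fderiv_phaseDefect_diag
      (hΦ.eventually_contDiffAt.self_of_nhds.of_le two_le_infty), h1.eventually h2] with x hx hd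
    have h3 : HasFDerivAt (fun z => phaseDefect Φ₀ Ψ (0, (z, x))) _ x :=
      hd.hasFDerivAt.comp (f := fun z : Cn n => (z, x)) x (hasFDerivAt_prodMk_left x x)
    rw [h3.fderiv]
    ext a
    exact hx a
  obtain ⟨r, hr, K, hK, hD⟩ := exists_isDefect (Φ₀ := Φ₀) (pt := pt) (S.smoothNear_phaseDefect hΦ)
    hdiag (hinit.mono fun w hw => le_trans (by positivity) hw) heqn
  obtain ⟨R, hR, hinit⟩ := Metric.eventually_nhds_iff_ball.1 hinit
  -- the foot points are only needed in a ball on which the initial bound holds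
  have hD' : ∀ y ∈ Metric.ball x₀ r, IsDefect Φ₀ pt x₀ (min r R) K (2 * (k + 2)) y
      (fun s z => phaseDefect Φ₀ Ψ (s, (z, y))) := fun y hy =>
    (hD y hy).mono (min_le_left _ _)
  obtain ⟨ρ₁, hρ₁, c, hc, C, hC, hb⟩ := hF (min r R) (by positivity) K hK (2 * (k + 2))
  set c₂ := c * min 1 c₁ with hc₂
  have hc₂0 : 0 < c₂ := by positivity
  -- with `N = 2 (k + 2)` the error is at most `A (t ^ (k + 2) + ‖Z t x - y‖ ^ N)`, which is absorbed by
  -- half of the lower bound when `t` and `‖Z t x - y‖` are small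
  set A := C * 2 ^ (2 * (k + 2) - 1) * (1 + C) ^ (2 * (k + 2)) with hA
  have hA0 : 0 < A := by positivity
  obtain ⟨ρ₂, hρ₂, habs⟩ := pow_absorb (half_pos hc₂0) hA0
  set σ := min 1 ρ₂ with hσ
  have hσ0 : 0 < σ := by positivity
  set ρ := min (min (min r₀ ρ₁) (min r R)) (σ / (C + 2)) with hρ
  have hρ0 : 0 < ρ := by positivity
  have hρr₀ : ρ ≤ r₀ := (min_le_left _ _).trans ((min_le_left _ _).trans (min_le_left _ _))
  have hρρ₁ : ρ ≤ ρ₁ := (min_le_left _ _).trans ((min_le_left _ _).trans (min_le_right _ _))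
  have hρr : ρ ≤ r := (min_le_left _ _).trans ((min_le_right _ _).trans (min_le_left _ _))
  have hρR : ρ ≤ R := (min_le_left _ _).trans ((min_le_right _ _).trans (min_le_right _ _))
  have hρσ : ρ * (C + 2) ≤ σ := by
    have : ρ ≤ σ / (C + 2) := min_le_right _ _
    rwa [le_div_iff₀ (by positivity)] at this
  have hρσ' : ρ ≤ σ := by nlinarith
  refine ⟨ρ, hρ0, c₂ / 2, by positivity, max C₀ C, by positivity, Z, fun t ht =>
    ⟨fun x hx x' hx' => ?_, fun x hx => ?_, fun x hx y hy => ?_⟩⟩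
  · refine (hZ t ⟨ht.1, ht.2.trans hρr₀⟩ x (Metric.ball_subset_ball hρr₀ hx) x'
      (Metric.ball_subset_ball hρr₀ hx')).trans ?_
    gcongr
    exact le_max_left _ _
  · refine (hb x₀ (Metric.mem_ball_self hρ₁) _ (hD' x₀ (Metric.mem_ball_self hr)) t
      ⟨ht.1, ht.2.trans hρρ₁⟩ x (Metric.ball_subset_ball hρρ₁ hx)).1.trans ?_
    exact mul_le_mul_of_nonneg_right (le_max_right _ _) ht.1
  · obtain ⟨h1, h2, h3⟩ := hb y (Metric.ball_subset_ball hρρ₁ hy) _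
      (hD' y (Metric.ball_subset_ball hρr hy)) t ⟨ht.1, ht.2.trans hρρ₁⟩ x
      (Metric.ball_subset_ball hρρ₁ hx)
    set z := Z t x with hz
    have h4 : c₁ * ‖z - y‖ ^ 2 ≤ phaseDefect Φ₀ Ψ (0, (z, y)) := hinit (z, y) (by
      rw [← ball_prod_same]
      exact ⟨Metric.ball_subset_ball (min_le_right _ _) h2, Metric.ball_subset_ball hρR hy⟩)
    have ht1 : t ≤ 1 := ht.2.trans (hρσ'.trans (min_le_left _ _))
    have htρ₂ : t ≤ ρ₂ := ht.2.trans (hρσ'.trans (min_le_right _ _))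
    have hts := le_sqrt_self ht.1 ht1
    have hzy : ‖z - y‖ ≤ σ := by
      rw [mem_ball_iff_norm] at hx hy
      have e : z - y = (z - x) + ((x - x₀) - (y - x₀)) := by abel
      have g1 := norm_add_le (z - x) ((x - x₀) - (y - x₀))
      have g2 := norm_sub_le (x - x₀) (y - x₀)
      have g3 : C * t ≤ C * ρ := by gcongr; exact ht.2
      rw [e]
      linarith
    have hlam : √t + ‖x - y‖ ≤ (1 + C) * (√t + ‖z - y‖) := by
      have e : x - y = (z - y) - (z - x) := by abel
      have g1 := norm_sub_le (z - y) (z - x)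
      have g3 : C * t ≤ C * √t := by gcongr
      have g4 : 0 ≤ C * ‖z - y‖ := by positivity
      rw [e]
      linarith
    have h5 : (√t + ‖x - y‖) ^ (2 * (k + 2)) ≤ (1 + C) ^ (2 * (k + 2)) *
        (2 ^ (2 * (k + 2) - 1) * (t ^ (k + 2) + ‖z - y‖ ^ (2 * (k + 2)))) := by
      calc _ ≤ ((1 + C) * (√t + ‖z - y‖)) ^ (2 * (k + 2)) := by gcongr
        _ = (1 + C) ^ (2 * (k + 2)) * (√t + ‖z - y‖) ^ (2 * (k + 2)) := mul_pow _ _ _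
        _ ≤ _ := by
          gcongr
          have := add_pow_le (Real.sqrt_nonneg t) (norm_nonneg (z - y)) (2 * (k + 2))
          rwa [sqrt_pow_two_mul ht.1] at this
    have h6 : C * (√t + ‖x - y‖) ^ (2 * (k + 2)) ≤
        A * (t ^ (k + 2) + ‖z - y‖ ^ (2 * (k + 2))) := by
      calc _ ≤ C * _ := mul_le_mul_of_nonneg_left h5 hC.le
        _ = _ := by rw [hA]; ring
    have h7 : A * t ^ (k + 2) ≤ c₂ / 2 * t ^ (k + 1) := by
      rw [pow_succ' t (k + 1), ← mul_assoc]
      exact mul_le_mul_of_nonneg_right (habs t ⟨ht.1, htρ₂⟩) (pow_nonneg ht.1 _)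
    have h8 : A * ‖z - y‖ ^ (2 * (k + 2)) ≤ c₂ / 2 * ‖z - y‖ ^ 2 := by
      have g1 : ‖z - y‖ ^ (2 * (k + 2)) = ‖z - y‖ * (‖z - y‖ ^ (2 * k + 1)) * ‖z - y‖ ^ 2 := by ring
      have g2 : ‖z - y‖ ^ (2 * k + 1) ≤ 1 :=
        pow_le_one₀ (norm_nonneg _) (hzy.trans (min_le_left _ _))
      have g3 := habs ‖z - y‖ ⟨norm_nonneg _, hzy.trans (min_le_right _ _)⟩
      rw [g1, ← mul_assoc, ← mul_assoc]
      gcongr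
      calc A * ‖z - y‖ * ‖z - y‖ ^ (2 * k + 1) ≤ A * ‖z - y‖ * 1 := by gcongr
        _ ≤ _ := by rwa [mul_one]
    have ht0 : 0 ≤ t ^ (k + 1) := pow_nonneg ht.1 _
    have h9 : min 1 c₁ * (t ^ (k + 1) + ‖z - y‖ ^ 2) ≤
        t ^ (k + 1) + phaseDefect Φ₀ Ψ (0, (z, y)) := by
      have g1 : min 1 c₁ * t ^ (k + 1) ≤ 1 * t ^ (k + 1) := by gcongr; exact min_le_left _ _
      have g2 : min 1 c₁ * ‖z - y‖ ^ 2 ≤ c₁ * ‖z - y‖ ^ 2 := by gcongr; exact min_le_right _ _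
      linarith
    have h10 : c₂ * (t ^ (k + 1) + ‖z - y‖ ^ 2) ≤
        c * (t ^ (k + 1) + phaseDefect Φ₀ Ψ (0, (z, y))) := by
      rw [hc₂, mul_assoc]
      gcongr
    have h11 : c * (t ^ (k + 1) + phaseDefect Φ₀ Ψ (0, (z, y))) ≤ phaseDefect Φ₀ Ψ (t, (x, y)) +
      C * (√t + ‖x - y‖) ^ (2 * (k + 2)) := h3
    linarith

end IsSemigroupPhase

end FBI

namespace FBI

/-! ### Schur's test and Gaussian integrals -/

variable {n : ℕ}

section Schur

open scoped ENNReal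

variable {X Y : Type*} [MeasurableSpace X] [MeasurableSpace Y] {μ : Measure X} {ν : Measure Y}

/-- The Cauchy-Schwarz inequality for the weight `k`. -/
lemma sq_lintegral_mul_le {k f : Y → ℝ≥0∞} (hk : AEMeasurable k ν) (hf : AEMeasurable f ν) :
    (∫⁻ y, k y * f y ∂ν) ^ 2 ≤ (∫⁻ y, k y ∂ν) * ∫⁻ y, k y * f y ^ 2 ∂ν := by
  have h := ENNReal.lintegral_mul_le_Lp_mul_Lq ν Real.HolderConjugate.two_two
    (f := fun y => k y ^ (1 / 2 : ℝ)) (g := fun y => k y ^ (1 / 2 : ℝ) * f y)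
    (hk.pow_const _) ((hk.pow_const _).mul hf)
  have e1 : ∀ a : ℝ≥0∞, a ^ (1 / 2 : ℝ) * a ^ (1 / 2 : ℝ) = a := fun a => by
    rw [← ENNReal.rpow_add_of_nonneg _ _ (by norm_num) (by norm_num)]; norm_num
  have e2 : ∀ a : ℝ≥0∞, (a ^ (1 / 2 : ℝ)) ^ (2 : ℝ) = a := fun a => by
    rw [← ENNReal.rpow_mul]; norm_num
  have h1 : (∫⁻ y, k y * f y ∂ν) ≤
      (∫⁻ y, k y ∂ν) ^ (1 / 2 : ℝ) * (∫⁻ y, k y * f y ^ 2 ∂ν) ^ (1 / 2 : ℝ) := by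
    convert h using 3
    · rw [Pi.mul_apply, ← mul_assoc, e1]
    · congr 1; ext y; rw [e2]
    · congr 1; ext y
      rw [ENNReal.mul_rpow_of_nonneg _ _ zero_le_two, e2, ENNReal.rpow_two]
  calc _ ≤ ((∫⁻ y, k y ∂ν) ^ (1 / 2 : ℝ) * (∫⁻ y, k y * f y ^ 2 ∂ν) ^ (1 / 2 : ℝ)) ^ 2 := by gcongr
    _ = _ := by rw [mul_pow, ← ENNReal.rpow_two, ← ENNReal.rpow_two, e2, e2]

/-- Schur's test. -/
lemma lintegral_sq_lintegral_mul_le [SFinite μ] [SFinite ν] {k : X × Y → ℝ≥0∞} (hk : Measurable k)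
    {f : Y → ℝ≥0∞} (hf : AEMeasurable f ν) {A B : ℝ≥0∞} (hA : ∀ᵐ x ∂μ, ∫⁻ y, k (x, y) ∂ν ≤ A)
    (hB : ∀ᵐ y ∂ν, ∫⁻ x, k (x, y) ∂μ ≤ B) :
    ∫⁻ x, (∫⁻ y, k (x, y) * f y ∂ν) ^ 2 ∂μ ≤ A * B * ∫⁻ y, f y ^ 2 ∂ν := by
  have hkx : ∀ x, Measurable fun y => k (x, y) := fun x => hk.comp measurable_prodMk_left
  have hky : ∀ y, Measurable fun x => k (x, y) := fun y => hk.comp measurable_prodMk_right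
  calc ∫⁻ x, (∫⁻ y, k (x, y) * f y ∂ν) ^ 2 ∂μ
      ≤ ∫⁻ x, A * ∫⁻ y, k (x, y) * f y ^ 2 ∂ν ∂μ := by
        refine lintegral_mono_ae ?_
        filter_upwards [hA] with x hx
        exact (sq_lintegral_mul_le (hkx x).aemeasurable hf).trans (by gcongr)
    _ ≤ A * ∫⁻ x, ∫⁻ y, k (x, y) * f y ^ 2 ∂ν ∂μ := by
        rw [lintegral_const_mul'' _ ?_]
        refine AEMeasurable.lintegral_prod_right' (f := fun w : X × Y => k w * f w.2 ^ 2) ?_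
        exact hk.aemeasurable.mul ((hf.comp_snd).pow_const 2)
    _ = A * ∫⁻ y, ∫⁻ x, k (x, y) * f y ^ 2 ∂μ ∂ν := by
        rw [lintegral_lintegral_swap]
        exact hk.aemeasurable.mul ((hf.comp_snd).pow_const 2)
    _ ≤ A * ∫⁻ y, B * f y ^ 2 ∂ν := by
        gcongr 1
        refine lintegral_mono_ae ?_
        filter_upwards [hB] with y hy
        rw [lintegral_mul_const _ (hky y)]
        gcongr
    _ = A * B * ∫⁻ y, f y ^ 2 ∂ν := by
        rw [lintegral_const_mul'' _ (hf.pow_const 2), mul_assoc]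

end Schur

section Gaussian

/-- A Gaussian is dominated by every inverse power of `1 + s`. -/
lemma exp_neg_mul_sq_le {a : ℝ} (ha : 0 < a) (m : ℕ) (s : ℝ) (hs : 0 ≤ s) :
    Real.exp (-(a * s ^ 2)) ≤ Real.exp (m ^ 2 / (4 * a)) * (1 + s) ^ (-(m : ℝ)) := by
  have h1 : (1 + s) ^ m ≤ Real.exp (m ^ 2 / (4 * a) + a * s ^ 2) := by
    calc (1 + s) ^ m ≤ Real.exp s ^ m := by
          gcongr
          linarith [Real.add_one_le_exp s]
      _ = Real.exp (m * s) := by rw [← Real.exp_nat_mul]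
      _ ≤ _ := by
          refine Real.exp_le_exp.2 ?_
          have : 0 ≤ (m - 2 * a * s) ^ 2 / (4 * a) := by positivity
          have e : (m - 2 * a * s) ^ 2 / (4 * a) = m ^ 2 / (4 * a) + a * s ^ 2 - m * s := by
            field_simp; ring
          linarith
  rw [Real.rpow_neg (by positivity), Real.rpow_natCast, ← div_eq_mul_inv,
    le_div_iff₀ (by positivity)]
  calc _ ≤ Real.exp (-(a * s ^ 2)) * Real.exp (m ^ 2 / (4 * a) + a * s ^ 2) := by gcongr
    _ = _ := by rw [← Real.exp_add]; congr 1; ring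

lemma lintegral_gaussian_lt_top {a : ℝ} (ha : 0 < a) :
    ∫⁻ x : Cn n, ENNReal.ofReal (Real.exp (-(a * ‖x‖ ^ 2))) < ⊤ := by
  set m := Module.finrank ℝ (Cn n) + 1 with hm
  have h1 : Integrable (fun x : Cn n => (1 + ‖x‖) ^ (-(m : ℝ))) :=
    integrable_one_add_norm (by rw [hm]; push_cast; linarith)
  have h2 := (h1.const_mul (Real.exp (m ^ 2 / (4 * a)))).lintegral_lt_top
  refine lt_of_le_of_lt (lintegral_mono fun x => ?_) h2
  exact ENNReal.ofReal_le_ofReal (exp_neg_mul_sq_le ha m _ (norm_nonneg x))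

/-- A Gaussian of width `√h` on `ℂⁿ` has mass `O(hⁿ)`. -/
lemma exists_lintegral_gaussian_le (n : ℕ) {a : ℝ} (ha : 0 < a) : ∃ C > 0, ∀ h > 0, ∀ x₁ : Cn n,
    ∫⁻ x : Cn n, ENNReal.ofReal (Real.exp (-(a * ‖x - x₁‖ ^ 2 / h))) ≤
      ENNReal.ofReal (C * h ^ n) := by
  set I := ∫⁻ x : Cn n, ENNReal.ofReal (Real.exp (-(a * ‖x‖ ^ 2))) with hI
  have hIt : I < ⊤ := lintegral_gaussian_lt_top ha
  refine ⟨I.toReal + 1, by positivity, fun h hh x₁ => ?_⟩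
  have hs : 0 < √h := Real.sqrt_pos.2 hh
  have hmeas : Measurable fun x : Cn n => ENNReal.ofReal (Real.exp (-(a * ‖x‖ ^ 2))) := by
    fun_prop
  have hdim : Module.finrank ℝ (Cn n) = 2 * n := by
    rw [Module.finrank_pi_fintype]; simp [mul_comm]
  rw [lintegral_sub_right_eq_self (fun x : Cn n => ENNReal.ofReal (Real.exp (-(a * ‖x‖ ^ 2 / h)))) x₁]
  have e1 : ∀ x : Cn n, ENNReal.ofReal (Real.exp (-(a * ‖x‖ ^ 2 / h))) =
      ENNReal.ofReal (Real.exp (-(a * ‖(√h)⁻¹ • x‖ ^ 2))) := fun x => by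
    rw [norm_smul, mul_pow, norm_inv, Real.norm_eq_abs, inv_pow, sq_abs, Real.sq_sqrt hh.le]
    congr 3
    field_simp
  simp only [e1]
  have h2 := lintegral_map (μ := (volume : Measure (Cn n))) hmeas
    (measurable_const_smul (M := ℝ) (√h)⁻¹)
  rw [Measure.map_addHaar_smul _ (inv_ne_zero hs.ne'), lintegral_smul_measure] at h2
  rw [← h2, hdim, pow_mul, inv_pow, Real.sq_sqrt hh.le, inv_pow, inv_inv,
    abs_of_nonneg (by positivity), smul_eq_mul, mul_comm (I.toReal + 1),
    ENNReal.ofReal_mul (by positivity)]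
  gcongr
  calc I = ENNReal.ofReal I.toReal := (ENNReal.ofReal_toReal hIt.ne).symm
    _ ≤ _ := ENNReal.ofReal_le_ofReal (by linarith)

/-- The Gaussian bound after a change of variables with Lipschitz inverse. No regularity of the map
is needed. -/
lemma exists_lintegral_gaussian_comp_le (n : ℕ) {a K : ℝ} (ha : 0 < a) (hK : 0 < K) : ∃ C > 0,
    ∀ h > 0, ∀ (W : Set (Cn n)), MeasurableSet W → ∀ Z : Cn n → Cn n,
      (∀ x ∈ W, ∀ x' ∈ W, ‖x - x'‖ ≤ K * ‖Z x - Z x'‖) → ∀ y,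
        ∫⁻ x in W, ENNReal.ofReal (Real.exp (-(a * ‖Z x - y‖ ^ 2 / h))) ≤
          ENNReal.ofReal (C * h ^ n) := by
  obtain ⟨C, hC, hg⟩ := exists_lintegral_gaussian_le n (a := a / (8 * K ^ 2)) (by positivity)
  refine ⟨Real.exp (a / 4) * C, by positivity, fun h hh W hW Z hZ y => ?_⟩
  rcases W.eq_empty_or_nonempty with rfl | hne
  · simp
  have hs : 0 < √h := Real.sqrt_pos.2 hh
  -- an almost nearest point to `y` in the image serves as the centre of the Gaussian
  obtain ⟨x₁, hx₁, hmin⟩ : ∃ x₁ ∈ W, ∀ x ∈ W, ‖Z x₁ - y‖ ≤ ‖Z x - y‖ + √h := by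
    have hbdd : BddBelow ((fun x => ‖Z x - y‖) '' W) := ⟨0, by rintro _ ⟨x, -, rfl⟩; exact norm_nonneg _⟩
    obtain ⟨_, ⟨x₁, hx₁, rfl⟩, hlt⟩ := exists_lt_of_csInf_lt (hne.image fun x => ‖Z x - y‖)
      (lt_add_of_pos_right (sInf ((fun x => ‖Z x - y‖) '' W)) hs)
    exact ⟨x₁, hx₁, fun x hx => hlt.le.trans
      (by gcongr; exact csInf_le hbdd (mem_image_of_mem _ hx))⟩
  have hpt : ∀ x ∈ W, Real.exp (-(a * ‖Z x - y‖ ^ 2 / h)) ≤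
      Real.exp (a / 4) * Real.exp (-(a / (8 * K ^ 2) * ‖x - x₁‖ ^ 2 / h)) := by
    intro x hx
    rw [← Real.exp_add]
    refine Real.exp_le_exp.2 ?_
    have h1 : ‖x - x₁‖ ≤ K * (2 * ‖Z x - y‖ + √h) := by
      refine (hZ x hx x₁ hx₁).trans ?_
      gcongr
      have e : Z x - Z x₁ = (Z x - y) - (Z x₁ - y) := by abel
      rw [e]
      refine (norm_sub_le _ _).trans ?_
      linarith [hmin x hx]
    have h2 : ‖x - x₁‖ ^ 2 ≤ K ^ 2 * (8 * ‖Z x - y‖ ^ 2 + 2 * h) := by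
      calc _ ≤ (K * (2 * ‖Z x - y‖ + √h)) ^ 2 := by gcongr
        _ = K ^ 2 * (2 * ‖Z x - y‖ + √h) ^ 2 := mul_pow _ _ _
        _ ≤ _ := by
          gcongr
          nlinarith [sq_nonneg (2 * ‖Z x - y‖ - √h), Real.sq_sqrt hh.le]
    have h3 : a / (8 * K ^ 2) * ‖x - x₁‖ ^ 2 / h ≤
        a / (8 * K ^ 2) * (K ^ 2 * (8 * ‖Z x - y‖ ^ 2 + 2 * h)) / h := by gcongr
    have h4 : a / (8 * K ^ 2) * (K ^ 2 * (8 * ‖Z x - y‖ ^ 2 + 2 * h)) / h =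
        a * ‖Z x - y‖ ^ 2 / h + a / 4 := by field_simp; ring
    linarith
  calc _ ≤ ∫⁻ x in W, ENNReal.ofReal (Real.exp (a / 4)) *
        ENNReal.ofReal (Real.exp (-(a / (8 * K ^ 2) * ‖x - x₁‖ ^ 2 / h))) := by
        refine setLIntegral_mono' hW fun x hx => ?_
        rw [← ENNReal.ofReal_mul (Real.exp_pos _).le]
        exact ENNReal.ofReal_le_ofReal (hpt x hx)
    _ ≤ ∫⁻ x, ENNReal.ofReal (Real.exp (a / 4)) *
        ENNReal.ofReal (Real.exp (-(a / (8 * K ^ 2) * ‖x - x₁‖ ^ 2 / h))) :=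
        setLIntegral_le_lintegral _ _
    _ = ENNReal.ofReal (Real.exp (a / 4)) * _ := lintegral_const_mul _ (by fun_prop)
    _ ≤ ENNReal.ofReal (Real.exp (a / 4)) * ENNReal.ofReal (C * h ^ n) := by
        gcongr; exact hg h hh x₁
    _ = _ := by rw [← ENNReal.ofReal_mul (Real.exp_pos _).le, mul_assoc]

end Gaussian

end FBI

namespace FBI

/-! ### The norm bound for the semigroup -/

variable {n : ℕ}

lemma wNorm_eq (Φ₀ : Cn n → ℝ) (h : ℝ) (V : Set (Cn n)) (u : Cn n → ℂ) :
    wNorm Φ₀ h V u = (∫⁻ x in V,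
      (‖u x‖ₑ * ENNReal.ofReal (Real.exp (-(Φ₀ x / h)))) ^ 2) ^ (1 / 2 : ℝ) := by
  rw [wNorm]
  congr 2
  ext x
  rw [mul_pow, ← ENNReal.ofReal_pow (Real.exp_pos _).le, ← Real.exp_nat_mul]
  congr 4
  push_cast
  ring

/-- After conjugation by the weights, the kernel of the semigroup is at most
`h⁻ⁿ M exp (-phaseDefect / h)` in absolute value. -/
lemma enorm_semigroupOp_le {Φ₀ : Cn n → ℝ} {Ψ : ℝ → Cn n → Cn n → ℂ}
    {a : ℝ → ℝ → Cn n → Cn n → ℂ} {V : Set (Cn n)} (hV : MeasurableSet V) {h t M : ℝ} (hh : 0 < h)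
    {x : Cn n} (ha : ∀ y ∈ V, ‖a h t x (conjC y)‖ ≤ M) (u : Cn n → ℂ) :
    ‖semigroupOp Φ₀ Ψ a V h t u x‖ₑ * ENNReal.ofReal (Real.exp (-(Φ₀ x / h))) ≤
      ENNReal.ofReal ((h ^ n)⁻¹ * M) *
        ∫⁻ y in V, ENNReal.ofReal (Real.exp (-(phaseDefect Φ₀ Ψ (t, (x, y)) / h))) *
          (‖u y‖ₑ * ENNReal.ofReal (Real.exp (-(Φ₀ y / h)))) := by
  have hhn : 0 ≤ (h ^ n)⁻¹ := by positivity
  rw [semigroupOp, enorm_mul, ENNReal.ofReal_mul hhn, mul_assoc, mul_assoc]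
  have e1 : ‖(((h ^ n)⁻¹ : ℝ) : ℂ)‖ₑ = ENNReal.ofReal (h ^ n)⁻¹ := by
    rw [← ofReal_norm, Complex.norm_real, Real.norm_eq_abs, abs_of_nonneg hhn]
  rw [e1]
  refine mul_le_mul' le_rfl ?_
  refine (mul_le_mul' (enorm_integral_le_lintegral_enorm _) le_rfl).trans ?_
  rw [← lintegral_mul_const' _ _ ENNReal.ofReal_ne_top, ← lintegral_const_mul' _ _
    ENNReal.ofReal_ne_top]
  refine setLIntegral_mono' hV fun y hy => ?_
  have e2 : ‖Complex.exp (2 * Ψ t x (conjC y) / h)‖ₑ =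
      ENNReal.ofReal (Real.exp (2 * (Ψ t x (conjC y)).re / h)) := by
    rw [← ofReal_norm, Complex.norm_exp]
    congr 2
    rw [Complex.div_ofReal_re]
    simp
  have e3 : ‖(Real.exp (-2 * Φ₀ y / h) : ℂ)‖ₑ = ENNReal.ofReal (Real.exp (-2 * Φ₀ y / h)) := by
    rw [← ofReal_norm, Complex.norm_real, Real.norm_eq_abs, abs_of_pos (Real.exp_pos _)]
  have e4 : ‖a h t x (conjC y)‖ₑ ≤ ENNReal.ofReal M := by
    rw [← ofReal_norm]
    exact ENNReal.ofReal_le_ofReal (ha y hy)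
  have e5 : Real.exp (2 * (Ψ t x (conjC y)).re / h) * Real.exp (-2 * Φ₀ y / h) *
      Real.exp (-(Φ₀ x / h)) = Real.exp (-(phaseDefect Φ₀ Ψ (t, (x, y)) / h)) *
        Real.exp (-(Φ₀ y / h)) := by
    rw [← Real.exp_add, ← Real.exp_add, ← Real.exp_add, phaseDefect]
    congr 1
    field_simp
    ring
  rw [enorm_mul, enorm_mul, enorm_mul, e2, e3]
  calc _ ≤ ENNReal.ofReal (Real.exp (2 * (Ψ t x (conjC y)).re / h)) * ENNReal.ofReal M * ‖u y‖ₑ *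
        ENNReal.ofReal (Real.exp (-2 * Φ₀ y / h)) * ENNReal.ofReal (Real.exp (-(Φ₀ x / h))) := by
        gcongr
    _ = ENNReal.ofReal M * (ENNReal.ofReal (Real.exp (2 * (Ψ t x (conjC y)).re / h) *
        Real.exp (-2 * Φ₀ y / h) * Real.exp (-(Φ₀ x / h))) * ‖u y‖ₑ) := by
        rw [ENNReal.ofReal_mul (by positivity), ENNReal.ofReal_mul (by positivity)]
        ring
    _ = _ := by
        rw [e5, ENNReal.ofReal_mul (by positivity)]
        ring

/-- The norm bound for an operator whose kernel is bounded by `exp (-d / h)` with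
`d ≥ c (s + |Z(x) - y|²)`. -/
lemma exists_wNorm_semigroupOp_le (n : ℕ) {c K : ℝ} (hc : 0 < c) (hK : 0 < K) : ∃ C > 0,
    ∀ (Φ₀ : Cn n → ℝ) (Ψ : ℝ → Cn n → Cn n → ℂ) (a : ℝ → ℝ → Cn n → Cn n → ℂ) (O V W : Set (Cn n))
      (Z : Cn n → Cn n) (h t s M : ℝ), IsOpen O → IsOpen V → IsOpen W → W ⊆ V → V ⊆ O → 0 < h →
      0 ≤ M → (∀ x ∈ O, ∀ y ∈ O, ‖a h t x (conjC y)‖ ≤ M) → ContinuousOn Φ₀ O →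
      ContinuousOn (fun w => phaseDefect Φ₀ Ψ (t, w)) (O ×ˢ O) →
      (∀ x ∈ O, ∀ x' ∈ O, ‖x - x'‖ ≤ K * ‖Z x - Z x'‖) →
      (∀ x ∈ O, ∀ y ∈ O, c * (s + ‖Z x - y‖ ^ 2) ≤ phaseDefect Φ₀ Ψ (t, (x, y))) →
      ∀ u : Cn n → ℂ, ContinuousOn u V → wNorm Φ₀ h W (semigroupOp Φ₀ Ψ a V h t u) ≤
        ENNReal.ofReal (C * M * Real.exp (-(c * s / h))) * wNorm Φ₀ h V u := by
  obtain ⟨C₁, hC₁, hg₁⟩ := exists_lintegral_gaussian_le n hc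
  obtain ⟨C₂, hC₂, hg₂⟩ := exists_lintegral_gaussian_comp_le n hc hK
  refine ⟨max C₁ C₂, by positivity,
    fun Φ₀ Ψ a O V W Z h t s M hO hV hW hWV hVO hh hM ha hΦ hD hZ hlow u hu => ?_⟩
  classical
  set C := max C₁ C₂
  have hC : 0 < C := lt_max_of_lt_left hC₁
  -- the extension by zero makes the kernel globally measurable
  set k : Cn n × Cn n → ENNReal := (O ×ˢ O).piecewise
    (fun w => ENNReal.ofReal (Real.exp (-(phaseDefect Φ₀ Ψ (t, w) / h)))) 0 with hk
  have hkm : Measurable k := by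
    refine ContinuousOn.measurable_piecewise ?_ continuousOn_const (hO.prod hO).measurableSet
    exact ENNReal.continuous_ofReal.comp_continuousOn
      (Real.continuous_exp.comp_continuousOn (hD.div_const h).neg)
  have hkeq : ∀ x ∈ O, ∀ y ∈ O, k (x, y) =
      ENNReal.ofReal (Real.exp (-(phaseDefect Φ₀ Ψ (t, (x, y)) / h))) := fun x hx y hy =>
    piecewise_eq_of_mem _ _ _ (show (x, y) ∈ O ×ˢ O from ⟨hx, hy⟩)
  set f : Cn n → ENNReal := fun y => ‖u y‖ₑ * ENNReal.ofReal (Real.exp (-(Φ₀ y / h))) with hf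
  have hfm : AEMeasurable f (volume.restrict V) := by
    have h1 : ContinuousOn (fun y => ENNReal.ofReal (Real.exp (-(Φ₀ y / h)))) V :=
      ENNReal.continuous_ofReal.comp_continuousOn
        (Real.continuous_exp.comp_continuousOn ((hΦ.mono hVO).div_const h).neg)
    exact (hu.aemeasurable hV.measurableSet).enorm.mul (h1.aemeasurable hV.measurableSet)
  set A := ENNReal.ofReal (Real.exp (-(c * s / h)) * (C * h ^ n)) with hA
  have hkle : ∀ x ∈ O, ∀ y ∈ O, k (x, y) ≤ ENNReal.ofReal (Real.exp (-(c * s / h))) *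
      ENNReal.ofReal (Real.exp (-(c * ‖Z x - y‖ ^ 2 / h))) := by
    intro x hx y hy
    rw [hkeq x hx y hy, ← ENNReal.ofReal_mul (Real.exp_pos _).le, ← Real.exp_add]
    refine ENNReal.ofReal_le_ofReal (Real.exp_le_exp.2 ?_)
    have h1 : c * (s + ‖Z x - y‖ ^ 2) / h ≤ phaseDefect Φ₀ Ψ (t, (x, y)) / h := by
      gcongr; exact hlow x hx y hy
    rw [mul_add, add_div] at h1
    linarith
  have hWO := hWV.trans hVO
  have hAy : ∀ x ∈ W, ∫⁻ y in V, k (x, y) ≤ A := by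
    intro x hx
    calc _ ≤ ∫⁻ y in V, ENNReal.ofReal (Real.exp (-(c * s / h))) *
          ENNReal.ofReal (Real.exp (-(c * ‖y - Z x‖ ^ 2 / h))) :=
          setLIntegral_mono' hV.measurableSet fun y hy => by
            rw [norm_sub_rev y]; exact hkle x (hWO hx) y (hVO hy)
      _ ≤ ENNReal.ofReal (Real.exp (-(c * s / h))) *
          ∫⁻ y, ENNReal.ofReal (Real.exp (-(c * ‖y - Z x‖ ^ 2 / h))) := by
          rw [← lintegral_const_mul _ (by fun_prop)]
          exact setLIntegral_le_lintegral _ _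
      _ ≤ ENNReal.ofReal (Real.exp (-(c * s / h))) * ENNReal.ofReal (C * h ^ n) := by
          gcongr
          refine (hg₁ h hh _).trans (ENNReal.ofReal_le_ofReal ?_)
          gcongr
          exact le_max_left _ _
      _ = A := by rw [hA, ENNReal.ofReal_mul (Real.exp_pos _).le]
  -- in `x` the Gaussian is composed with `Z`, of which only a Lipschitz inverse is known
  have hAx : ∀ y ∈ V, ∫⁻ x in W, k (x, y) ≤ A := by
    intro y hy
    calc _ ≤ ∫⁻ x in W, ENNReal.ofReal (Real.exp (-(c * s / h))) *
          ENNReal.ofReal (Real.exp (-(c * ‖Z x - y‖ ^ 2 / h))) :=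
          setLIntegral_mono' hW.measurableSet fun x hx => hkle x (hWO hx) y (hVO hy)
      _ = ENNReal.ofReal (Real.exp (-(c * s / h))) *
          ∫⁻ x in W, ENNReal.ofReal (Real.exp (-(c * ‖Z x - y‖ ^ 2 / h))) :=
          lintegral_const_mul' _ _ ENNReal.ofReal_ne_top
      _ ≤ ENNReal.ofReal (Real.exp (-(c * s / h))) * ENNReal.ofReal (C * h ^ n) := by
          gcongr
          refine (hg₂ h hh W hW.measurableSet Z
            (fun x hx x' hx' => hZ x (hWO hx) x' (hWO hx')) y).trans (ENNReal.ofReal_le_ofReal ?_)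
          gcongr
          exact le_max_right _ _
      _ = A := by rw [hA, ENNReal.ofReal_mul (Real.exp_pos _).le]
  have hschur := lintegral_sq_lintegral_mul_le (μ := volume.restrict W) (ν := volume.restrict V)
    hkm hfm (ae_restrict_of_forall_mem hW.measurableSet hAy)
    (ae_restrict_of_forall_mem hV.measurableSet hAx)
  set b := ENNReal.ofReal ((h ^ n)⁻¹ * M) with hb
  have hsq : ∫⁻ x in W, (‖semigroupOp Φ₀ Ψ a V h t u x‖ₑ *
      ENNReal.ofReal (Real.exp (-(Φ₀ x / h)))) ^ 2 ≤ (b * A) ^ 2 * ∫⁻ y in V, f y ^ 2 := by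
    calc _ ≤ ∫⁻ x in W, b ^ 2 * (∫⁻ y in V, k (x, y) * f y) ^ 2 := by
          refine setLIntegral_mono' hW.measurableSet fun x hx => ?_
          rw [← mul_pow]
          refine pow_le_pow_left' ?_ 2
          refine (enorm_semigroupOp_le hV.measurableSet hh
            (fun y hy => ha x (hWO hx) y (hVO hy)) u).trans (le_of_eq ?_)
          congr 1
          refine setLIntegral_congr_fun hV.measurableSet fun y hy => ?_
          simp only [hkeq x (hWO hx) y (hVO hy), hf]
      _ = b ^ 2 * ∫⁻ x in W, (∫⁻ y in V, k (x, y) * f y) ^ 2 :=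
          lintegral_const_mul' _ _ (by rw [hb]; exact ENNReal.pow_ne_top ENNReal.ofReal_ne_top)
      _ ≤ b ^ 2 * (A * A * ∫⁻ y in V, f y ^ 2) := by gcongr
      _ = _ := by ring
  have hbA : b * A = ENNReal.ofReal (C * M * Real.exp (-(c * s / h))) := by
    rw [hb, hA, ← ENNReal.ofReal_mul (by positivity)]
    congr 1
    field_simp
  rw [wNorm_eq, wNorm_eq]
  calc _ ≤ ((b * A) ^ 2 * ∫⁻ y in V, f y ^ 2) ^ (1 / 2 : ℝ) := by gcongr
    _ = ENNReal.ofReal (C * M * Real.exp (-(c * s / h))) *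
        (∫⁻ y in V, f y ^ 2) ^ (1 / 2 : ℝ) := by
      rw [ENNReal.mul_rpow_of_nonneg _ _ (by norm_num), ← ENNReal.rpow_two, ← ENNReal.rpow_mul, hbA]
      norm_num

namespace IsSemigroupPhase

variable {pt : Cn n × Cn n → ℂ} {x₀ ξ₀ : Cn n} {Φ₀ : Cn n → ℝ} {Ψ : ℝ → Cn n → Cn n → ℂ}

lemma eventually_continuousAt_phaseDefect (S : IsSemigroupPhase pt x₀ Φ₀ Ψ)
    (hΦ : SmoothNear Φ₀ univ x₀) :
    ∀ᶠ q in halfNhds (x₀, x₀), ContinuousAt (fun w => phaseDefect Φ₀ Ψ (q.1, w)) q.2 := by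
  have hIcc : ∀ᶠ q in halfNhds (x₀, x₀), q.1 ∈ Icc (0 : ℝ) 1 :=
    eventually_halfNhds_iff.2 ⟨1, one_pos, fun t ht _ _ => ht⟩
  filter_upwards [(tendsto_sqrt_halfNhds (x₀, x₀)).eventually
    (S.smoothNear_phaseDefect hΦ).eventually_contDiffAt_sq, hIcc] with q hq ht
  have h1 := ContinuousAt.comp (f := fun w : Cn n × Cn n => (√q.1, w))
    (g := fun q : ℝ × (Cn n × Cn n) => phaseDefect Φ₀ Ψ (q.1 ^ 2, q.2)) hq.continuousAt
    (by fun_prop : ContinuousAt (fun w : Cn n × Cn n => (√q.1, w)) q.2)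
  simpa [Function.comp_def, Real.sq_sqrt ht.1] using h1

/-- The microlocal semigroup decays like `exp (-t ^ (k + 1) / (C h))`. -/
theorem exists_wNorm_le (S : IsSemigroupPhase pt x₀ Φ₀ Ψ) (hΦ : SmoothNear Φ₀ univ x₀)
    (hξ : wcov Φ₀ x₀ = ξ₀) (hpt : ContDiffAt ℝ 1 pt (x₀, ξ₀)) {k : ℕ}
    (hF : HasFootpoints Φ₀ pt x₀ k) {c₁ : ℝ} (hc₁ : 0 < c₁)
    (hinit : ∀ᶠ w in 𝓝 (x₀, x₀), c₁ * ‖w.1 - w.2‖ ^ 2 ≤ phaseDefect Φ₀ Ψ (0, w))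
    {a : ℝ → ℝ → Cn n → Cn n → ℂ} (ha : IsBoundedAmplitude x₀ a) {δ : ℝ} (hδ : 0 < δ) :
    ∃ r > (0 : ℝ), ∃ C > (0 : ℝ), ∃ h₀ > (0 : ℝ),
      ∀ V W : Set (Cn n), IsOpen V → IsOpen W → W ⊆ V → V ⊆ Metric.ball x₀ r →
      ∀ h ∈ Ioc 0 h₀, ∀ t ∈ Icc 0 (h ^ δ), ∀ u ∈ HSpace Φ₀ h V,
        wNorm Φ₀ h W (semigroupOp Φ₀ Ψ a V h t u) ≤
          ENNReal.ofReal (C * Real.exp (-(t ^ (k + 1) / (C * h)))) * wNorm Φ₀ h V u := by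
  obtain ⟨ρ, hρ, c, hc, K, hK, Z, hZ⟩ := S.exists_phaseDefect_ge hΦ hξ hpt hF hc₁ hinit
  obtain ⟨U, hU, h₁, hh₁, M, ha⟩ := ha
  obtain ⟨r₁, hr₁, hcont⟩ := eventually_halfNhds_iff.1 (S.eventually_continuousAt_phaseDefect hΦ)
  obtain ⟨r₂, hr₂, hUr⟩ := eventually_halfNhds_iff.1 (tendsto_conjSnd_halfNhds x₀ hU)
  obtain ⟨r₃, hr₃, hΦc⟩ := Metric.eventually_nhds_iff_ball.1
    (hΦ.eventually_contDiffAt.mono fun x hx => hx.continuousAt)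
  obtain ⟨C, hC, hop⟩ := exists_wNorm_semigroupOp_le n hc hK
  set r := min (min ρ r₁) (min r₂ r₃) with hr
  have hr0 : 0 < r := by positivity
  have hrρ : r ≤ ρ := (min_le_left _ _).trans (min_le_left _ _)
  have hrr₁ : r ≤ r₁ := (min_le_left _ _).trans (min_le_right _ _)
  have hrr₂ : r ≤ r₂ := (min_le_right _ _).trans (min_le_left _ _)
  have hrr₃ : r ≤ r₃ := (min_le_right _ _).trans (min_le_right _ _)
  set M' := max M 0 with hM'
  set C' := max (C * M' + 1) (1 / c) with hC'
  have hC'0 : 0 < C' := lt_max_of_lt_right (by positivity)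
  -- `h ≤ r ^ (1 / δ)` ensures `t ≤ h ^ δ ≤ r`
  refine ⟨r, hr0, C', hC'0, min h₁ (r ^ (1 / δ)), by positivity,
    fun V W hV hW hWV hVr h hh t ht u hu => ?_⟩
  have hh0 : 0 < h := hh.1
  have htr : t ≤ r := by
    refine ht.2.trans ?_
    calc h ^ δ ≤ (r ^ (1 / δ)) ^ δ :=
          Real.rpow_le_rpow hh0.le (hh.2.trans (min_le_right _ _)) hδ.le
      _ = r := by rw [← Real.rpow_mul hr0.le, one_div_mul_cancel hδ.ne', Real.rpow_one]
  have hball : ∀ {x y : Cn n} {R : ℝ}, r ≤ R → x ∈ Metric.ball x₀ r → y ∈ Metric.ball x₀ r →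
      (x, y) ∈ Metric.ball (x₀, x₀) R := fun hR hx hy => by
    rw [← ball_prod_same]
    exact ⟨Metric.ball_subset_ball hR hx, Metric.ball_subset_ball hR hy⟩
  obtain ⟨hZ1, -, hZ3⟩ := hZ t ⟨ht.1, htr.trans hrρ⟩
  refine (hop Φ₀ Ψ a (Metric.ball x₀ r) V W (Z t) h t (t ^ (k + 1)) M' Metric.isOpen_ball hV hW hWV
    hVr hh0 (le_max_right _ _) ?_ ?_ ?_ ?_ ?_ u hu.1.continuousOn).trans ?_
  · intro x hx y hy
    exact ((ha h ⟨hh0, hh.2.trans (min_le_left _ _)⟩).2 _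
      (hUr t ⟨ht.1, htr.trans hrr₂⟩ (x, y) (hball hrr₂ hx hy))).trans (le_max_left _ _)
  · exact fun x hx => (hΦc x (Metric.ball_subset_ball hrr₃ hx)).continuousWithinAt
  · exact fun w hw => (hcont t ⟨ht.1, htr.trans hrr₁⟩ w
      (hball hrr₁ hw.1 hw.2)).continuousWithinAt
  · exact fun x hx x' hx' => hZ1 x (Metric.ball_subset_ball hrρ hx) x'
      (Metric.ball_subset_ball hrρ hx')
  · exact fun x hx y hy => hZ3 x (Metric.ball_subset_ball hrρ hx) y
      (Metric.ball_subset_ball hrρ hy)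
  · have h1 : 1 ≤ c * C' := by
      have : 1 / c ≤ C' := le_max_right _ _
      rw [div_le_iff₀ hc] at this
      linarith
    have h2 : t ^ (k + 1) / (C' * h) ≤ c * t ^ (k + 1) / h := by
      rw [div_le_div_iff₀ (by positivity) hh0]
      have h3 : 0 ≤ t ^ (k + 1) * h := mul_nonneg (pow_nonneg ht.1 _) hh0.le
      nlinarith
    refine mul_le_mul' (ENNReal.ofReal_le_ofReal (mul_le_mul ?_ (Real.exp_le_exp.2 (neg_le_neg h2))
      (Real.exp_pos _).le hC'0.le)) le_rfl
    exact (lt_add_one _).le.trans (le_max_left _ _)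

end IsSemigroupPhase

end FBI

namespace FBI

/-! ### Critical points of saddle type depending on parameters -/

section Saddle

variable {E : Type*} [NormedAddCommGroup E] [NormedSpace ℝ E]
  {E₁ : Type*} [NormedAddCommGroup E₁] [NormedSpace ℝ E₁]
  {E₂ : Type*} [NormedAddCommGroup E₂] [NormedSpace ℝ E₂]

lemma hessian_comp_affine {Z : Type*} [NormedAddCommGroup Z] [NormedSpace ℝ Z] {h : Z → ℝ} {a : Z}
    (L : E →L[ℝ] Z) {u : E} (hh : ContDiffAt ℝ 2 h (a + L u)) (v w : E) :
    fderiv ℝ (fderiv ℝ fun u => h (a + L u)) u v w =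
      fderiv ℝ (fderiv ℝ h) (a + L u) (L v) (L w) := by
  have hline : ∀ u, HasFDerivAt (fun u => a + L u) L u := fun u => L.hasFDerivAt.const_add a
  have hev : fderiv ℝ (fun u => h (a + L u)) =ᶠ[𝓝 u] fun u => (fderiv ℝ h (a + L u)).comp L := by
    filter_upwards [(hline u).continuousAt.eventually (hh.eventually (by simp))] with u hu
    exact ((hu.differentiableAt (by norm_num)).hasFDerivAt.comp u (hline u)).fderiv
  have hd : DifferentiableAt ℝ (fderiv ℝ h) (a + L u) :=
    (hh.fderiv_right (m := 1) (by norm_num)).differentiableAt (by norm_num)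
  have h1 := (hd.hasFDerivAt.comp u (hline u)).clm_comp (hasFDerivAt_const L u)
  rw [hev.fderiv_eq]
  have h2 : fderiv ℝ (fun u => (fderiv ℝ h (a + L u)).comp L) u = _ := h1.fderiv
  rw [h2]
  simp

/-- A function `F` of a parameter and of two variables, seen near a point that is critical in the
two variables: the Hessian is negative definite in the second variable, and positive definite on the
graph of the linear map `L` from the first variable to the second. -/
structure IsSaddle (F : E × (E₁ × E₂) → ℝ) (b : E × (E₁ × E₂)) (L : E₁ →L[ℝ] E₂) (c : ℝ) :
    Prop where
  smooth : ContDiffAt ℝ 2 F b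
  critical : ∀ v, fderiv ℝ F b (0, v) = 0
  pos : 0 < c
  lower : ∀ v, c * ‖v‖ ^ 2 ≤ fderiv ℝ (fderiv ℝ F) b (0, (v, L v)) (0, (v, L v))
  upper : ∀ w, fderiv ℝ (fderiv ℝ F) b (0, (0, w)) (0, (0, w)) ≤ -(c * ‖w‖ ^ 2)

namespace IsSaddle

variable {F : E × (E₁ × E₂) → ℝ} {b : E × (E₁ × E₂)} {L : E₁ →L[ℝ] E₂} {c : ℝ}

/-- The Hessian of a saddle in the two variables is nondegenerate. -/
lemma eq_zero (S : IsSaddle F b L c) {u : E₁ × E₂}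
    (hu : ∀ v, fderiv ℝ (fderiv ℝ F) b (0, u) (0, v) = 0) : u = 0 := by
  set B := fderiv ℝ (fderiv ℝ F) b
  have hsymm : ∀ v, B (0, v) (0, u) = 0 := fun v =>
    (S.smooth.isSymmSndFDerivAt (by simp) _ _).trans (hu v)
  -- the vector `(u.1, L u.1)` differs from the null vector `u` by a vertical vector
  have hdec : (((0 : E), (u.1, L u.1)) : E × (E₁ × E₂)) = (0, u) + (0, (0, L u.1 - u.2)) := by
    ext <;> simp
  have h1 := S.lower u.1
  have h2 := S.upper (L u.1 - u.2)
  have h3 : B (0, (u.1, L u.1)) (0, (u.1, L u.1)) =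
      B (0, (0, L u.1 - u.2)) (0, (0, L u.1 - u.2)) := by
    rw [hdec]
    simp only [map_add, add_apply, hu, hsymm, zero_add]
  have hc := S.pos
  have h4 : 0 ≤ c * ‖u.1‖ ^ 2 := by positivity
  have h5 : 0 ≤ c * ‖L u.1 - u.2‖ ^ 2 := by positivity
  have h6 : c * ‖u.1‖ ^ 2 = 0 := by linarith
  have h7 : c * ‖L u.1 - u.2‖ ^ 2 = 0 := by linarith
  have h8 : u.1 = 0 := by simpa [hc.ne'] using h6
  have h9 : L u.1 - u.2 = 0 := by simpa [hc.ne'] using h7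
  rw [h8, map_zero, zero_sub, neg_eq_zero] at h9
  exact Prod.ext h8 h9

/-- A saddle point moves continuously with the parameter. -/
lemma exists_critical [CompleteSpace E] [FiniteDimensional ℝ E₁] [FiniteDimensional ℝ E₂]
    (S : IsSaddle F b L c) : ∃ ψ : E → E₁ × E₂, Tendsto ψ (𝓝 b.1) (𝓝 b.2) ∧
      ∀ᶠ p in 𝓝 b.1, ∀ v, fderiv ℝ F (p, ψ p) (0, v) = 0 := by
  have : CompleteSpace (E₁ × E₂) := FiniteDimensional.complete ℝ _
  set J := ContinuousLinearMap.inr ℝ E (E₁ × E₂) with hJ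
  set g : E × (E₁ × E₂) → (E₁ × E₂) →L[ℝ] ℝ := fun q => (fderiv ℝ F q).comp J with hg
  have hF1 : ContDiffAt ℝ 1 (fderiv ℝ F) b := S.smooth.fderiv_right (by norm_num)
  have hcd : ContDiffAt ℝ 1 g b := hF1.clm_comp contDiffAt_const
  have hg0 : g b = 0 := by
    ext v
    · exact S.critical (v, 0)
    · exact S.critical (0, v)
  have happ : ∀ u v, (fderiv ℝ g b ∘L J) u v = fderiv ℝ (fderiv ℝ F) b (0, u) (0, v) := by
    intro u v
    have h1 := (hF1.differentiableAt (by norm_num)).hasFDerivAt.clm_comp (hasFDerivAt_const J b)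
    have h2 : fderiv ℝ g b = _ := h1.fderiv
    rw [h2]
    simp [hJ]
  have hinj : Function.Injective (fderiv ℝ g b ∘L J) := by
    rw [injective_iff_map_eq_zero]
    intro u hu
    exact S.eq_zero fun v => by rw [← happ, hu, zero_apply]
  have hdim : Module.finrank ℝ (E₁ × E₂) = Module.finrank ℝ ((E₁ × E₂) →L[ℝ] ℝ) := by
    rw [← (LinearMap.toContinuousLinearMap (𝕜 := ℝ) (E := E₁ × E₂) (F' := ℝ)).finrank_eq]
    exact Subspace.dual_finrank_eq.symm
  have hinv : (fderiv ℝ g b ∘L .inr ℝ E (E₁ × E₂)).IsInvertible := by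
    refine ⟨(LinearMap.linearEquivOfInjective
      (fderiv ℝ g b ∘L J : (E₁ × E₂) →L[ℝ] ((E₁ × E₂) →L[ℝ] ℝ)).toLinearMap
      hinj hdim).toContinuousLinearEquiv, ?_⟩
    exact ContinuousLinearMap.ext fun u => rfl
  refine ⟨hcd.implicitFunction (by simp) hinv, ?_, ?_⟩
  · have := (hcd.contDiffAt_implicitFunction (by simp) hinv).continuousAt.tendsto
    rwa [hcd.implicitFunction_apply_self (by simp) hinv] at this
  · filter_upwards [hcd.eventually_apply_implicitFunction (by simp) hinv] with p hp v
    rw [hg0] at hp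
    exact congrArg (fun l => l v) hp

/-- The saddle value is a minimax: it is at most the maximum over the second variable, for every
value of the first one. -/
lemma eventually_le (S : IsSaddle F b L c) : ∃ r > 0, ∀ p ∈ Metric.ball b.1 r,
    ∀ z ∈ Metric.ball b.2 r, (∀ v, fderiv ℝ F (p, z) (0, v) = 0) →
    ∀ u ∈ Metric.ball b.2 r, (∀ w, fderiv ℝ F (p, u) (0, (0, w)) = 0) → F (p, z) ≤ F (p, u) := by
  have hc := S.pos
  have hlow := eventually_coercive (tendsto_hessian S.smooth)
    (fun v : E₁ => ((0, (v, L v)) : E × (E₁ × E₂))) (κ := 1 + ‖L‖) hc (by positivity) (fun v => by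
      have h1 := L.le_opNorm v
      have h2 : 0 ≤ ‖L‖ * ‖v‖ := by positivity
      simp only [Prod.norm_mk, norm_zero]
      refine max_le (by positivity) (max_le ?_ ?_) <;> nlinarith [norm_nonneg v]) S.lower
  have hneg : fderiv ℝ (fderiv ℝ fun q => -F q) = fun q => -fderiv ℝ (fderiv ℝ F) q := by
    have h1 : fderiv ℝ (fun q => -F q) = fun q => -fderiv ℝ F q := funext fun q => fderiv_fun_neg
    rw [h1]
    exact funext fun q => fderiv_fun_neg
  have hup := eventually_coercive (tendsto_hessian S.smooth.neg)
    (fun w : E₂ => ((0, (0, w)) : E × (E₁ × E₂))) (κ := 1) hc one_pos (fun w => by simp)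
    (fun w => by
      have := S.upper w
      change c * ‖w‖ ^ 2 ≤ fderiv ℝ (fderiv ℝ fun q => -F q) b _ _
      rw [hneg]
      simp only [neg_apply]
      linarith)
  obtain ⟨R, hR, hball⟩ := Metric.eventually_nhds_iff_ball.1
    ((S.smooth.eventually (by simp)).and (hlow.and hup))
  set r := R / (3 + 2 * ‖L‖) with hr
  have hLr : r * (3 + 2 * ‖L‖) = R := by rw [hr]; field_simp
  have hr0 : 0 < r := by positivity
  have hL0 : 0 ≤ r * ‖L‖ := by positivity
  have hrR : r ≤ R := by linarith
  refine ⟨r, hr0, fun p hp z hz hcz u hu hcu => ?_⟩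
  have hmem : ∀ {z}, z ∈ Metric.ball b.2 R → (p, z) ∈ Metric.ball b R := fun hz => by
    rw [← Prod.mk.eta (p := b), ← ball_prod_same]; exact ⟨Metric.ball_subset_ball hrR hp, hz⟩
  have hzR := Metric.ball_subset_ball hrR hz
  have huR := Metric.ball_subset_ball hrR hu
  -- the intermediate point, above `u.1` in the direction of the graph of `L`
  set z' : E₁ × E₂ := (u.1, z.2 + L (u.1 - z.1)) with hz'
  have hz'R : z' ∈ Metric.ball b.2 R := by
    rw [← Prod.mk.eta (p := b.2), ← ball_prod_same] at hz hu ⊢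
    refine ⟨Metric.ball_subset_ball hrR hu.1, ?_⟩
    have h1 := mem_ball_iff_norm.1 hz.1
    have h2 := mem_ball_iff_norm.1 hz.2
    have h3 := mem_ball_iff_norm.1 hu.1
    have h4 : ‖u.1 - z.1‖ ≤ 2 * r := by
      have := norm_sub_le (u.1 - b.2.1) (z.1 - b.2.1)
      rw [sub_sub_sub_cancel_right] at this
      linarith
    have h5 : ‖L (u.1 - z.1)‖ ≤ ‖L‖ * (2 * r) :=
      (L.le_opNorm _).trans (mul_le_mul_of_nonneg_left h4 (norm_nonneg _))
    have h6 := norm_add_le (z.2 - b.2.2) (L (u.1 - z.1))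
    rw [sub_add_eq_add_sub] at h6
    rw [mem_ball_iff_norm]
    refine h6.trans_lt ?_
    linarith
  have hseg : ∀ {z₁ z₂}, z₁ ∈ Metric.ball b.2 R → z₂ ∈ Metric.ball b.2 R →
      segment ℝ (p, z₁) (p, z₂) ⊆ Metric.ball b R := fun h₁ h₂ =>
    (convex_ball _ _).segment_subset (hmem h₁) (hmem h₂)
  -- `F` is convex from the critical point `z` to `z'`, along the graph of `L`
  have h1 : F (p, z) ≤ F (p, z') := by
    have hd : ((p, z') : E × (E₁ × E₂)) - (p, z) = (0, (u.1 - z.1, L (u.1 - z.1))) := by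
      ext <;> simp [hz']
    have := le_of_hessian_lower_bound (c := 0) (fun q hq => (hball q (hseg hzR hz'R hq)).1)
      (fun q hq => by
        rw [hd]
        exact le_trans (by positivity) ((hball q (hseg hzR hz'R hq)).2.1 (u.1 - z.1)))
    rw [hd, hcz] at this
    linarith
  -- `F` is concave from `u`, critical in the second variable, to `z'`
  have h2 : F (p, z') ≤ F (p, u) := by
    have hd : ((p, z') : E × (E₁ × E₂)) - (p, u) = (0, (0, z'.2 - u.2)) := by
      ext <;> simp [hz']
    have := le_of_hessian_upper_bound (c := 0) (fun q hq => (hball q (hseg huR hz'R hq)).1)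
      (fun q hq => by
        have h3 := (hball q (hseg huR hz'R hq)).2.2 (z'.2 - u.2)
        change c / 2 * _ ≤ fderiv ℝ (fderiv ℝ fun q => -F q) q _ _ at h3
        rw [hneg] at h3
        simp only [neg_apply] at h3
        rw [hd]
        have : 0 ≤ c / 2 * ‖z'.2 - u.2‖ ^ 2 := by positivity
        linarith)
    rw [hd, hcu] at this
    linarith
  exact h1.trans h2

end IsSaddle

end Saddle

end FBI

namespace FBI

/-! ### The weight on the real phase space -/

variable {n : ℕ}

/-- The real linear map `(x, θ) ↦ (x, iθ)`. -/
noncomputable def shift (n : ℕ) : Cn n × Rn n →L[ℝ] Cn n × Cn n :=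
  (ContinuousLinearMap.fst ℝ (Cn n) (Rn n)).prod
    (Complex.I • (toCL n).comp (ContinuousLinearMap.snd ℝ (Cn n) (Rn n)))

@[simp] lemma shift_apply (z : Cn n × Rn n) : shift n z = (z.1, Complex.I • toC z.2) := rfl

/-- The linear form `(x, θ) ↦ η · θ`. -/
noncomputable def pairing (η : Rn n) : Cn n × Rn n →L[ℝ] ℝ :=
  (∑ j, η j • ContinuousLinearMap.proj (R := ℝ) j).comp (ContinuousLinearMap.snd ℝ (Cn n) (Rn n))

@[simp] lemma pairing_apply (η : Rn n) (z : Cn n × Rn n) : pairing η z = ∑ j, η j * z.2 j := by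
  simp [pairing]

section CritFun

variable {φ : Cn n → Cn n → ℂ} {Φ₁ : Cn n → ℝ} {y η : Rn n} {z : Cn n × Rn n}

lemma critFun_eq (φ : Cn n → Cn n → ℂ) (Φ₁ : Cn n → ℝ) (y η : Rn n) : critFun φ Φ₁ y η =
    fun z => ((fun z : Cn n × Cn n => φ z.1 z.2) ((0, toC y) + shift n z)).im + pairing η z +
      Φ₁ z.1 := by
  ext z
  simp [critFun]

lemma hasFDerivAt_critFun
    (hf : DifferentiableAt ℂ (fun z : Cn n × Cn n => φ z.1 z.2) (z.1, toC y + Complex.I • toC z.2))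
    (hΦ : DifferentiableAt ℝ Φ₁ z.1) :
    HasFDerivAt (critFun φ Φ₁ y η)
      (Complex.imCLM.comp (((fderiv ℂ (fun z : Cn n × Cn n => φ z.1 z.2)
        (z.1, toC y + Complex.I • toC z.2)).restrictScalars ℝ).comp (shift n)) + pairing η +
        (fderiv ℝ Φ₁ z.1).comp (ContinuousLinearMap.fst ℝ (Cn n) (Rn n))) z := by
  have hpt : (0, toC y) + shift n z = (z.1, toC y + Complex.I • toC z.2) := by simp
  have h1 := hasFDerivAt_im_comp (f := fun z : Cn n × Cn n => φ z.1 z.2) (a := (0, toC y))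
    (shift n) (u := z) (by rw [hpt]; exact hf)
  rw [hpt] at h1
  rw [critFun_eq]
  exact (h1.add (pairing η).hasFDerivAt).add (hΦ.hasFDerivAt.comp z hasFDerivAt_fst)

lemma hessian_critFun
    (hf : ContDiffAt ℂ 2 (fun z : Cn n × Cn n => φ z.1 z.2) (z.1, toC y + Complex.I • toC z.2))
    (hΦ : ContDiffAt ℝ 2 Φ₁ z.1) (v w : Cn n × Rn n) :
    fderiv ℝ (fderiv ℝ (critFun φ Φ₁ y η)) z v w =
      (fderiv ℂ (fderiv ℂ (fun z : Cn n × Cn n => φ z.1 z.2)) (z.1, toC y + Complex.I • toC z.2)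
        (shift n v) (shift n w)).im + fderiv ℝ (fderiv ℝ Φ₁) z.1 v.1 w.1 := by
  have hpt : (0, toC y) + shift n z = (z.1, toC y + Complex.I • toC z.2) := by simp
  have hf' : ContDiffAt ℂ 2 (fun z : Cn n × Cn n => φ z.1 z.2) ((0, toC y) + shift n z) := by
    rw [hpt]; exact hf
  have h1 := contDiffAt_im_comp (m := 2) (shift n) hf'
  have h2 := hessian_im_comp (shift n) hf' v w
  have hΦ' : ContDiffAt ℝ 2 Φ₁ (0 + ContinuousLinearMap.fst ℝ (Cn n) (Rn n) z) := by simpa using hΦ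
  have h3 := hessian_comp_affine _ hΦ' v w
  have h4 : fderiv ℝ (fderiv ℝ fun z : Cn n × Rn n => pairing η z) z v w = 0 := by
    have : fderiv ℝ (fun z : Cn n × Rn n => pairing η z) = fun _ => pairing η :=
      funext fun z => (pairing η).fderiv
    rw [this]
    simp
  have h5 : ContDiffAt ℝ 2 (fun z : Cn n × Rn n => Φ₁ z.1) z :=
    ContDiffAt.comp (g := Φ₁) (f := Prod.fst) z hΦ contDiffAt_fst
  rw [critFun_eq, hessian_add (h1.add (pairing η).contDiff.contDiffAt) h5,
    hessian_add h1 (pairing η).contDiff.contDiffAt, h2, h4, hpt, add_zero]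
  simp only [zero_add, ContinuousLinearMap.coe_fst'] at h3
  rw [h3]

end CritFun

/-- The function whose critical values define the real weight, as a function of the parameters
`(√t, (y, η))` and of the variables `(x, θ)`. In the parameter `√t` it is smooth across `t = 0`. -/
noncomputable def critFamily (φ : Cn n → Cn n → ℂ) (Φ : ℝ → Cn n → ℝ) :
    (ℝ × (Rn n × Rn n)) × (Cn n × Rn n) → ℝ :=
  fun q => critFun φ (Φ (q.1.1 ^ 2)) q.1.2.1 q.1.2.2 q.2

section Family

variable {φ : Cn n → Cn n → ℂ} {x₀ : Cn n} {y₀ η₀ : Rn n} {Φ : ℝ → Cn n → ℝ}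

/-- The family depends smoothly on `τ = √t`, across `τ = 0`, and on all other variables. -/
lemma contDiffAt_critFamily (hf : AnalyticAt ℂ (fun z : Cn n × Cn n => φ z.1 z.2) (x₀, toC y₀))
    (hΦ : SmoothNear (fun q : ℝ × Cn n => Φ q.1 q.2) (Ici (0 : ℝ) ×ˢ univ) (0, x₀)) :
    ContDiffAt ℝ 2 (critFamily φ Φ) ((0, (y₀, η₀)), (x₀, 0)) := by
  set b : (ℝ × (Rn n × Rn n)) × (Cn n × Rn n) := ((0, (y₀, η₀)), (x₀, 0)) with hb
  have h1 : ContDiffAt ℝ 2 (fun q : (ℝ × (Rn n × Rn n)) × (Cn n × Rn n) =>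
      (φ q.2.1 (toC q.1.2.1 + Complex.I • toC q.2.2)).im) b := by
    have hin : ContDiff ℝ 2 fun q : (ℝ × (Rn n × Rn n)) × (Cn n × Rn n) =>
        (q.2.1, toC q.1.2.1 + Complex.I • toC q.2.2) := by
      have e1 : ContDiff ℝ 2 fun q : (ℝ × (Rn n × Rn n)) × (Cn n × Rn n) => toCL n q.1.2.1 := by
        fun_prop
      have e2 : ContDiff ℝ 2 fun q : (ℝ × (Rn n × Rn n)) × (Cn n × Rn n) =>
        Complex.I • toCL n q.2.2 := ((toCL n).contDiff.comp (by fun_prop)).const_smul Complex.I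
      exact (by fun_prop : ContDiff ℝ 2 fun q : (ℝ × (Rn n × Rn n)) × (Cn n × Rn n) =>
        q.2.1).prodMk (e1.add e2)
    have hf' : ContDiffAt ℝ 2 (fun z : Cn n × Cn n => φ z.1 z.2)
        (x₀, toC y₀ + Complex.I • toC (0 : Rn n)) := by
      rw [toC_zero, smul_zero, add_zero]
      exact (hf.contDiffAt (n := 2)).restrict_scalars ℝ
    exact Complex.imCLM.contDiff.contDiffAt.comp b
      (ContDiffAt.comp (g := fun z : Cn n × Cn n => φ z.1 z.2) b hf' hin.contDiffAt)
  have h2 : ContDiffAt ℝ 2 (fun q : (ℝ × (Rn n × Rn n)) × (Cn n × Rn n) =>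
      ∑ j, q.1.2.2 j * q.2.2 j) b := by fun_prop
  have h3 : ContDiffAt ℝ 2 (fun q : (ℝ × (Rn n × Rn n)) × (Cn n × Rn n) =>
      Φ (q.1.1 ^ 2) q.2.1) b :=
    ContDiffAt.comp (g := fun q : ℝ × Cn n => Φ (q.1 ^ 2) q.2) b
      (f := fun q : (ℝ × (Rn n × Rn n)) × (Cn n × Rn n) => (q.1.1, q.2.1))
      (hΦ.eventually_contDiffAt_sq.self_of_nhds.of_le two_le_infty) (by fun_prop)
  exact (h1.add h2).add h3

lemma hasFDerivAt_critFun_of_family {p : ℝ × (Rn n × Rn n)} {z : Cn n × Rn n}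
    (h : DifferentiableAt ℝ (critFamily φ Φ) (p, z)) :
    HasFDerivAt (critFun φ (Φ (p.1 ^ 2)) p.2.1 p.2.2)
      ((fderiv ℝ (critFamily φ Φ) (p, z)).comp
        (ContinuousLinearMap.inr ℝ (ℝ × (Rn n × Rn n)) (Cn n × Rn n))) z :=
  HasFDerivAt.comp (g := critFamily φ Φ) (f := fun z => (p, z)) z h.hasFDerivAt
    (hasFDerivAt_prodMk_right p z)

end Family

namespace Setting

variable {φ : Cn n → Cn n → ℂ} {x₀ : Cn n} {y₀ η₀ : Rn n} {Φ₀ : Cn n → ℝ}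

lemma im_fderiv_I_toC {f : Cn n × Cn n → ℂ} {z : Cn n × Cn n} {η : Rn n}
    (h : gradY f z = -toC η) (w : Rn n) :
    (fderiv ℂ f z (0, Complex.I • toC w)).im = -∑ j, η j * w j := by
  rw [fderiv_apply_inr, Complex.im_sum, ← Finset.sum_neg_distrib]
  refine Finset.sum_congr rfl fun j _ => ?_
  rw [h]
  simp [toC]
  ring

lemma fderiv_weight_base {f : Cn n × Cn n → ℂ} (S : Setting f x₀ y₀ η₀ Φ₀) (v : Cn n) :
    fderiv ℝ Φ₀ x₀ v = -(fderiv ℂ f (x₀, toC y₀) (v, 0)).im := by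
  have h1 : ∀ j, pd (fun x => (Φ₀ x : ℂ)) x₀ j = Complex.I / 2 * gradX f (x₀, toC y₀) j := by
    intro j
    rw [← S.wcov_base, wcov, cov, Pi.smul_apply, smul_eq_mul]
    field_simp
  rw [fderiv_eq_re_pd (S.smooth.differentiableAt (by simp)), fderiv_apply_inl, Complex.re_sum,
    Complex.im_sum, Finset.mul_sum, ← Finset.sum_neg_distrib]
  refine Finset.sum_congr rfl fun j _ => ?_
  rw [h1]
  simp only [Complex.mul_re, Complex.mul_im, Complex.div_ofNat_re, Complex.div_ofNat_im,
    Complex.I_re, Complex.I_im]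
  ring

/-- The Hessian of `Im φ(x, y₀ + iθ) + Φ₀(x)` at the base point, in the direction `(v, w)`. -/
lemma hessian_critFun_base (S : Setting (fun z : Cn n × Cn n => φ z.1 z.2) x₀ y₀ η₀ Φ₀)
    (v : Cn n) (w : Rn n) :
    fderiv ℝ (fderiv ℝ (critFun φ Φ₀ y₀ η₀)) (x₀, 0) (v, w) (v, w) =
      (fderiv ℝ (fderiv ℝ Φ₀) x₀ v v +
        (fderiv ℂ (fderiv ℂ fun z : Cn n × Cn n => φ z.1 z.2) (x₀, toC y₀) (v, 0) (v, 0)).im) +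
      2 * ∑ j, w j * reC (mixed (fun z : Cn n × Cn n => φ z.1 z.2) (x₀, toC y₀) v) j -
      (fderiv ℂ (fderiv ℂ fun z : Cn n × Cn n => φ z.1 z.2) (x₀, toC y₀)
        (0, toC w) (0, toC w)).im := by
  set f : Cn n × Cn n → ℂ := fun z => φ z.1 z.2 with hf
  have hpt : toC y₀ + Complex.I • toC (0 : Rn n) = toC y₀ := by rw [toC_zero, smul_zero, add_zero]
  have hC : ContDiffAt ℂ 2 f (x₀, toC y₀) := S.holo.contDiffAt
  rw [hessian_critFun (by simpa only [hpt] using hC) (S.smooth.of_le two_le_infty)]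
  simp only [hpt]
  set D := fderiv ℂ (fderiv ℂ f) (x₀, toC y₀) with hD
  have hdec : shift n (v, w) = (v, 0) + Complex.I • ((0, toC w) : Cn n × Cn n) := by simp
  have hmix : D (v, 0) (0, toC w) = ∑ j, (w j : ℂ) * mixed f (x₀, toC y₀) v j := by
    have := clm_apply_eq_sum ((D (v, 0)).comp (ContinuousLinearMap.inr ℂ (Cn n) (Cn n))) (toC w)
    simpa [mixed_apply, toC] using this
  have hsymm : D (0, toC w) (v, 0) = D (v, 0) (0, toC w) := symm_hessian hC _ _
  have hre : (D (v, 0) (0, toC w)).re = ∑ j, w j * reC (mixed f (x₀, toC y₀) v) j := by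
    rw [hmix, Complex.re_sum]
    refine Finset.sum_congr rfl fun j _ => ?_
    simp [reC]
  rw [hdec]
  simp only [map_add, map_smul, add_apply, smul_apply, smul_eq_mul, hsymm]
  rw [← hre]
  simp only [Complex.add_im, Complex.mul_im, Complex.mul_re, Complex.I_re, Complex.I_im,
    Complex.add_re]
  ring

/-- The critical point of the family at `t = 0` is a saddle point: the Hessian is negative in `θ`, and
positive on the graph of a small multiple of `Re f''_{yx}`. -/
lemma exists_isSaddle {Φ : ℝ → Cn n → ℝ}
    (S : Setting (fun z : Cn n × Cn n => φ z.1 z.2) x₀ y₀ η₀ (Φ 0))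
    (hΦ : SmoothNear (fun q : ℝ × Cn n => Φ q.1 q.2) (Ici (0 : ℝ) ×ˢ univ) (0, x₀)) :
    ∃ L c, IsSaddle (critFamily φ Φ) ((0, (y₀, η₀)), (x₀, 0)) L c := by
  set f : Cn n × Cn n → ℂ := fun z => φ z.1 z.2 with hf
  have hC : ContDiffAt ℂ 2 f (x₀, toC y₀) := S.holo.contDiffAt
  have hpt : toC y₀ + Complex.I • toC (0 : Rn n) = toC y₀ := by rw [toC_zero, smul_zero, add_zero]
  have hsm : ContDiffAt ℝ 2 (critFamily φ Φ) ((0, (y₀, η₀)), (x₀, 0)) :=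
    contDiffAt_critFamily S.holo hΦ
  obtain ⟨c₁, hc₁, hH⟩ := S.exists_hessian_weight_ge
  obtain ⟨c₂, hc₂, hA⟩ := S.exists_mixed_ge
  obtain ⟨c₃, hc₃, hyy⟩ := S.exists_yy_coercive
  have hyy : ∀ w : Rn n, c₃ * ‖w‖ ^ 2 ≤
      (fderiv ℂ (fderiv ℂ f) (x₀, toC y₀) (0, toC w) (0, toC w)).im := fun w => by
    have := hyy.self_of_nhds w
    rwa [hessian_imPhase hC] at this
  set D := fderiv ℂ (fderiv ℂ f) (x₀, toC y₀) with hD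
  set A := mixed f (x₀, toC y₀) with hA'
  -- the Hessian of the family in the variables `(x, θ)`
  have hess : ∀ v w, fderiv ℝ (fderiv ℝ (critFamily φ Φ)) ((0, (y₀, η₀)), (x₀, 0))
      (0, (v, w)) (0, (v, w)) = (fderiv ℝ (fderiv ℝ (Φ 0)) x₀ v v + (D (v, 0) (v, 0)).im) +
        2 * ∑ j, w j * reC (A v) j - (D (0, toC w) (0, toC w)).im := by
    intro v w
    have h1 := hessian_comp_affine (h := critFamily φ Φ) (a := ((0, (y₀, η₀)), 0))
      (ContinuousLinearMap.inr ℝ (ℝ × (Rn n × Rn n)) (Cn n × Rn n)) (u := (x₀, 0))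
      (by simpa using hsm) (v, w) (v, w)
    have h2 : (fun u => critFamily φ Φ (((0, (y₀, η₀)), 0) +
        ContinuousLinearMap.inr ℝ (ℝ × (Rn n × Rn n)) (Cn n × Rn n) u)) =
          critFun φ (Φ 0) y₀ η₀ := by
      ext u; simp [critFamily]
    rw [h2, S.hessian_critFun_base] at h1
    simpa using h1.symm
  set M := ‖D‖ with hM
  -- `L v = τ Re (A v)` makes the mixed term positive, and `τ ‖D‖ ≤ 1` keeps the quadratic term in `w`
  -- below it; the directions with `Re (A v) = 0` are covered by the Hessian bound for the weight
  set τ := 1 / (M + 1) with hτ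
  have hM0 : 0 ≤ M := norm_nonneg D
  have hτ0 : 0 < τ := by positivity
  have hτM : τ * M ≤ 1 := by
    rw [hτ, one_div, inv_mul_le_iff₀ (by positivity)]; linarith
  set reL : Cn n →L[ℝ] Rn n :=
    ContinuousLinearMap.pi fun j => Complex.reCLM.comp (ContinuousLinearMap.proj j)
  set c := min (min c₁ τ / 2 * c₂ ^ 2) c₃ with hc
  refine ⟨τ • reL.comp (A.restrictScalars ℝ), c, hsm, ?_, by positivity, ?_, ?_⟩
  · intro v
    have h1 := hasFDerivAt_critFun_of_family (hsm.differentiableAt (by norm_num))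
    have h2 := hasFDerivAt_critFun (φ := φ) (Φ₁ := Φ 0) (y := y₀) (η := η₀) (z := (x₀, 0))
      (by simp only [hpt]; exact hC.differentiableAt (by norm_num))
      (S.smooth.differentiableAt (by simp))
    simp only [zero_pow two_ne_zero] at h1
    have h3 := congrArg (fun l => l v) (h1.unique h2)
    simp only [ContinuousLinearMap.comp_apply, ContinuousLinearMap.inr_apply, add_apply, hpt] at h3
    rw [h3, ← hf]
    have h4 : shift n v = (v.1, 0) + (0, Complex.I • toC v.2) := by simp
    have h5 := im_fderiv_I_toC S.real v.2
    have h6 := S.fderiv_weight_base v.1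
    simp only [ContinuousLinearMap.coe_restrictScalars', Complex.imCLM_apply, h4, map_add,
      h5, h6, pairing_apply, ContinuousLinearMap.coe_fst']
    ring
  · intro v
    rw [hess]
    set r := reC (A v) with hr
    have e1 : (τ • reL.comp (A.restrictScalars ℝ)) v = τ • r := rfl
    rw [e1]
    have h1 := hH v
    have h2 : ∑ j, (τ • r) j * r j = τ * ∑ j, r j ^ 2 := by
      rw [Finset.mul_sum]
      refine Finset.sum_congr rfl fun j _ => ?_
      simp only [Pi.smul_apply, smul_eq_mul]; ring
    have h3 := sq_norm_le_sum_sq r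
    have h4 : (D (0, toC (τ • r)) (0, toC (τ • r))).im ≤ τ * ‖r‖ ^ 2 := by
      have e2 : ‖((0, toC (τ • r)) : Cn n × Cn n)‖ ≤ τ * ‖r‖ := by
        rw [Prod.norm_mk, norm_zero, max_eq_right (norm_nonneg _)]
        refine (pi_norm_le_iff_of_nonneg (by positivity)).2 fun j => ?_
        simp only [toC, Complex.norm_real, Pi.smul_apply, norm_smul, Real.norm_of_nonneg hτ0.le]
        gcongr
        exact norm_le_pi_norm r j
      calc _ ≤ ‖D (0, toC (τ • r)) (0, toC (τ • r))‖ :=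
            (le_abs_self _).trans (Complex.abs_im_le_norm _)
        _ ≤ M * (τ * ‖r‖) * (τ * ‖r‖) := (D.le_opNorm₂ _ _).trans (by gcongr)
        _ = (τ * M) * (τ * ‖r‖ ^ 2) := by ring
        _ ≤ 1 * (τ * ‖r‖ ^ 2) := by gcongr
        _ = _ := one_mul _
    have h5 : (c₂ * ‖v‖) ^ 2 ≤ (‖r‖ + ‖imC (A v)‖) ^ 2 := by
      gcongr
      exact (hA v).trans (norm_le_reC_add_imC _)
    have h6 : (‖r‖ + ‖imC (A v)‖) ^ 2 ≤ 2 * (‖r‖ ^ 2 + ‖imC (A v)‖ ^ 2) := by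
      nlinarith [sq_nonneg (‖r‖ - ‖imC (A v)‖)]
    have h7 : c * ‖v‖ ^ 2 ≤ min c₁ τ / 2 * c₂ ^ 2 * ‖v‖ ^ 2 := by
      gcongr; exact min_le_left _ _
    have h8 : min c₁ τ / 2 * (c₂ * ‖v‖) ^ 2 ≤
        min c₁ τ / 2 * (2 * (‖r‖ ^ 2 + ‖imC (A v)‖ ^ 2)) := by
      gcongr; exact h5.trans h6
    have h9 : min c₁ τ * ‖r‖ ^ 2 ≤ τ * ‖r‖ ^ 2 := by gcongr; exact min_le_right _ _
    have h10 : min c₁ τ * ‖imC (A v)‖ ^ 2 ≤ c₁ * ‖imC (A v)‖ ^ 2 := by gcongr; exact min_le_left _ _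
    have h11 : τ * ‖r‖ ^ 2 ≤ τ * ∑ j, r j ^ 2 := by gcongr
    rw [h2]
    nlinarith
  · intro w
    rw [hess]
    have h1 : c * ‖w‖ ^ 2 ≤ c₃ * ‖w‖ ^ 2 := by gcongr; exact min_le_right _ _
    have h2 := hyy w
    have h3 : ((0, 0) : Cn n × Cn n) = 0 := rfl
    have h4 : reC (0 : Cn n) = 0 := by ext j; simp [reC]
    simp only [map_zero, h3, h4, Pi.zero_apply, mul_zero, Finset.sum_const_zero,
      Complex.zero_im, add_zero, zero_sub]
    linarith

end Setting

end FBI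

namespace FBI

/-! ### Decay of the critical values -/

variable {n : ℕ} {φ : Cn n → Cn n → ℂ} {x₀ : Cn n} {y₀ η₀ : Rn n} {Φ : ℝ → Cn n → ℝ}

/-- At a real point of the chart, `(X(y, η), 0)` is critical in `θ`, with critical value
`Φ_t(x) - Φ₀(x)`, `x = X(y, η)`. -/
lemma ChartAt.critFun {X : Cn n × Cn n → Cn n} {ρ : Rn n × Rn n} {Φ₀ : Cn n → ℝ}
    (h : ChartAt (fun z : Cn n × Cn n => φ z.1 z.2) Φ₀ X ρ) {τ : ℝ}
    (hd : DifferentiableAt ℝ (critFamily φ Φ) ((τ, ρ), (X (toCC ρ), 0)))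
    (hΦ : DifferentiableAt ℝ (Φ (τ ^ 2)) (X (toCC ρ))) :
    (∀ w, fderiv ℝ (critFamily φ Φ) ((τ, ρ), (X (toCC ρ), 0)) (0, (0, w)) = 0) ∧
      critFamily φ Φ ((τ, ρ), (X (toCC ρ), 0)) = Φ (τ ^ 2) (X (toCC ρ)) - Φ₀ (X (toCC ρ)) := by
  have hpt : toC ρ.1 + Complex.I • toC (0 : Rn n) = toC ρ.1 := by rw [toC_zero, smul_zero, add_zero]
  constructor
  · intro w
    have h1 := hasFDerivAt_critFun_of_family hd
    have h2 := hasFDerivAt_critFun (φ := φ) (Φ₁ := Φ (τ ^ 2)) (y := ρ.1) (η := ρ.2)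
      (z := (X (toCC ρ), 0)) (by simp only [hpt]; exact h.holo.differentiableAt) hΦ
    have h3 := congrArg (fun l => l (0, w)) (h1.unique h2)
    simp only [ContinuousLinearMap.comp_apply, ContinuousLinearMap.inr_apply, add_apply, hpt] at h3
    rw [h3]
    have h4 := Setting.im_fderiv_I_toC h.critical w
    simp only [ContinuousLinearMap.coe_restrictScalars', Complex.imCLM_apply, shift_apply, h4,
      pairing_apply, ContinuousLinearMap.coe_fst', map_zero]
    ring
  · rw [h.weight]
    simp only [critFamily, FBI.critFun, hpt, Setting.imPhase, Pi.zero_apply, mul_zero,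
      Finset.sum_const_zero]
    ring

/-- The critical values exist. -/
theorem exists_isRealWeight {L : Cn n →L[ℝ] Rn n} {c : ℝ}
    (S : IsSaddle (critFamily φ Φ) ((0, (y₀, η₀)), (x₀, 0)) L c) :
    ∃ G, IsRealWeight φ x₀ y₀ η₀ Φ G := by
  obtain ⟨ψ, hψ, hcrit⟩ := S.exists_critical
  have hd := S.smooth.eventually (by simp)
  have hψ' : Tendsto (fun p => (p, ψ p)) (𝓝 (0, (y₀, η₀))) (𝓝 ((0, (y₀, η₀)), (x₀, 0))) :=
    tendsto_id.prodMk_nhds hψ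
  -- the critical point is a function of `τ = √t`
  refine ⟨fun t ρ => critFun φ (Φ t) ρ.1 ρ.2 (ψ (√t, ρ)), fun ε hε => ?_⟩
  have ht := tendsto_sqrt_halfNhds ((y₀, η₀) : Rn n × Rn n)
  filter_upwards [ht.eventually hcrit, ht.eventually (hψ'.eventually hd),
    ht.eventually (hψ.eventually (Metric.ball_mem_nhds _ hε)), self_mem_nhdsWithin]
    with q h1 h2 h3 h4
  have hsq : √q.1 ^ 2 = q.1 := Real.sq_sqrt h4.1
  refine ⟨ψ (√q.1, q.2), h3, ?_, rfl⟩
  have h5 := hasFDerivAt_critFun_of_family (h2.differentiableAt (by norm_num))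
  simp only [hsq] at h5
  exact h5.congr_fderiv (ContinuousLinearMap.ext fun v => h1 v)

/-- The critical values decay, by the minimax inequality with the competitor `(X(y, η), 0)`. -/
theorem IsRealWeight.exists_decay {G : ℝ → Rn n × Rn n → ℝ} (hG : IsRealWeight φ x₀ y₀ η₀ Φ G)
    {L : Cn n →L[ℝ] Rn n} {c : ℝ}
    (S : IsSaddle (critFamily φ Φ) ((0, (y₀, η₀)), (x₀, 0)) L c)
    (hΦ : SmoothNear (fun q : ℝ × Cn n => Φ q.1 q.2) (Ici (0 : ℝ) ×ˢ univ) (0, x₀))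
    {X : Cn n × Cn n → Cn n} (hX0 : X (toCC (y₀, η₀)) = x₀)
    (hX : ∀ᶠ ρ in 𝓝 (y₀, η₀), ChartAt (fun z : Cn n × Cn n => φ z.1 z.2) (Φ 0) X ρ) {k : ℕ}
    (hdecay : ∃ C > (0 : ℝ), ∀ᶠ q in halfNhds x₀, Φ q.1 q.2 ≤ Φ 0 q.2 - q.1 ^ (k + 1) / C) :
    ∃ C > (0 : ℝ), ∀ᶠ q in halfNhds (y₀, η₀), G q.1 q.2 ≤ -(q.1 ^ (k + 1) / C) := by
  obtain ⟨C, hC, hdecay⟩ := hdecay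
  obtain ⟨r, hr, hle⟩ := S.eventually_le
  obtain ⟨r', hr', hd⟩ := Metric.eventually_nhds_iff_ball.1 (S.smooth.eventually (by simp))
  have hXt : Tendsto (fun ρ => X (toCC ρ)) (𝓝 (y₀, η₀)) (𝓝 x₀) := by
    have h1 : ContinuousAt (fun ρ => X (toCC ρ)) (y₀, η₀) :=
      ContinuousAt.comp (g := X) (f := toCCL n) hX.self_of_nhds.smooth.continuousAt
        (toCCL n).continuous.continuousAt
    have h2 := h1.tendsto
    rwa [hX0] at h2
  set ε := min r r' with hε
  have hε0 : 0 < ε := by positivity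
  have ht := tendsto_sqrt_halfNhds ((y₀, η₀) : Rn n × Rn n)
  have hsnd : Tendsto Prod.snd (halfNhds ((y₀, η₀) : Rn n × Rn n)) (𝓝 (y₀, η₀)) :=
    continuous_snd.continuousAt.tendsto.mono_left nhdsWithin_le_nhds
  have hhalf : Tendsto (fun q : ℝ × (Rn n × Rn n) => (q.1, X (toCC q.2)))
      (halfNhds (y₀, η₀)) (halfNhds x₀) := by
    refine tendsto_nhdsWithin_iff.2 ⟨?_, ?_⟩
    · have h1 : Tendsto Prod.fst (halfNhds ((y₀, η₀) : Rn n × Rn n)) (𝓝 0) :=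
        continuous_fst.continuousAt.tendsto.mono_left nhdsWithin_le_nhds
      exact h1.prodMk_nhds (hXt.comp hsnd)
    · filter_upwards [self_mem_nhdsWithin] with q hq
      exact ⟨hq.1, mem_univ _⟩
  have hsqrt : Tendsto (fun q : ℝ × (Rn n × Rn n) => (√q.1, X (toCC q.2)))
      (halfNhds (y₀, η₀)) (𝓝 (0, x₀)) := (tendsto_sqrt_halfNhds x₀).comp hhalf
  refine ⟨C, hC, ?_⟩
  filter_upwards [hG ε hε0, ht.eventually (Metric.ball_mem_nhds _ hε0),
    hsqrt.eventually hΦ.eventually_contDiffAt_sq,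
    (hXt.comp hsnd).eventually (Metric.ball_mem_nhds _ hε0), hsnd.eventually hX,
    hhalf.eventually hdecay, self_mem_nhdsWithin] with q h1 h2 h3 h4 h5 h6 h7
  obtain ⟨z, hz, hcrit, hval⟩ := h1
  have hsq : √q.1 ^ 2 = q.1 := Real.sq_sqrt h7.1
  have hεr : ε ≤ r := min_le_left _ _
  have hεr' : ε ≤ r' := min_le_right _ _
  set u : Cn n × Rn n := (X (toCC q.2), 0) with hu
  have hub : u ∈ Metric.ball ((x₀, 0) : Cn n × Rn n) ε := by
    rw [← ball_prod_same]
    exact ⟨h4, Metric.mem_ball_self hε0⟩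
  have hdiff : ∀ z ∈ Metric.ball ((x₀, 0) : Cn n × Rn n) ε,
      DifferentiableAt ℝ (critFamily φ Φ) ((√q.1, q.2), z) := fun z hz =>
    (hd _ (by
      rw [← ball_prod_same]
      exact ⟨Metric.ball_subset_ball hεr' h2, Metric.ball_subset_ball hεr' hz⟩)).differentiableAt
        (by norm_num)
  have hΦd : DifferentiableAt ℝ (Φ (√q.1 ^ 2)) (X (toCC q.2)) :=
    DifferentiableAt.comp (g := fun q : ℝ × Cn n => Φ (q.1 ^ 2) q.2)
      (f := fun x : Cn n => (√q.1, x)) _ (h3.differentiableAt (by simp)) (by fun_prop)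
  obtain ⟨hu1, hu2⟩ := h5.critFun (hdiff u hub) hΦd
  have hcz : ∀ v, fderiv ℝ (critFamily φ Φ) ((√q.1, q.2), z) (0, v) = 0 := by
    intro v
    have e1 := hasFDerivAt_critFun_of_family (hdiff z hz)
    simp only [hsq] at e1
    exact congrArg (fun l => l v) (e1.unique hcrit)
  -- minimax: the critical value is at most the value `Φ_t(x) - Φ₀(x)` at the competitor
  have hmain := hle (√q.1, q.2) (Metric.ball_subset_ball hεr h2) z
    (Metric.ball_subset_ball hεr hz) hcz u (Metric.ball_subset_ball hεr hub) hu1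
  rw [hu2, hsq] at hmain
  have hval' : G q.1 q.2 = critFamily φ Φ ((√q.1, q.2), z) := by
    rw [hval]; simp only [critFamily, hsq]
  rw [hval']
  linarith

lemma SolvesHJ.smoothNear_zero {pt : Cn n × Cn n → ℂ} (h : SolvesHJ pt x₀ Φ) :
    SmoothNear (Φ 0) univ x₀ := by
  obtain ⟨U, hU, hs⟩ := h.1
  have hc : ContDiff ℝ ∞ fun x : Cn n => ((0 : ℝ), x) := by fun_prop
  have ht : Tendsto (fun x : Cn n => ((0 : ℝ), x)) (𝓝 x₀)
      (𝓝[Ici (0 : ℝ) ×ˢ (univ : Set (Cn n))] (0, x₀)) :=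
    tendsto_nhdsWithin_iff.2 ⟨hc.continuous.tendsto _,
      Eventually.of_forall fun x => ⟨mem_Ici.2 le_rfl, mem_univ _⟩⟩
  exact ⟨_, by rw [nhdsWithin_univ]; exact ht hU, hs.comp hc.contDiffOn fun x hx => hx⟩

end FBI

theorem proposition3p4 (n k : ℕ)
    (φ : FBI.Cn n → FBI.Cn n → ℂ) (x₀ ξ₀ : FBI.Cn n) (y₀ η₀ : FBI.Rn n)
    (hφ : FBI.IsFBIPhase φ x₀ y₀ η₀)
    (hξ₀ : ξ₀ = FBI.pd (fun x => φ x (FBI.toC y₀)) x₀)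
    (pt : FBI.Cn n × FBI.Cn n → ℂ) (p : FBI.Rn n × FBI.Rn n → ℂ)
    (Φ : ℝ → FBI.Cn n → ℝ)
    (hΦ₀ : FBI.IsFBIWeight φ x₀ y₀ (Φ 0))
    (hpt : FBI.IsAlmostHolo pt (FBI.LambdaSet (Φ 0)) (x₀, ξ₀))
    (hp : FBI.IsPullback φ x₀ ξ₀ y₀ η₀ pt p)
    (hpos : ∀ᶠ ρ in 𝓝 (y₀, η₀), 0 ≤ (p ρ).re)
    (hzero : ∀ j < k,
      (FBI.hamD (fun ρ => (p ρ).im))^[j] (fun ρ => (p ρ).re) (y₀, η₀) = 0)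
    (hk : 0 < (FBI.hamD (fun ρ => (p ρ).im))^[k] (fun ρ => (p ρ).re) (y₀, η₀))
    (hΦ : FBI.SolvesHJ pt x₀ Φ) :
    ((∃ G : ℝ → FBI.Rn n × FBI.Rn n → ℝ, FBI.IsRealWeight φ x₀ y₀ η₀ Φ G) ∧
      ∀ G : ℝ → FBI.Rn n × FBI.Rn n → ℝ, FBI.IsRealWeight φ x₀ y₀ η₀ Φ G →
        ∃ C > (0 : ℝ), ∀ᶠ q in FBI.halfNhds (y₀, η₀), G q.1 q.2 ≤ -(q.1 ^ (k + 1) / C)) ∧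
    (∃ C > (0 : ℝ), ∀ᶠ q in FBI.halfNhds x₀, Φ q.1 q.2 ≤ Φ 0 q.2 - q.1 ^ (k + 1) / C) ∧
    (∀ (Ψ : ℝ → FBI.Cn n → FBI.Cn n → ℂ) (a : ℝ → ℝ → FBI.Cn n → FBI.Cn n → ℂ),
      FBI.IsSemigroupPhase pt x₀ (Φ 0) Ψ → FBI.IsBoundedAmplitude x₀ a →
      ∀ δ > (0 : ℝ), ∃ r > (0 : ℝ), ∃ C > (0 : ℝ), ∃ h₀ > (0 : ℝ),
        ∀ V W : Set (FBI.Cn n), IsOpen V → IsOpen W → W ⊆ V → V ⊆ Metric.ball x₀ r →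
        ∀ h ∈ Ioc 0 h₀, ∀ t ∈ Icc 0 (h ^ δ), ∀ u ∈ FBI.HSpace (Φ 0) h V,
          FBI.wNorm (Φ 0) h W (FBI.semigroupOp (Φ 0) Ψ a V h t u) ≤
            ENNReal.ofReal (C * Real.exp (-(t ^ (k + 1) / (C * h)))) *
              FBI.wNorm (Φ 0) h V u) := by
  set f : FBI.Cn n × FBI.Cn n → ℂ := fun z => φ z.1 z.2
  have S : FBI.Setting f x₀ y₀ η₀ (Φ 0) := hφ.setting hΦ₀ hΦ.contDiffAt_zero
  have hξ : ξ₀ = FBI.gradX f (x₀, FBI.toC y₀) :=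
    hξ₀.trans (FBI.pd_left (f := f) S.holo.differentiableAt)
  have P := hpt.symbol
  obtain ⟨X, hX0, hX, hsurj⟩ := S.exists_chart
  have hF : FBI.HasFootpoints (Φ 0) pt x₀ k :=
    S.hasFootpoints hξ P hX0 hX hsurj (hp.eventually_eq hξ hX0 hX) hpos hk
  have hdecay := hΦ.exists_decay hF
  obtain ⟨L, c, hsaddle⟩ := S.exists_isSaddle hΦ.1
  refine ⟨⟨FBI.exists_isRealWeight hsaddle,
    fun G hG => hG.exists_decay hsaddle hΦ.1 hX0 hX hdecay⟩, hdecay, fun Ψ a hΨ ha δ hδ => ?_⟩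
  have hsm := hΦ.smoothNear_zero
  obtain ⟨c₀, hc₀, hlevi⟩ := S.exists_levi_ge
  obtain ⟨c₁, hc₁, hinit⟩ := hΨ.exists_phaseDefect_zero_ge hsm hc₀ hlevi
  exact hΨ.exists_wNorm_le hsm (S.wcov_base.trans hξ.symm)
    (P.smooth.self_of_nhds.of_le (by simp)) hF hc₁ hinit ha hδ
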